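/- Let $\mu$ be a Radon measure on a $\sigma$-compact locally compact Hausdorff space $X$, let $(\mathcal M_x,\mathcal H_x)_{x\in X}$ be a $\mu$-measurable field of tracial von Neumann algebras over $X$ (for almost every $x$, $\mathcal M_x\subset B(\mathcal H_x)$ has a faithful normal tracial state), and let $\mathcal M=\int_X^{\oplus}\mathcal M_x\,d\mu(x)$, acting on $\mathcal H=\int_X^{\oplus}\mathcal H_x\,d\mu(x)$. Let $\tau$ be a faithful normal tracial state on $\mathcal M$, let $B$ be a countable group, and let $B\curvearrowright^{\alpha,c}(\mathcal M,\tau)$ be a cocycle action; that is, $\alpha_g$ $(g\in B)$ are $\tau$-preserving $*$-automorphisms of $\mathcal M$ and $c(g,h)$ $(g,h\in B)$ are unitaries of $\mathcal M$ such that $\alpha_g\alpha_h=\mathrm{Ad}(c(g,h))\,\alpha_{gh}$, $c(g,h)c(gh,k)=\alpha_g(c(h,k))c(g,hk)$ and $c(g,e)=c(e,g)=1$ for all $g,h,k\in B$. Assume that every $\alpha_g$ acts trivially on the diagonal algebra $L^\infty(X,\mu)\subset\mathcal M$. For a cocycle action $(\alpha,c)$ of $B$ on a tracial von Neumann algebra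 $\mathcal M\subset B(\mathcal H)$, the cocycle crossed product $\mathcal M\rtimes_{\alpha,c}B$ is the von Neumann algebra on $\ell^2(B,\mathcal H)$ generated by the copies $(a\xi)(h)=\alpha_h^{-1}(a)\xi(h)$ of the elements $a\in\mathcal M$ and the canonical unitaries $(u_g\xi)(k)=\alpha_k^{-1}(c(g,g^{-1}k))\,\xi(g^{-1}k)$, $g\in B$; they satisfy $u_gau_g^*=\alpha_g(a)$ and $u_gu_h=c(g,h)u_{gh}$. Then: 1. There is a measurable field $(\alpha_{\cdot,x},c_x)_{x}$ of cocycle actions of $B$ on $\mathcal M_x$, defined for almost every $x$, such that $\alpha_g=\int_X^{\oplus}\alpha_{g,x}\,d\mu(x)$ and $c(g,h)=\int_X^{\oplus}c_x(g,h)\,d\mu(x)$ for all $g,h\in B$. (The action $(\alpha_{\cdot,x},c_x)$ preserves some faithful normal tracial state of $\mathcal M_x$.) 2. For every such field, $x\mapsto\mathcal M_x\rtimes_{\alpha_{\cdot,x},c_x}B$ is a measurable field of von Neumann algebras on the field $x\mapsto\ell^2(B,\mathcal H_x)$, and there is a $*$-isomorphism $$\Phi:\ \mathcal M\rtimes_{\alpha,c}B\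 \longrightarrow\ \int_X^{\oplus}\mathcal M_x\rtimes_{\alpha_{\cdot,x},c_x}B\,d\mu(x)$$ such that $\Phi\bigl(\int_X^{\oplus}a_x\,d\mu(x)\bigr)=\int_X^{\oplus}a_x\,d\mu(x)$ (copies of $a\in\mathcal M$ and of $a_x\in\mathcal M_x$ in the crossed products) and $\Phi(u_g)=\int_X^{\oplus}u_g\,d\mu(x)$ for all $a=\int_X^\oplus a_x\,d\mu(x)\in\mathcal M$ and $g\in B$. -/

import Mathlib

open MeasureTheory Filter Topology
open scoped ENNReal ComplexInnerProductSpace ComplexOrder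

universe u v w

noncomputable section

/-- The von Neumann algebra generated by a set `S` of operators: the double commutant of
`S ∪ S*`. -/
def generatedVonNeumannAlgebra {K : Type u} [NormedAddCommGroup K] [InnerProductSpace ℂ K]
    [CompleteSpace K] (S : Set (K →L[ℂ] K)) : VonNeumannAlgebra K where
  toStarSubalgebra := StarSubalgebra.centralizer ℂ (StarSubalgebra.centralizer ℂ S : Set _)
  centralizer_centralizer' := by
    change Set.centralizer (Set.centralizer (Set.centralizer _)) = Set.centralizer _
    rw [Set.centralizer_centralizer_centralizer]

/-- A `μ`-measurable field of Hilbert spaces over `X`: a collection `(H x)` of Hilbert spaces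
together with a space of measurable sections. Measurability of scalar functions is
`μ`-measurability, that is, `AEMeasurable`. -/
structure HilbertField {X : Type u} [MeasurableSpace X] (μ : Measure X) (H : X → Type v)
    [∀ x, NormedAddCommGroup (H x)] [∀ x, InnerProductSpace ℂ (H x)] where
  /-- the measurable sections -/
  sections : Submodule ℂ (∀ x, H x)
  mem_sections_iff : ∀ η : ∀ x, H x,
    η ∈ sections ↔ ∀ ζ ∈ sections, AEMeasurable (fun x => ⟪ζ x, η x⟫) μ
  exists_total : ∃ ζ : ℕ → ∀ x, H x, (∀ n, ζ n ∈ sections) ∧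
    ∀ᵐ x ∂μ, (Submodule.span ℂ (Set.range fun n => ζ n x)).topologicalClosure = ⊤

namespace HilbertField

variable {X : Type u} [MeasurableSpace X] {μ : Measure X} {H : X → Type v}
  [∀ x, NormedAddCommGroup (H x)] [∀ x, InnerProductSpace ℂ (H x)]

theorem aemeasurable_inner (F : HilbertField μ H) {ζ η : ∀ x, H x} (hζ : ζ ∈ F.sections)
    (hη : η ∈ F.sections) : AEMeasurable (fun x => ⟪ζ x, η x⟫) μ :=
  (F.mem_sections_iff η).1 hη ζ hζ

theorem aemeasurable_norm (F : HilbertField μ H) {ζ : ∀ x, H x} (hζ : ζ ∈ F.sections) :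
    AEMeasurable (fun x => ‖ζ x‖) μ := by
  have h := (F.aemeasurable_inner hζ hζ).norm.sqrt
  refine h.congr (Eventually.of_forall fun x => ?_)
  simp [inner_self_eq_norm_sq_to_K]

theorem memLp_norm (F : HilbertField μ H) {ζ : ∀ x, H x} (hζ : ζ ∈ F.sections)
    (hi : Integrable (fun x => ‖ζ x‖ ^ 2) μ) : MemLp (fun x => ‖ζ x‖) 2 μ :=
  (memLp_two_iff_integrable_sq (F.aemeasurable_norm hζ).aestronglyMeasurable).2 hi

theorem integrable_inner (F : HilbertField μ H) {ζ η : ∀ x, H x} (hζ : ζ ∈ F.sections)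
    (hη : η ∈ F.sections) (hi : Integrable (fun x => ‖ζ x‖ ^ 2) μ)
    (hi' : Integrable (fun x => ‖η x‖ ^ 2) μ) : Integrable (fun x => ⟪ζ x, η x⟫) μ := by
  refine (hi.add hi').mono' (F.aemeasurable_inner hζ hη).aestronglyMeasurable
    (Eventually.of_forall fun x => ?_)
  have := norm_inner_le_norm (𝕜 := ℂ) (ζ x) (η x)
  simp only [Pi.add_apply]
  nlinarith [sq_nonneg (‖ζ x‖ - ‖η x‖), sq_nonneg (‖ζ x‖), sq_nonneg (‖η x‖)]

/-- The square integrable measurable sections. -/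
def squareIntegrable (F : HilbertField μ H) : Submodule ℂ (∀ x, H x) where
  carrier := {ζ | ζ ∈ F.sections ∧ Integrable (fun x => ‖ζ x‖ ^ 2) μ}
  zero_mem' := ⟨F.sections.zero_mem, by simp⟩
  add_mem' := by
    rintro ζ η ⟨hζ, hi⟩ ⟨hη, hi'⟩
    refine ⟨F.sections.add_mem hζ hη, ?_⟩
    refine ((hi.add hi').const_mul 2).mono'
      ((F.aemeasurable_norm (F.sections.add_mem hζ hη)).pow_const 2).aestronglyMeasurable
      (Eventually.of_forall fun x => ?_)
    have h1 : ‖ζ x + η x‖ ≤ ‖ζ x‖ + ‖η x‖ := norm_add_le _ _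
    have h0 := norm_nonneg (ζ x + η x)
    simp only [Pi.add_apply, norm_pow, norm_norm]
    nlinarith [sq_nonneg (‖ζ x‖ - ‖η x‖)]
  smul_mem' := by
    rintro c ζ ⟨hζ, hi⟩
    refine ⟨F.sections.smul_mem c hζ, ?_⟩
    simpa [norm_smul, mul_pow] using hi.const_mul (‖c‖ ^ 2)

/-- The type of square integrable measurable sections, with the seminorm
`‖ζ‖ = (∫ ‖ζ x‖² dμ)^(1/2)`. -/
def L2 (F : HilbertField μ H) : Type (max u v) := F.squareIntegrable

namespace L2

variable {F : HilbertField μ H}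

instance : AddCommGroup F.L2 := inferInstanceAs (AddCommGroup F.squareIntegrable)

instance : Module ℂ F.L2 := inferInstanceAs (Module ℂ F.squareIntegrable)

/-- The section underlying an element of `F.L2`. -/
def toSection : F.L2 →ₗ[ℂ] ∀ x, H x := F.squareIntegrable.subtype

instance : CoeFun F.L2 fun _ => ∀ x, H x := ⟨fun ζ => toSection ζ⟩

/-- A square integrable measurable section, as an element of `F.L2`. -/
def of (ζ : ∀ x, H x) (h : ζ ∈ F.squareIntegrable) : F.L2 := ⟨ζ, h⟩

@[simp]
theorem of_apply (ζ : ∀ x, H x) (h : ζ ∈ F.squareIntegrable) (x : X) :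
    (of ζ h : F.L2) x = ζ x := rfl

theorem mem_squareIntegrable (ζ : F.L2) : toSection ζ ∈ F.squareIntegrable := ζ.2

@[simp]
theorem add_apply (ζ η : F.L2) (x : X) : (ζ + η) x = ζ x + η x := rfl

@[simp]
theorem sub_apply (ζ η : F.L2) (x : X) : (ζ - η) x = ζ x - η x := rfl

@[simp]
theorem smul_apply (c : ℂ) (ζ : F.L2) (x : X) : (c • ζ) x = c • ζ x := rfl

theorem mem_sections (ζ : F.L2) : toSection ζ ∈ F.sections := ζ.2.1

theorem integrable (ζ : F.L2) : Integrable (fun x => ‖ζ x‖ ^ 2) μ := ζ.2.2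

theorem integrable_inner (ζ η : F.L2) : Integrable (fun x => ⟪ζ x, η x⟫) μ :=
  F.integrable_inner ζ.mem_sections η.mem_sections ζ.integrable η.integrable

theorem integral_inner_self (ζ : F.L2) :
    (∫ x, ⟪ζ x, ζ x⟫ ∂μ) = ((∫ x, ‖ζ x‖ ^ 2 ∂μ : ℝ) : ℂ) := by
  rw [← integral_complex_ofReal]
  simp [inner_self_eq_norm_sq_to_K]

instance core : PreInnerProductSpace.Core ℂ F.L2 where
  inner ζ η := ∫ x, ⟪ζ x, η x⟫ ∂μ
  conj_inner_symm ζ η := by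
    rw [← integral_conj]
    simp only [inner_conj_symm]
  re_inner_nonneg ζ := by
    rw [integral_inner_self]
    simpa using integral_nonneg fun x => sq_nonneg (‖ζ x‖)
  add_left ζ η θ := by
    rw [← integral_add (integrable_inner ζ θ) (integrable_inner η θ)]
    exact integral_congr_ae (Eventually.of_forall fun x => inner_add_left (ζ x) (η x) (θ x))
  smul_left ζ η r := by
    rw [← integral_const_mul]
    exact integral_congr_ae (Eventually.of_forall fun x => inner_smul_left (ζ x) (η x) r)

instance : SeminormedAddCommGroup F.L2 :=
  InnerProductSpace.Core.toSeminormedAddCommGroup (𝕜 := ℂ)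

instance : InnerProductSpace ℂ F.L2 := InnerProductSpace.ofCore core

theorem inner_def (ζ η : F.L2) : ⟪ζ, η⟫ = ∫ x, ⟪ζ x, η x⟫ ∂μ := rfl

theorem norm_sq_eq (ζ : F.L2) : ‖ζ‖ ^ 2 = ∫ x, ‖ζ x‖ ^ 2 ∂μ := by
  rw [norm_sq_eq_re_inner (𝕜 := ℂ), inner_def, integral_inner_self]
  simp

end L2

/-- The direct integral `∫ H x dμ(x)`: square integrable measurable sections up to null sets
(see `mk_eq_mk_iff`), with inner product `∫ ⟪ζ x, η x⟫ dμ(x)` (see `inner_mk_mk`). -/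
def DirectIntegral (F : HilbertField μ H) : Type (max u v) := SeparationQuotient F.L2

namespace DirectIntegral

variable {F : HilbertField μ H}

instance : NormedAddCommGroup F.DirectIntegral :=
  inferInstanceAs (NormedAddCommGroup (SeparationQuotient F.L2))

instance : InnerProductSpace ℂ F.DirectIntegral :=
  inferInstanceAs (InnerProductSpace ℂ (SeparationQuotient F.L2))

/-- The class of a square integrable section. -/
def mk (ζ : F.L2) : F.DirectIntegral := SeparationQuotient.mk ζ

theorem mk_surjective : Function.Surjective (mk : F.L2 → F.DirectIntegral) :=
  SeparationQuotient.surjective_mk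

theorem inner_mk_mk (ζ η : F.L2) : ⟪mk ζ, mk η⟫ = ∫ x, ⟪ζ x, η x⟫ ∂μ := rfl

theorem norm_mk (ζ : F.L2) : ‖mk ζ‖ = ‖ζ‖ := SeparationQuotient.norm_mk ζ

theorem mk_add (ζ η : F.L2) : mk (ζ + η) = mk ζ + mk η := rfl

theorem mk_sub (ζ η : F.L2) : mk (ζ - η) = mk ζ - mk η := rfl

theorem mk_smul (c : ℂ) (ζ : F.L2) : mk (c • ζ) = c • mk ζ := rfl

theorem mk_eq_mk_iff (ζ η : F.L2) : mk ζ = mk η ↔ ∀ᵐ x ∂μ, ζ x = η x := by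
  rw [← sub_eq_zero, ← mk_sub, ← norm_eq_zero, norm_mk, ← sq_eq_zero_iff, L2.norm_sq_eq,
    integral_eq_zero_iff_of_nonneg (fun x => sq_nonneg _) (L2.integrable _)]
  refine eventually_congr (Eventually.of_forall fun x => ?_)
  simp [sub_eq_zero]

instance [∀ x, CompleteSpace (H x)] : CompleteSpace F.DirectIntegral := by
  refine NormedAddCommGroup.completeSpace_of_summable_imp_tendsto fun u hu => ?_
  choose f hf using fun n => mk_surjective (u n)
  have hmem n : MemLp (fun x => ‖f n x‖) 2 μ :=
    F.memLp_norm (f n).mem_sections (f n).integrable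
  let G : ℕ → Lp ℝ 2 μ := fun n => (hmem n).toLp
  have normLp (g : Lp ℝ 2 μ) : ‖g‖ ^ 2 = ∫ x, ‖g x‖ ^ 2 ∂μ := by
    have h := MeasureTheory.L2.inner_def (𝕜 := ℝ) g g
    rw [real_inner_self_eq_norm_sq] at h
    rw [h]
    simp
  have hG n : ‖G n‖ = ‖u n‖ := by
    rw [← hf n, norm_mk, ← sq_eq_sq₀ (norm_nonneg _) (norm_nonneg _), L2.norm_sq_eq, normLp]
    refine integral_congr_ae ?_
    filter_upwards [(hmem n).coeFn_toLp] with x hx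
    simp [G, hx]
  have hGs : Summable fun n => ‖G n‖ := by simpa only [hG] using hu
  have hGe (N : ℕ) : ∑' n, ‖G (n + N)‖ₑ ≠ ∞ := by
    rw [tsum_enorm_ne_top_iff_summable_norm]
    exact (summable_nat_add_iff N).2 hGs
  have hae : ∀ᵐ x ∂μ, ∀ N, HasSum (fun n => ‖f (n + N) x‖) ((∑' n, G (n + N) : Lp ℝ 2 μ) x) := by
    rw [ae_all_iff]
    intro N
    have h2 : ∀ᵐ x ∂μ, ∀ n, G n x = ‖f n x‖ := ae_all_iff.2 fun n => (hmem n).coeFn_toLp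
    filter_upwards [Lp.hasSum_coeFn_tsum (hGe N), h2] with x hx h2
    simpa only [h2] using hx
  let S : ∀ x, H x := fun x => ∑' n, f n x
  have hS : S ∈ F.sections := by
    refine (F.mem_sections_iff S).2 fun ζ hζ => ?_
    refine aemeasurable_of_tendsto_metrizable_ae atTop
      (f := fun N x => ∑ n ∈ Finset.range N, ⟪ζ x, f n x⟫)
      (fun N => Finset.aemeasurable_fun_sum _ fun n _ =>
        F.aemeasurable_inner hζ (f n).mem_sections) ?_
    filter_upwards [hae] with x hx
    have h1 : Summable fun n => f n x := Summable.of_norm (by simpa using (hx 0).summable)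
    have h2 := h1.hasSum.tendsto_sum_nat
    simpa [inner_sum] using (tendsto_const_nhds (x := ζ x)).inner (𝕜 := ℂ) h2
  have hbd (N : ℕ) : ∀ᵐ x ∂μ, ‖S x - ∑ n ∈ Finset.range N, f n x‖ ≤
      ‖(∑' n, G (n + N) : Lp ℝ 2 μ) x‖ := by
    filter_upwards [hae] with x hx
    have h1 : Summable fun n => f n x := Summable.of_norm (by simpa using (hx 0).summable)
    have h3 : S x - ∑ n ∈ Finset.range N, f n x = ∑' n, f (n + N) x :=
      sub_eq_of_eq_add' (h1.sum_add_tsum_nat_add N).symm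
    rw [h3, ← (hx N).tsum_eq]
    exact (norm_tsum_le_tsum_norm (hx N).summable).trans (le_abs_self _)
  have hS2 : S ∈ F.squareIntegrable := by
    refine ⟨hS, ?_⟩
    have h := (memLp_two_iff_integrable_sq (Lp.aestronglyMeasurable _)).1
      (Lp.memLp (∑' n, G (n + 0) : Lp ℝ 2 μ))
    refine h.mono' ((F.aemeasurable_norm hS).pow_const 2).aestronglyMeasurable ?_
    filter_upwards [hbd 0] with x hx
    simp only [Finset.range_zero, Finset.sum_empty, sub_zero] at hx
    rw [norm_pow, norm_norm, ← sq_abs ((∑' n, G (n + 0) : Lp ℝ 2 μ) x)]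
    exact pow_le_pow_left₀ (norm_nonneg _) hx 2
  have hcoe (N : ℕ) (x : X) :
      L2.toSection (∑ n ∈ Finset.range N, f n) x = ∑ n ∈ Finset.range N, f n x := by
    rw [map_sum, Finset.sum_apply]
  have hmk (N : ℕ) : mk (∑ n ∈ Finset.range N, f n) = ∑ n ∈ Finset.range N, u n := by
    induction N with
    | zero => rfl
    | succ N ih => rw [Finset.sum_range_succ, Finset.sum_range_succ, mk_add, ih, hf]
  refine ⟨mk (L2.of S hS2), ?_⟩
  rw [tendsto_iff_norm_sub_tendsto_zero]
  refine squeeze_zero (fun N => norm_nonneg _) (fun N => ?_)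
    (tendsto_sum_nat_add fun n => ‖G n‖)
  have h1 : ‖∑ n ∈ Finset.range N, u n - mk (L2.of S hS2)‖ ≤ ‖(∑' n, G (n + N) : Lp ℝ 2 μ)‖ := by
    rw [norm_sub_rev, ← hmk, ← mk_sub, norm_mk,
      ← sq_le_sq₀ (norm_nonneg _) (norm_nonneg _), L2.norm_sq_eq, normLp]
    refine integral_mono_ae (L2.integrable _)
      (by simpa using (memLp_two_iff_integrable_sq (Lp.aestronglyMeasurable _)).1 (Lp.memLp _)) ?_
    filter_upwards [hbd N] with x hx
    refine pow_le_pow_left₀ (norm_nonneg _) ?_ 2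
    rw [← hcoe] at hx
    exact hx
  exact h1.trans (norm_tsum_le_tsum_norm ((summable_nat_add_iff N).2 hGs))

end DirectIntegral

/-- A measurable (essentially bounded) field of operators. -/
structure IsMeasurableOperatorField (F : HilbertField μ H) (T : ∀ x, H x →L[ℂ] H x) : Prop where
  aemeasurable : ∀ ξ ∈ F.sections, ∀ η ∈ F.sections,
    AEMeasurable (fun x => ⟪T x (ξ x), η x⟫) μ
  bounded : ∃ C : ℝ, ∀ᵐ x ∂μ, ‖T x‖ ≤ C

namespace IsMeasurableOperatorField

variable {F : HilbertField μ H} {T S : ∀ x, H x →L[ℂ] H x}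

theorem apply_mem_sections (hT : F.IsMeasurableOperatorField T) {ξ : ∀ x, H x}
    (hξ : ξ ∈ F.sections) : (fun x => T x (ξ x)) ∈ F.sections := by
  refine (F.mem_sections_iff _).2 fun ζ hζ => ?_
  have h := Complex.continuous_conj.measurable.comp_aemeasurable (hT.aemeasurable ξ hξ ζ hζ)
  refine h.congr (Eventually.of_forall fun x => ?_)
  exact inner_conj_symm (𝕜 := ℂ) (ζ x) (T x (ξ x))

theorem apply_mem_squareIntegrable (hT : F.IsMeasurableOperatorField T) {ξ : ∀ x, H x}
    (hξ : ξ ∈ F.squareIntegrable) : (fun x => T x (ξ x)) ∈ F.squareIntegrable := by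
  refine ⟨hT.apply_mem_sections hξ.1, ?_⟩
  obtain ⟨C, hC⟩ := hT.bounded
  refine (hξ.2.const_mul (C ^ 2)).mono'
    ((F.aemeasurable_norm (hT.apply_mem_sections hξ.1)).pow_const 2).aestronglyMeasurable ?_
  filter_upwards [hC] with x hx
  rw [norm_pow, norm_norm, ← mul_pow]
  exact pow_le_pow_left₀ (norm_nonneg _)
    (((T x).le_opNorm _).trans (mul_le_mul_of_nonneg_right hx (norm_nonneg _))) 2

/-- The square integrable section `x ↦ T x (ζ x)`. -/
def apply (hT : F.IsMeasurableOperatorField T) (ζ : F.L2) : F.L2 :=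
  L2.of (fun x => T x (ζ x)) (hT.apply_mem_squareIntegrable ζ.mem_squareIntegrable)

@[simp]
theorem apply_apply (hT : F.IsMeasurableOperatorField T) (ζ : F.L2) (x : X) :
    hT.apply ζ x = T x (ζ x) := rfl

theorem mul (hT : F.IsMeasurableOperatorField T) (hS : F.IsMeasurableOperatorField S) :
    F.IsMeasurableOperatorField (fun x => T x * S x) := by
  refine ⟨fun ξ hξ η hη => hT.aemeasurable _ (hS.apply_mem_sections hξ) η hη, ?_⟩
  obtain ⟨C, hC⟩ := hT.bounded
  obtain ⟨D, hD⟩ := hS.bounded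
  refine ⟨C * D, ?_⟩
  filter_upwards [hC, hD] with x h1 h2
  exact (norm_mul_le _ _).trans (mul_le_mul h1 h2 (norm_nonneg _) ((norm_nonneg _).trans h1))

theorem add (hT : F.IsMeasurableOperatorField T) (hS : F.IsMeasurableOperatorField S) :
    F.IsMeasurableOperatorField (fun x => T x + S x) := by
  refine ⟨fun ξ hξ η hη => ?_, ?_⟩
  · refine ((hT.aemeasurable ξ hξ η hη).add (hS.aemeasurable ξ hξ η hη)).congr
      (Eventually.of_forall fun x => ?_)
    exact (inner_add_left (T x (ξ x)) (S x (ξ x)) (η x)).symm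
  obtain ⟨C, hC⟩ := hT.bounded
  obtain ⟨D, hD⟩ := hS.bounded
  refine ⟨C + D, ?_⟩
  filter_upwards [hC, hD] with x h1 h2
  exact (norm_add_le _ _).trans (add_le_add h1 h2)

theorem smul_one (F : HilbertField μ H) (r : ℂ) :
    F.IsMeasurableOperatorField (fun x => r • (1 : H x →L[ℂ] H x)) := by
  refine ⟨fun ξ hξ η hη => F.aemeasurable_inner (F.sections.smul_mem r hξ) hη, ‖r‖, ?_⟩
  refine Eventually.of_forall fun x => ?_
  rw [norm_smul]
  exact mul_le_of_le_one_right (norm_nonneg _) ContinuousLinearMap.norm_id_le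

theorem star [∀ x, CompleteSpace (H x)] (hT : F.IsMeasurableOperatorField T) :
    F.IsMeasurableOperatorField (fun x => star (T x)) := by
  refine ⟨fun ξ hξ η hη => ?_, ?_⟩
  · refine (F.aemeasurable_inner hξ (hT.apply_mem_sections hη)).congr
      (Eventually.of_forall fun x => ?_)
    exact (ContinuousLinearMap.adjoint_inner_left (T x) (η x) (ξ x)).symm
  · obtain ⟨C, hC⟩ := hT.bounded
    exact ⟨C, hC.mono fun x hx => by rwa [norm_star]⟩

end IsMeasurableOperatorField

/-- `F.IsDirectIntegral A T` says that `(T x)` is a measurable field of operators and that the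
operator `A` on the direct integral is `∫ T x dμ(x)`, i.e. it maps the class of a section `ζ` to
the class of `x ↦ T x (ζ x)`. -/
def IsDirectIntegral (F : HilbertField μ H) (A : F.DirectIntegral →L[ℂ] F.DirectIntegral)
    (T : ∀ x, H x →L[ℂ] H x) : Prop :=
  ∃ hT : F.IsMeasurableOperatorField T, ∀ ζ : F.L2,
    A (DirectIntegral.mk ζ) = DirectIntegral.mk (hT.apply ζ)

/-- A measurable field of von Neumann algebras: almost every fiber is generated, as a von Neumann
algebra, by the values of one sequence of measurable fields of operators. -/
def IsMeasurableAlgebraField [∀ x, CompleteSpace (H x)] (F : HilbertField μ H)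
    (M : ∀ x, VonNeumannAlgebra (H x)) : Prop :=
  ∃ a : ℕ → ∀ x, H x →L[ℂ] H x, (∀ n, F.IsMeasurableOperatorField (a n)) ∧
    ∀ᵐ x ∂μ, M x = generatedVonNeumannAlgebra (Set.range fun n => a n x)

/-- The direct integral `∫ M x dμ(x)` of von Neumann algebras: the algebra of the decomposable
operators `∫ T x dμ(x)` with `T x ∈ M x` for almost every `x`. -/
def integralAlgebra [∀ x, CompleteSpace (H x)] (F : HilbertField μ H)
    (M : ∀ x, VonNeumannAlgebra (H x)) :
    StarSubalgebra ℂ (F.DirectIntegral →L[ℂ] F.DirectIntegral) where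
  carrier := {A | ∃ T : ∀ x, H x →L[ℂ] H x, F.IsDirectIntegral A T ∧ ∀ᵐ x ∂μ, T x ∈ M x}
  mul_mem' := by
    rintro A A' ⟨T, ⟨hT, h⟩, hM⟩ ⟨T', ⟨hT', h'⟩, hM'⟩
    refine ⟨fun x => T x * T' x, ⟨hT.mul hT', fun ζ => ?_⟩, ?_⟩
    · change A (A' _) = _
      rw [h', h]
      rfl
    · filter_upwards [hM, hM'] with x h1 h2 using mul_mem h1 h2
  add_mem' := by
    rintro A A' ⟨T, ⟨hT, h⟩, hM⟩ ⟨T', ⟨hT', h'⟩, hM'⟩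
    refine ⟨fun x => T x + T' x, ⟨hT.add hT', fun ζ => ?_⟩, ?_⟩
    · change A _ + A' _ = _
      rw [h', h]
      rfl
    · filter_upwards [hM, hM'] with x h1 h2 using add_mem h1 h2
  algebraMap_mem' r := by
    refine ⟨fun x => r • 1, ⟨.smul_one F r, fun ζ => rfl⟩, Eventually.of_forall fun x => ?_⟩
    have h := (M x).toStarSubalgebra.algebraMap_mem r
    rwa [Algebra.algebraMap_eq_smul_one] at h
  star_mem' := by
    rintro A ⟨T, ⟨hT, h⟩, hM⟩
    refine ⟨fun x => star (T x), ⟨hT.star, fun ζ => ?_⟩, ?_⟩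
    · refine ext_inner_right ℂ fun v => ?_
      obtain ⟨η, rfl⟩ := DirectIntegral.mk_surjective v
      rw [ContinuousLinearMap.star_eq_adjoint, ContinuousLinearMap.adjoint_inner_left, h,
        DirectIntegral.inner_mk_mk, DirectIntegral.inner_mk_mk]
      refine integral_congr_ae (Eventually.of_forall fun x => ?_)
      exact (ContinuousLinearMap.adjoint_inner_left (T x) (η x) (ζ x)).symm
    · filter_upwards [hM] with x h1 using star_mem h1

/-- The field of Hilbert spaces `x ↦ ℓ²(B, H x) = H x ⊗ ℓ²(B)`, whose measurable sections are
those with measurable coordinates. -/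
def ellTwo [∀ x, CompleteSpace (H x)] (F : HilbertField μ H) (B : Type w) [Countable B] :
    HilbertField μ (fun x => lp (fun _ : B => H x) 2) where
  sections :=
    { carrier := {ξ | ∀ b, (fun x => ξ x b) ∈ F.sections}
      zero_mem' := fun _ => F.sections.zero_mem
      add_mem' := fun h h' b => F.sections.add_mem (h b) (h' b)
      smul_mem' := fun c _ h b => F.sections.smul_mem c (h b) }
  mem_sections_iff η := by
    classical
    constructor
    · intro hη ζ hζ
      simp only [lp.inner_eq_tsum]
      have hs (x : X) : HasSum (fun b => ⟪ζ x b, η x b⟫) (∑' b, ⟪ζ x b, η x b⟫) :=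
        lp.hasSum_inner (ζ x) (η x)
      exact aemeasurable_of_tendsto_metrizable_ae
        (u := (atTop : Filter (Finset B))) (f := fun s x => ∑ b ∈ s, ⟪ζ x b, η x b⟫)
        (fun s => Finset.aemeasurable_fun_sum _ fun b _ => F.aemeasurable_inner (hζ b) (hη b))
        (Eventually.of_forall fun x => hs x)
    · intro h b
      refine (F.mem_sections_iff _).2 fun ζ hζ => ?_
      have h1 := h (fun x => lp.single 2 b (ζ x)) fun b' => ?_
      · simpa only [lp.inner_single_left] using h1
      · by_cases hb : b' = b
        · subst hb
          simpa using hζ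
        · have h0 : (fun _ => 0 : ∀ x, H x) ∈ F.sections := F.sections.zero_mem
          simpa only [lp.coeFn_single, Pi.single_eq_of_ne hb] using h0
  exists_total := by
    classical
    obtain ⟨ζ, hζ, ht⟩ := F.exists_total
    cases isEmpty_or_nonempty B with
    | inl hB =>
      refine ⟨fun _ _ => 0, fun _ b => F.sections.zero_mem, Eventually.of_forall fun x => ?_⟩
      refine (Submodule.eq_top_iff'.2 fun v => ?_)
      have : v = 0 := lp.ext (funext fun b => hB.elim b)
      rw [this]
      exact Submodule.zero_mem _
    | inr hB =>
      obtain ⟨e, he⟩ := exists_surjective_nat (ℕ × B)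
      refine ⟨fun n x => lp.single 2 (e n).2 (ζ (e n).1 x), fun n b => ?_, ?_⟩
      · by_cases hb : b = (e n).2
        · subst hb
          simpa using hζ (e n).1
        · have h0 : (fun _ => 0 : ∀ x, H x) ∈ F.sections := F.sections.zero_mem
          simpa only [lp.coeFn_single, Pi.single_eq_of_ne hb] using h0
      · filter_upwards [ht] with x hx
        rw [Submodule.topologicalClosure_eq_top_iff, Submodule.eq_bot_iff] at hx ⊢
        intro v hv
        refine lp.ext (funext fun b => ?_)
        refine hx (v b) ((Submodule.mem_orthogonal _ _).2 fun u hu => ?_)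
        induction hu using Submodule.span_induction with
        | mem u hu =>
          obtain ⟨n, rfl⟩ := hu
          obtain ⟨m, hm⟩ := he (n, b)
          have h := (Submodule.mem_orthogonal _ _).1 hv _ (Submodule.subset_span ⟨m, rfl⟩)
          simpa [hm, lp.inner_single_left] using h
        | zero => simp
        | add u w _ _ h1 h2 => rw [inner_add_left, h1, h2, add_zero]
        | smul c u _ h1 => rw [inner_smul_left, h1, mul_zero]

end HilbertField

section CocycleActions

variable {B : Type w} [Group B] {K : Type u} [NormedAddCommGroup K] [InnerProductSpace ℂ K]
  [CompleteSpace K] {M : StarSubalgebra ℂ (K →L[ℂ] K)}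

/-- A faithful normal tracial state on a von Neumann algebra `M` of operators on `K`. Normality
is `σ`-weak continuity: `τ` is of the form `a ↦ ∑ ⟪ξ n, a (η n)⟫`, with square summable sequences
of vectors. -/
structure IsTracialState (τ : M →ₗ[ℂ] ℂ) : Prop where
  map_one : τ 1 = 1
  nonneg : ∀ a, 0 ≤ τ (star a * a)
  faithful : ∀ a, τ (star a * a) = 0 → a = 0
  trace : ∀ a b, τ (a * b) = τ (b * a)
  normal : ∃ ξ η : ℕ → K, Summable (fun n => ‖ξ n‖ ^ 2) ∧ Summable (fun n => ‖η n‖ ^ 2) ∧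
    ∀ a : M, HasSum (fun n => ⟪ξ n, (a : K →L[ℂ] K) (η n)⟫) (τ a)

/-- A cocycle action `(α, c)` of the group `B` on the tracial von Neumann algebra `(M, τ)`. -/
structure IsCocycleAction (τ : M →ₗ[ℂ] ℂ) (α : B → (M ≃⋆ₐ[ℂ] M)) (c : B → B → unitary M) :
    Prop where
  trace_preserving : ∀ g a, τ (α g a) = τ a
  map_map : ∀ g h a, α g (α h a) = (c g h : M) * α (g * h) a * star (c g h : M)
  cocycle : ∀ g h k, (c g h : M) * (c (g * h) k : M) = α g (c h k : M) * (c g (h * k) : M)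
  right_one : ∀ g, c g 1 = 1
  left_one : ∀ g, c 1 g = 1

/-- `T` is the copy in the crossed product of `a ∈ M`: in terms of the formal expansion of
`ξ ∈ ℓ²(B, K)` as `∑ u_h ξ(h)`, we have `a u_h = u_h α_h⁻¹(a)`. -/
def IsCopy (α : B → (M ≃⋆ₐ[ℂ] M)) (a : M)
    (T : lp (fun _ : B => K) 2 →L[ℂ] lp (fun _ : B => K) 2) : Prop :=
  ∀ ξ h, T ξ h = ((α h).symm a : K →L[ℂ] K) (ξ h)

/-- `T` is the canonical unitary `u_g` of the crossed product: in terms of the formal expansion of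
`ξ ∈ ℓ²(B, K)` as `∑ u_h ξ(h)`, we have `u_g u_h = c(g, h) u_{gh} = u_{gh} α_{gh}⁻¹(c(g, h))`. -/
def IsCanonicalUnitary (α : B → (M ≃⋆ₐ[ℂ] M)) (c : B → B → unitary M) (g : B)
    (T : lp (fun _ : B => K) 2 →L[ℂ] lp (fun _ : B => K) 2) : Prop :=
  ∀ ξ k, T ξ k = ((α k).symm (c g (g⁻¹ * k) : M) : K →L[ℂ] K) (ξ (g⁻¹ * k))

/-- The cocycle crossed product `M ⋊_{α,c} B`, in its regular representation on
`ℓ²(B, K) = K ⊗ ℓ²(B)`: the von Neumann algebra generated by the copy of `M` and the canonical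
unitaries. -/
def cocycleCrossedProduct (α : B → (M ≃⋆ₐ[ℂ] M)) (c : B → B → unitary M) :
    VonNeumannAlgebra (lp (fun _ : B => K) 2) :=
  generatedVonNeumannAlgebra ({T | ∃ a, IsCopy α a T} ∪ {T | ∃ g, IsCanonicalUnitary α c g T})

end CocycleActions

namespace HilbertField

variable {X : Type u} [MeasurableSpace X] {μ : Measure X} {H : X → Type v}
  [∀ x, NormedAddCommGroup (H x)] [∀ x, InnerProductSpace ℂ (H x)] [∀ x, CompleteSpace (H x)]
  {B : Type w} [Group B]

/-- A measurable field of cocycle actions of `B` on the fibers `M x`, the fibers outside a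
conull set being irrelevant. -/
structure IsCocycleActionField (F : HilbertField μ H) (M : ∀ x, VonNeumannAlgebra (H x))
    (α : ∀ x, B → ((M x).toStarSubalgebra ≃⋆ₐ[ℂ] (M x).toStarSubalgebra))
    (c : ∀ x, B → B → unitary (M x).toStarSubalgebra) : Prop where
  isCocycleAction : ∀ᵐ x ∂μ, ∃ τ : (M x).toStarSubalgebra →ₗ[ℂ] ℂ,
    IsTracialState τ ∧ IsCocycleAction τ (α x) (c x)
  measurable_automorphism : ∀ g, ∀ T : ∀ x, (M x).toStarSubalgebra,
    F.IsMeasurableOperatorField (fun x => (T x : H x →L[ℂ] H x)) →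
      F.IsMeasurableOperatorField (fun x => (α x g (T x) : H x →L[ℂ] H x))
  measurable_cocycle : ∀ g h, ∀ ξ ∈ F.sections, ∀ η ∈ F.sections,
    AEMeasurable (fun x => ⟪((c x g h : (M x).toStarSubalgebra) : H x →L[ℂ] H x) (ξ x), η x⟫) μ

/-- `(α', c')` is an integral decomposition of the cocycle action `(α, c)` on `∫ M x dμ(x)`:
it is a measurable field of cocycle actions with `α g = ∫ α' x g dμ(x)` and
`c g h = ∫ c' x g h dμ(x)`. -/
structure IsCocycleDecomposition (F : HilbertField μ H) (M : ∀ x, VonNeumannAlgebra (H x))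
    (α : B → (F.integralAlgebra M ≃⋆ₐ[ℂ] F.integralAlgebra M))
    (c : B → B → unitary (F.integralAlgebra M))
    (α' : ∀ x, B → ((M x).toStarSubalgebra ≃⋆ₐ[ℂ] (M x).toStarSubalgebra))
    (c' : ∀ x, B → B → unitary (M x).toStarSubalgebra) : Prop where
  field : F.IsCocycleActionField M α' c'
  automorphism : ∀ g, ∀ a : F.integralAlgebra M, ∀ T : ∀ x, (M x).toStarSubalgebra,
    F.IsDirectIntegral a (fun x => (T x : H x →L[ℂ] H x)) →
      F.IsDirectIntegral (α g a) (fun x => (α' x g (T x) : H x →L[ℂ] H x))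
  cocycle : ∀ g h, F.IsDirectIntegral ((c g h : F.integralAlgebra M) : _ →L[ℂ] _)
    (fun x => ((c' x g h : (M x).toStarSubalgebra) : H x →L[ℂ] H x))

/-- The automorphism `α` of `∫ M x dμ(x)` fixes `L^∞(X, μ)`, the algebra of diagonal operators
`∫ f(x) 1 dμ(x)`. -/
def FixesDiagonal (F : HilbertField μ H) (M : ∀ x, VonNeumannAlgebra (H x))
    (α : F.integralAlgebra M ≃⋆ₐ[ℂ] F.integralAlgebra M) : Prop :=
  ∀ f : X → ℂ, MemLp f ∞ μ → ∀ a : F.integralAlgebra M,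
    F.IsDirectIntegral a (fun x => f x • (1 : H x →L[ℂ] H x)) → α a = a

end HilbertField

end

/-! Existence of the decomposition. A normal trace on `∫ M x` is given by square summable sequences
of vectors, hence by sections, and these give normal functionals `ψ x` on the fibers with `φ = ∫ ψ
x` (`exists_isFunctionalIntegral`). Fix a countable set `S` of decomposable operators which contains
generators and all `c g h` and is stable under the algebraic operations, a dense sequence of
scalars, every `α g` and its inverse. Countably many identities hold simultaneously at almost every
`x`: fiber values respect the operations on `S` (`ae_isFiberMap`), and `ψ x` is tracial, positive
and `α`-invariant on them. The last three are obtained by testing against indicator functions, which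
are central and, for invariance, fixed by `α g`.

Faithfulness of `ψ x` does not follow from countably many identities. If it failed on a set of
positive measure, a measurable selection would glue fiber witnesses into a bounded sequence `p k` in
`∫ M x` with `φ (star (p k) * p k) → 0` that does not tend strongly to zero. This contradicts
faithfulness of the global trace (`IsNormalTrace.tendsto_norm_apply`, `ae_not_forall_exists`).

On a good fiber the pairs formed by the values of `a` and `α g a`, `a ∈ S`, have equal traces, and
both coordinates generate `M x`. Kaplansky's density theorem and weak compactness extend this
partial graph to a trace preserving automorphism (`IsNormalTrace.exists_automorphism`). That
automorphism is characterized by its pairing with `S` under `ψ x`. The same characterization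
transfers the cocycle identities to the fiber and shows that the fiber automorphisms integrate to `α
g`.

The crossed product. Taking coordinates identifies `∫ ℓ²(B, H x)` with `ℓ²(B, ∫ H x)`
(`exists_ellTwo_equiv`), and `Φ` is conjugation by this unitary. Copies of `M` and canonical
unitaries are weighted shifts with decomposable weights, so they are carried to direct integrals of
their fiber counterparts. To see that the algebras correspond, two facts are needed. First, the
direct integral of a measurable field is generated by a sequence of generating fields together with
the diagonal algebra (`mem_integralAlgebra_iff`), because the commutant of the diagonal algebra
consists of the decomposable operators. Second, the fiber crossed products are generated by the
copies of countably many elements and the canonical unitaries (`crossedCopy_mem_generated`), because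
trace preserving automorphisms are weakly continuous on bounded sets. The diagonal operators on `∫
ℓ²(B, H x)` are themselves copies of elements of `∫ M x`, so they add nothing. -/

noncomputable section

/-! ### Weighted shifts and amplifications on `ℓ²(ι, K)`. -/

section LpOperators

variable {ι : Type w} {K : Type u} [NormedAddCommGroup K]

theorem memlp_two_iff_summable_sq (f : ι → K) :
    Memℓp f 2 ↔ Summable fun i => ‖f i‖ ^ 2 := by
  rw [memℓp_gen_iff (by norm_num)]
  simp

theorem lp_summable_sq (ξ : lp (fun _ : ι => K) 2) : Summable fun i => ‖ξ i‖ ^ 2 :=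
  (memlp_two_iff_summable_sq _).1 (lp.memℓp ξ)

theorem lp_norm_sq_eq_tsum (ξ : lp (fun _ : ι => K) 2) : ‖ξ‖ ^ 2 = ∑' i, ‖ξ i‖ ^ 2 := by
  have h := lp.norm_rpow_eq_tsum (p := 2) (by norm_num) ξ
  simpa using h

variable [InnerProductSpace ℂ K]

/-- The operator `ξ ↦ (k ↦ a k (ξ (σ k)))` on `ℓ²(ι, K)`. -/
def weightedShift (σ : ι ≃ ι) (a : ι → K →L[ℂ] K) (C : ℝ) (h : ∀ i, ‖a i‖ ≤ C) :
    lp (fun _ : ι => K) 2 →L[ℂ] lp (fun _ : ι => K) 2 :=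
  have key (ξ : lp (fun _ : ι => K) 2) (i : ι) :
      ‖a i (ξ (σ i))‖ ^ 2 ≤ C ^ 2 * ‖ξ (σ i)‖ ^ 2 := by
    rw [← mul_pow]
    exact pow_le_pow_left₀ (norm_nonneg _)
      (((a i).le_opNorm _).trans (mul_le_mul_of_nonneg_right (h i) (norm_nonneg _))) 2
  have hs (ξ : lp (fun _ : ι => K) 2) : Summable fun i => C ^ 2 * ‖ξ (σ i)‖ ^ 2 :=
    ((σ.summable_iff (f := fun i => ‖ξ i‖ ^ 2)).2 (lp_summable_sq ξ)).mul_left _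
  LinearMap.mkContinuous
    { toFun := fun ξ => ⟨fun i => a i (ξ (σ i)), (memlp_two_iff_summable_sq _).2
        (Summable.of_nonneg_of_le (fun i => sq_nonneg _) (key ξ) (hs ξ))⟩
      map_add' := fun ξ η => lp.ext (funext fun i => by simp; rfl)
      map_smul' := fun c ξ => lp.ext (funext fun i => by simp) }
    -- `C` may be negative when `ι` is empty, hence the absolute value.
    |C| fun ξ => by
      rw [← sq_le_sq₀ (norm_nonneg _) (by positivity), lp_norm_sq_eq_tsum, mul_pow, sq_abs,
        lp_norm_sq_eq_tsum, ← σ.tsum_eq (fun i => ‖ξ i‖ ^ 2), ← tsum_mul_left]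
      exact (Summable.of_nonneg_of_le (fun i => sq_nonneg _) (key ξ) (hs ξ)).tsum_le_tsum
        (key ξ) (hs ξ)

@[simp]
theorem weightedShift_apply (σ : ι ≃ ι) (a : ι → K →L[ℂ] K) (C : ℝ) (h : ∀ i, ‖a i‖ ≤ C)
    (ξ : lp (fun _ : ι => K) 2) (i : ι) : weightedShift σ a C h ξ i = a i (ξ (σ i)) := rfl

theorem norm_weightedShift_le (σ : ι ≃ ι) (a : ι → K →L[ℂ] K) (C : ℝ) (h : ∀ i, ‖a i‖ ≤ C) :
    ‖weightedShift σ a C h‖ ≤ |C| := by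
  unfold weightedShift
  exact LinearMap.mkContinuous_norm_le _ (abs_nonneg _) _

/-- The diagonal amplification `a ⊗ 1` of an operator to `ℓ²(ι, K)`. -/
def amplification (ι : Type w) (a : K →L[ℂ] K) :
    lp (fun _ : ι => K) 2 →L[ℂ] lp (fun _ : ι => K) 2 :=
  weightedShift (Equiv.refl ι) (fun _ => a) ‖a‖ fun _ => le_rfl

@[simp]
theorem amplification_apply (a : K →L[ℂ] K) (ξ : lp (fun _ : ι => K) 2) (i : ι) :
    amplification ι a ξ i = a (ξ i) := rfl

/-- The `i`-th coordinate of `ℓ²(ι, K)`. -/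
def lpCoord (i : ι) : lp (fun _ : ι => K) 2 →L[ℂ] K :=
  LinearMap.mkContinuous
    { toFun := fun ξ => ξ i
      map_add' := fun _ _ => rfl
      map_smul' := fun _ _ => rfl } 1 fun ξ => by
      rw [one_mul]
      exact lp.norm_apply_le_norm (by norm_num) ξ i

@[simp]
theorem lpCoord_apply (i : ι) (ξ : lp (fun _ : ι => K) 2) : lpCoord i ξ = ξ i := rfl

omit [InnerProductSpace ℂ K] in
theorem lp_hasSum_single [DecidableEq ι] (ξ : lp (fun _ : ι => K) 2) :
    HasSum (fun i => lp.single 2 i (ξ i)) ξ :=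
  lp.hasSum_single (by norm_num) ξ

/-- The inclusion of the `i`-th summand in `ℓ²(ι, K)`. -/
def lpIncl [DecidableEq ι] (i : ι) : K →L[ℂ] lp (fun _ : ι => K) 2 :=
  LinearMap.mkContinuous
    { toFun := fun v => lp.single 2 i v
      map_add' := fun v w => by simp
      map_smul' := fun c v => by simp } 1 fun v => by
      rw [one_mul]
      exact (lp.norm_single (E := fun _ : ι => K) (p := 2) (by norm_num) i v).le

@[simp]
theorem lpIncl_apply [DecidableEq ι] (i : ι) (v : K) :
    lpIncl (ι := ι) i v = lp.single 2 i v := rfl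

theorem amplification_single [DecidableEq ι] (a : K →L[ℂ] K) (i : ι) (v : K) :
    amplification ι a (lp.single 2 i v) = lp.single 2 i (a v) := by
  refine lp.ext (funext fun j => ?_)
  by_cases hj : j = i
  · subst hj; simp
  · simp [hj]

end LpOperators

/-! ### The double commutant theorem in `σ`-strong form. -/

section DoubleCommutant

variable {K : Type u} [NormedAddCommGroup K] [InnerProductSpace ℂ K] [CompleteSpace K]

/-- The commutant of a set together with its adjoints is closed under adjoints, so commutation with
`b` already contains commutation with `star b`. -/
theorem mem_generatedVonNeumannAlgebra_iff {S : Set (K →L[ℂ] K)} {a : K →L[ℂ] K} :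
    a ∈ generatedVonNeumannAlgebra S ↔
      ∀ b : K →L[ℂ] K, (∀ s ∈ S, b * s = s * b ∧ b * star s = star s * b) → b * a = a * b := by
  have h0 (b : K →L[ℂ] K) : b ∈ StarSubalgebra.centralizer ℂ S ↔
      ∀ s ∈ S, b * s = s * b ∧ b * star s = star s * b := by
    rw [StarSubalgebra.mem_centralizer_iff]
    exact forall₂_congr fun s _ => by rw [eq_comm, and_congr_right_iff]; intro _; rw [eq_comm]
  change a ∈ StarSubalgebra.centralizer ℂ (StarSubalgebra.centralizer ℂ S : Set (K →L[ℂ] K)) ↔ _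
  rw [StarSubalgebra.mem_centralizer_iff]
  constructor
  · intro h b hb
    exact (h b ((h0 b).2 hb)).1
  · intro h g hg
    refine ⟨h g ((h0 g).1 hg), h (star g) ((h0 _).1 (star_mem hg))⟩

theorem subset_generatedVonNeumannAlgebra (S : Set (K →L[ℂ] K)) {a : K →L[ℂ] K} (ha : a ∈ S) :
    a ∈ generatedVonNeumannAlgebra S :=
  mem_generatedVonNeumannAlgebra_iff.2 fun _ hb => (hb a ha).1

/-- Membership in a von Neumann algebra is commutation with the commutant. -/
theorem VonNeumannAlgebra.mem_iff_forall_commutant (M : VonNeumannAlgebra K) {a : K →L[ℂ] K} :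
    a ∈ M ↔ ∀ b ∈ M.commutant, b * a = a * b := by
  conv_lhs => rw [← M.commutant_commutant]
  rw [VonNeumannAlgebra.mem_commutant_iff]

theorem generatedVonNeumannAlgebra_le {S : Set (K →L[ℂ] K)} (M : VonNeumannAlgebra K)
    (h : S ⊆ M) {a : K →L[ℂ] K} (ha : a ∈ generatedVonNeumannAlgebra S) : a ∈ M := by
  rw [M.mem_iff_forall_commutant]
  intro b hb
  refine mem_generatedVonNeumannAlgebra_iff.1 ha b fun s hs => ?_
  have h1 := VonNeumannAlgebra.mem_commutant_iff.1 hb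
  exact ⟨(h1 s (h hs)).symm, (h1 _ (star_mem (h hs))).symm⟩

theorem generatedVonNeumannAlgebra_mono {S T : Set (K →L[ℂ] K)}
    (h : ∀ s ∈ S, s ∈ generatedVonNeumannAlgebra T) {a : K →L[ℂ] K}
    (ha : a ∈ generatedVonNeumannAlgebra S) : a ∈ generatedVonNeumannAlgebra T :=
  generatedVonNeumannAlgebra_le _ h ha

theorem mem_generatedVonNeumannAlgebra_starSubalgebra_iff {A : StarSubalgebra ℂ (K →L[ℂ] K)}
    {a : K →L[ℂ] K} : a ∈ generatedVonNeumannAlgebra (A : Set (K →L[ℂ] K)) ↔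
      ∀ b : K →L[ℂ] K, (∀ s ∈ A, b * s = s * b) → b * a = a * b := by
  rw [mem_generatedVonNeumannAlgebra_iff]
  refine forall_congr' fun b => imp_congr_left ?_
  exact ⟨fun h s hs => (h s hs).1, fun h s hs => ⟨h s hs, h _ (star_mem hs)⟩⟩

theorem generatedVonNeumannAlgebra_adjoin (S : Set (K →L[ℂ] K)) :
    generatedVonNeumannAlgebra (StarAlgebra.adjoin ℂ S : Set (K →L[ℂ] K)) =
      generatedVonNeumannAlgebra S := by
  refine VonNeumannAlgebra.ext fun a => ⟨fun h => ?_, fun h => ?_⟩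
  · refine generatedVonNeumannAlgebra_le _ ?_ h
    exact StarAlgebra.adjoin_le (S := (generatedVonNeumannAlgebra S).toStarSubalgebra)
      fun s hs => subset_generatedVonNeumannAlgebra S hs
  · exact generatedVonNeumannAlgebra_mono (fun s hs => subset_generatedVonNeumannAlgebra _
      (StarAlgebra.subset_adjoin ℂ S hs)) h

theorem star_amplification (ι : Type w) (a : K →L[ℂ] K) :
    star (amplification ι a) = amplification ι (star a) := by
  rw [ContinuousLinearMap.star_eq_adjoint, eq_comm, ContinuousLinearMap.eq_adjoint_iff]
  intro ξ η
  rw [lp.inner_eq_tsum, lp.inner_eq_tsum]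
  exact tsum_congr fun i => ContinuousLinearMap.adjoint_inner_left a (η i) (ξ i)

/-- An operator in the double commutant of `A` maps `η ∈ ℓ²(ι, K)` into the closure of
`(A ⊗ 1) η`. -/
theorem amplification_mem_closure {A : StarSubalgebra ℂ (K →L[ℂ] K)} {a : K →L[ℂ] K}
    (ha : a ∈ generatedVonNeumannAlgebra (A : Set (K →L[ℂ] K))) {ι : Type w}
    (η : lp (fun _ : ι => K) 2) :
    amplification ι a η ∈ closure {x | ∃ p ∈ A, amplification ι p η = x} := by
  classical
  let V0 : Submodule ℂ (lp (fun _ : ι => K) 2) :=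
    { carrier := {x | ∃ p ∈ A, amplification ι p η = x}
      zero_mem' := ⟨0, zero_mem A, lp.ext (funext fun i => by simp)⟩
      add_mem' := by
        rintro _ _ ⟨p, hp, rfl⟩ ⟨q, hq, rfl⟩
        exact ⟨p + q, add_mem hp hq, lp.ext (funext fun i => by simp)⟩
      smul_mem' := by
        rintro z _ ⟨p, hp, rfl⟩
        exact ⟨z • p, A.smul_mem hp z, lp.ext (funext fun i => by simp)⟩ }
  let V := V0.topologicalClosure
  change amplification ι a η ∈ V
  have hinv (p) (hp : p ∈ A) (x) (hx : x ∈ V) : amplification ι p x ∈ V := by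
    have hm : Set.MapsTo (amplification ι p) (V0 : Set (lp (fun _ : ι => K) 2)) V0 := by
      rintro _ ⟨q, hq, rfl⟩
      exact ⟨p * q, mul_mem hp hq, lp.ext (funext fun i => by simp)⟩
    exact hm.closure (amplification ι p).continuous hx
  have hη : η ∈ V :=
    V0.le_topologicalClosure ⟨1, one_mem A, lp.ext (funext fun i => by simp)⟩
  -- Since `V` is invariant under the amplifications of `A` and of their adjoints, its projection
  -- commutes with them.
  let P := V.starProjection
  have hcomm (p) (hp : p ∈ A) (x) : P (amplification ι p x) = amplification ι p (P x) := by
    refine Submodule.eq_starProjection_of_mem_of_inner_eq_zero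
      (hinv p hp _ (V.starProjection_apply_mem x)) fun w hw => ?_
    rw [← map_sub, ← ContinuousLinearMap.adjoint_inner_right, ← ContinuousLinearMap.star_eq_adjoint,
      star_amplification]
    exact Submodule.starProjection_inner_eq_zero x _ (hinv _ (star_mem hp) w hw)
  -- Each matrix entry of `P` lies in the commutant of `A`, so it commutes with `a`. This avoids
  -- computing the commutant of the amplified algebra.
  have hentry (i j : ι) : (lpCoord i ∘L P ∘L lpIncl j) * a = a * (lpCoord i ∘L P ∘L lpIncl j) := by
    refine mem_generatedVonNeumannAlgebra_starSubalgebra_iff.1 ha _ fun p hp => ?_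
    ext v
    have h := congrArg (lpCoord i) (hcomm p hp (lp.single 2 j v))
    rw [amplification_single] at h
    simpa using h
  have hsingle (j : ι) (v : K) :
      P (amplification ι a (lp.single 2 j v)) = amplification ι a (P (lp.single 2 j v)) := by
    refine lp.ext (funext fun i => ?_)
    have h := congrArg (fun T : K →L[ℂ] K => T v) (hentry i j)
    rw [amplification_single]
    simpa using h
  -- Commutation of `P` with the amplification of `a`, known on vectors with one coordinate, passes
  -- to `η` by continuity.
  have h1 := ((lp_hasSum_single η).mapL (P ∘L amplification ι a)).unique
    (f := fun i => (P ∘L amplification ι a) (lp.single 2 i (η i)))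
    (((lp_hasSum_single η).mapL (amplification ι a ∘L P)).congr_fun ?_)
  · have h2 : P η = η := Submodule.starProjection_eq_self_iff.2 hη
    simp only [ContinuousLinearMap.comp_apply] at h1
    rw [h2] at h1
    rw [← h1]
    exact V.starProjection_apply_mem _
  · intro i
    exact hsingle i _

/-- A normal functional vanishing on a unital `*`-algebra vanishes on its double commutant. -/
theorem tsum_inner_eq_zero_of_mem {A : StarSubalgebra ℂ (K →L[ℂ] K)} {a : K →L[ℂ] K}
    (ha : a ∈ generatedVonNeumannAlgebra (A : Set (K →L[ℂ] K))) {ι : Type w} {ξ η : ι → K}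
    (hξ : Summable fun i => ‖ξ i‖ ^ 2) (hη : Summable fun i => ‖η i‖ ^ 2)
    (h : ∀ p ∈ A, ∑' i, ⟪ξ i, p (η i)⟫ = 0) : ∑' i, ⟪ξ i, a (η i)⟫ = 0 := by
  let ξ' : lp (fun _ : ι => K) 2 := ⟨ξ, (memlp_two_iff_summable_sq _).2 hξ⟩
  let η' : lp (fun _ : ι => K) 2 := ⟨η, (memlp_two_iff_summable_sq _).2 hη⟩
  -- The functional is evaluation on `η'` after amplification, followed by the pairing with `ξ'`, so
  -- it vanishes on a closed set of vectors.
  have hcl : IsClosed {x : lp (fun _ : ι => K) 2 | ⟪ξ', x⟫ = 0} :=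
    isClosed_eq (by fun_prop) continuous_const
  have := closure_minimal (s := {x | ∃ p ∈ A, amplification ι p η' = x}) ?_ hcl
    (amplification_mem_closure ha η')
  · change ⟪ξ', amplification ι a η'⟫ = 0 at this
    rwa [lp.inner_eq_tsum] at this
  · rintro _ ⟨p, hp, rfl⟩
    change ⟪ξ', amplification ι p η'⟫ = 0
    rw [lp.inner_eq_tsum]
    exact h p hp

end DoubleCommutant

/-! ### Strong-`*` density, Kaplansky density and weak compactness. -/

section Density

variable {K : Type u} [NormedAddCommGroup K] [InnerProductSpace ℂ K] [CompleteSpace K]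

attribute [local instance] InnerProductSpace.complexToReal in
/-- A unital `*`-algebra is strong-`*` dense in its double commutant. -/
theorem exists_mem_norm_sub_lt_and_star {A : StarSubalgebra ℂ (K →L[ℂ] K)} {a : K →L[ℂ] K}
    (ha : a ∈ generatedVonNeumannAlgebra (A : Set (K →L[ℂ] K))) {ι : Type w} [Fintype ι]
    (u : ι → K) {ε : ℝ} (hε : 0 < ε) :
    ∃ p ∈ A, ∀ i, ‖p (u i) - a (u i)‖ < ε ∧ ‖star p (u i) - star a (u i)‖ < ε := by
  -- The adjoint makes this map only real linear, so density is tested with the real inner product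
  -- and a real subspace.
  let ev : (K →L[ℂ] K) → PiLp 2 (fun _ : ι ⊕ ι => K) := fun p =>
    WithLp.toLp 2 (Sum.elim (fun i => p (u i)) (fun i => star p (u i)))
  let V : Submodule ℝ (PiLp 2 (fun _ : ι ⊕ ι => K)) :=
    { carrier := {x | ∃ p ∈ A, ev p = x}
      zero_mem' := ⟨0, zero_mem A, by ext i; rcases i with i | i <;> simp [ev]⟩
      add_mem' := by
        rintro _ _ ⟨p, hp, rfl⟩ ⟨q, hq, rfl⟩
        exact ⟨p + q, add_mem hp hq, by ext i; rcases i with i | i <;> simp [ev]⟩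
      smul_mem' := by
        rintro z _ ⟨p, hp, rfl⟩
        refine ⟨(z : ℂ) • p, A.smul_mem hp z, ?_⟩
        ext i
        rcases i with i | i
        · simp [ev]
        · simp [ev, star_smul] }
  -- Under the real part, `⟪y, star p u⟫` may be replaced by `⟪u, p y⟫`. The pairing with `y`
  -- becomes the real part of a complex linear normal functional of `p`.
  have hinner (y : PiLp 2 (fun _ : ι ⊕ ι => K)) (p : K →L[ℂ] K) :
      inner ℝ y (ev p) = (∑' j : ι ⊕ ι, ⟪(Sum.elim (fun i => y (Sum.inl i)) u : ι ⊕ ι → K) j,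
        p ((Sum.elim u (fun i => y (Sum.inr i)) : ι ⊕ ι → K) j)⟫).re := by
    change (⟪y, ev p⟫).re = _
    rw [tsum_fintype, PiLp.inner_apply, Complex.re_sum, Complex.re_sum,
      Fintype.sum_sum_type, Fintype.sum_sum_type]
    congr 1
    refine Finset.sum_congr rfl fun i _ => ?_
    simp only [ev, Sum.elim_inr]
    change (⟪y (Sum.inr i), star p (u i)⟫).re = _
    rw [ContinuousLinearMap.star_eq_adjoint, ContinuousLinearMap.adjoint_inner_right,
      ← inner_conj_symm, Complex.conj_re]
  have hmem : ev a ∈ V.topologicalClosure := by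
    rw [← Submodule.orthogonal_orthogonal_eq_closure, Submodule.mem_orthogonal]
    intro y hy
    rw [hinner, tsum_inner_eq_zero_of_mem ha (summable_of_hasFiniteSupport (Set.toFinite _))
      (summable_of_hasFiniteSupport (Set.toFinite _))]
    · simp
    intro p hp
    have h1 (q) (hq : q ∈ A) := ((hinner y q).symm.trans (real_inner_comm _ _)).trans
      ((Submodule.mem_orthogonal _ _).1 hy (ev q) ⟨q, hq, rfl⟩)
    refine Complex.ext (h1 p hp) ?_
    -- Replacing `p` by `Complex.I • p` turns vanishing of the real part into vanishing of the
    -- imaginary part.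
    have h2 := h1 (Complex.I • p) (A.smul_mem hp _)
    simp only [smul_apply, inner_smul_right, tsum_mul_left] at h2
    simp at h2 ⊢
    linarith
  rw [← SetLike.mem_coe, Submodule.topologicalClosure_coe, Metric.mem_closure_iff] at hmem
  obtain ⟨_, ⟨p, hp, rfl⟩, h⟩ := hmem ε hε
  rw [dist_comm, dist_eq_norm] at h
  refine ⟨p, hp, fun i => ⟨?_, ?_⟩⟩
  · exact (PiLp.norm_apply_le (ev p - ev a) (Sum.inl i)).trans_lt h
  · exact (PiLp.norm_apply_le (ev p - ev a) (Sum.inr i)).trans_lt h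

/-- Take the selfadjoint part of an approximant. This is where control of `star p` is needed, since
the adjoint is not strongly continuous. -/
theorem exists_selfAdjoint_mem_norm_sub_lt {A : StarSubalgebra ℂ (K →L[ℂ] K)} {a : K →L[ℂ] K}
    (ha : a ∈ generatedVonNeumannAlgebra (A : Set (K →L[ℂ] K))) (hsa : IsSelfAdjoint a)
    {ι : Type w} [Fintype ι] (u : ι → K) {ε : ℝ} (hε : 0 < ε) :
    ∃ p ∈ A, IsSelfAdjoint p ∧ ∀ i, ‖p (u i) - a (u i)‖ < ε := by
  obtain ⟨p, hp, h⟩ := exists_mem_norm_sub_lt_and_star ha u hε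
  refine ⟨(2⁻¹ : ℂ) • (p + star p), A.smul_mem (add_mem hp (star_mem hp)) _, ?_, fun i => ?_⟩
  · rw [IsSelfAdjoint, star_smul, star_add, star_star, add_comm]
    simp
  · have h1 := h i
    rw [hsa.star_eq] at h1
    have h2 : ((2⁻¹ : ℂ) • (p + star p)) (u i) - a (u i) =
        (2⁻¹ : ℂ) • ((p (u i) - a (u i)) + (star p (u i) - a (u i))) := by
      simp only [smul_apply, add_apply]
      module
    rw [h2, norm_smul]
    have h3 := norm_add_le (p (u i) - a (u i)) (star p (u i) - a (u i))
    norm_num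
    linarith [h1.1, h1.2]

/-! ### The transform `t ↦ 2t / (1 + t²)`. -/

section Cayley

variable {p : K →L[ℂ] K}

theorem cfc_resolvent_mul (hp : IsSelfAdjoint p) :
    cfc (fun t : ℝ => (1 + t ^ 2)⁻¹) p * (1 + p * p) = 1 ∧
      (1 + p * p) * cfc (fun t : ℝ => (1 + t ^ 2)⁻¹) p = 1 := by
  have hc : Continuous fun t : ℝ => (1 + t ^ 2)⁻¹ :=
    (by fun_prop : Continuous fun t : ℝ => 1 + t ^ 2).inv₀ fun t => by positivity
  have h1 : 1 + p * p = cfc (fun t : ℝ => 1 + t ^ 2) p := by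
    rw [cfc_add .., cfc_pow_id .., cfc_const_one .., pow_two]
  rw [h1, ← cfc_mul _ _ _ (hc.continuousOn) (by fun_prop),
    ← cfc_mul _ _ _ (by fun_prop) (hc.continuousOn)]
  constructor
  · rw [← cfc_const_one ℝ p]
    exact cfc_congr fun t _ => inv_mul_cancel₀ (by positivity)
  · rw [← cfc_const_one ℝ p]
    exact cfc_congr fun t _ => mul_inv_cancel₀ (by positivity)

/-- Both orders of the factors are recorded because the difference formula in Kaplansky's theorem
has the resolvent of one operator on the left and that of the other on the right. -/
theorem cfc_cayley_eq (hp : IsSelfAdjoint p) :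
    cfc (fun t : ℝ => 2 * (t * (1 + t ^ 2)⁻¹)) p =
      (2 : ℝ) • (p * cfc (fun t : ℝ => (1 + t ^ 2)⁻¹) p) ∧
    cfc (fun t : ℝ => 2 * (t * (1 + t ^ 2)⁻¹)) p =
      (2 : ℝ) • (cfc (fun t : ℝ => (1 + t ^ 2)⁻¹) p * p) := by
  have hc : Continuous fun t : ℝ => (1 + t ^ 2)⁻¹ :=
    (by fun_prop : Continuous fun t : ℝ => 1 + t ^ 2).inv₀ fun t => by positivity
  have hc' : Continuous fun t : ℝ => t * (1 + t ^ 2)⁻¹ := continuous_id.mul hc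
  have h1 : cfc (fun t : ℝ => 2 * (t * (1 + t ^ 2)⁻¹)) p =
      (2 : ℝ) • (p * cfc (fun t : ℝ => (1 + t ^ 2)⁻¹) p) := by
    rw [cfc_const_mul _ _ _ hc'.continuousOn, cfc_mul (fun t : ℝ => t) _ _ (by fun_prop)
      hc.continuousOn, cfc_id' ℝ p]
  refine ⟨h1, ?_⟩
  rw [h1]
  congr 1
  exact (cfc_commute_cfc (fun t : ℝ => t) (fun t : ℝ => (1 + t ^ 2)⁻¹) p |>.eq |> fun h => by
    rwa [cfc_id' ℝ p] at h)

theorem norm_cfc_resolvent_le (p : K →L[ℂ] K) :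
    ‖cfc (fun t : ℝ => (1 + t ^ 2)⁻¹) p‖ ≤ 1 := by
  refine norm_cfc_le zero_le_one fun t _ => ?_
  rw [Real.norm_of_nonneg (by positivity)]
  exact inv_le_one_of_one_le₀ (by nlinarith [sq_nonneg t])

theorem norm_cfc_cayley_le (p : K →L[ℂ] K) :
    ‖cfc (fun t : ℝ => 2 * (t * (1 + t ^ 2)⁻¹)) p‖ ≤ 1 := by
  refine norm_cfc_le zero_le_one fun t _ => ?_
  rw [Real.norm_eq_abs, ← mul_assoc, ← div_eq_mul_inv, abs_le]
  have : (0 : ℝ) < 1 + t ^ 2 := by positivity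
  constructor
  · rw [le_div_iff₀ this]; nlinarith [sq_nonneg (t + 1)]
  · rw [div_le_iff₀ this]; nlinarith [sq_nonneg (t - 1)]

/-- On `[-1, 1]` the transform has the right inverse `s ↦ s / (1 + √(1 - s²))`, the half-angle
formula. It is continuous on all of `ℝ`, so `b` is obtained from `a` by functional calculus. The
commutation clause keeps `b` in every commutant containing `a`. -/
theorem exists_cfc_cayley_eq {a : K →L[ℂ] K} (ha : IsSelfAdjoint a) (hn : ‖a‖ ≤ 1) :
    ∃ b : K →L[ℂ] K, IsSelfAdjoint b ∧ (∀ c, Commute a c → Commute b c) ∧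
      cfc (fun t : ℝ => 2 * (t * (1 + t ^ 2)⁻¹)) b = a := by
  have hc : Continuous fun t : ℝ => (1 + t ^ 2)⁻¹ :=
    (by fun_prop : Continuous fun t : ℝ => 1 + t ^ 2).inv₀ fun t => by positivity
  have hc' : Continuous fun t : ℝ => 2 * (t * (1 + t ^ 2)⁻¹) :=
    continuous_const.mul (continuous_id.mul hc)
  have hg : Continuous fun s : ℝ => s / (1 + √(1 - s ^ 2)) :=
    continuous_id.div (by fun_prop) fun s => by positivity
  refine ⟨cfc (fun s : ℝ => s / (1 + √(1 - s ^ 2))) a, cfc_predicate _ a, fun c hac => ?_, ?_⟩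
  · exact hac.cfc_real _
  rw [← cfc_comp' (fun t : ℝ => 2 * (t * (1 + t ^ 2)⁻¹)) (fun s : ℝ => s / (1 + √(1 - s ^ 2))) a
    hc'.continuousOn hg.continuousOn]
  conv_rhs => rw [← cfc_id' ℝ a]
  refine cfc_congr fun s hs => ?_
  have h1 : |s| ≤ 1 := by
    refine (spectrum.norm_le_norm_mul_of_mem hs).trans ?_
    have h0 : ‖(1 : K →L[ℂ] K)‖ ≤ 1 := ContinuousLinearMap.norm_id_le
    nlinarith [norm_nonneg a, norm_nonneg (1 : K →L[ℂ] K)]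
  have h2 : s ^ 2 ≤ 1 := by rw [← sq_abs]; nlinarith [abs_nonneg s]
  have h3 := Real.sq_sqrt (by linarith : 0 ≤ 1 - s ^ 2)
  have h4 := Real.sqrt_nonneg (1 - s ^ 2)
  set r := √(1 - s ^ 2)
  have h5 : 1 + r ≠ 0 := by positivity
  have h6 : (1 + r) ^ 2 + s ^ 2 ≠ 0 := by positivity
  change 2 * (s / (1 + r) * (1 + (s / (1 + r)) ^ 2)⁻¹) = s
  have h7 : 1 + (s / (1 + r)) ^ 2 = ((1 + r) ^ 2 + s ^ 2) / (1 + r) ^ 2 := by field_simp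
  rw [h7, inv_div]
  field_simp
  linear_combination (-s) * h3

end Cayley

/-- Kaplansky's density theorem for selfadjoint contractions. -/
theorem kaplansky_selfAdjoint {A : StarSubalgebra ℂ (K →L[ℂ] K)} {a : K →L[ℂ] K}
    (ha : a ∈ generatedVonNeumannAlgebra (A : Set (K →L[ℂ] K))) (hsa : IsSelfAdjoint a)
    (hn : ‖a‖ ≤ 1) {ι : Type w} [Fintype ι] (u : ι → K) {ε : ℝ} (hε : 0 < ε) :
    ∃ p ∈ A, ‖p‖ ≤ 2 ∧ ∀ i, ‖p (u i) - a (u i)‖ < ε := by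
  -- The functional calculus leaves `A` but stays in its norm closure. Returning to `A` by a
  -- perturbation of norm less than `1` explains the bound `2`.
  suffices h : ∃ q ∈ A.topologicalClosure, ‖q‖ ≤ 1 ∧ ∀ i, ‖q (u i) - a (u i)‖ < ε / 2 by
    obtain ⟨q, hq, hq1, hqu⟩ := h
    have hq' : q ∈ closure (A : Set (K →L[ℂ] K)) := hq
    let D : ℝ := 1 + ∑ i, ‖u i‖
    have hD : 0 < D := by positivity
    obtain ⟨p, hp, hpq⟩ := Metric.mem_closure_iff.1 hq' (min 1 (ε / 2 / D)) (by positivity)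
    rw [dist_comm, dist_eq_norm, lt_min_iff] at hpq
    refine ⟨p, hp, ?_, fun i => ?_⟩
    · have := norm_add_le (p - q) q
      rw [sub_add_cancel] at this
      linarith [hpq.1]
    · have h1 : p (u i) - a (u i) = (p - q) (u i) + (q (u i) - a (u i)) := by
        simp
      have h2 : ‖(p - q) (u i)‖ ≤ ε / 2 := by
        refine ((p - q).le_opNorm _).trans ?_
        have h3 : ‖u i‖ ≤ D := by
          have := Finset.single_le_sum (f := fun i => ‖u i‖) (fun _ _ => norm_nonneg _)
            (Finset.mem_univ i)
          simp only [D]; linarith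
        calc ‖p - q‖ * ‖u i‖ ≤ ε / 2 / D * D :=
              mul_le_mul hpq.2.le h3 (norm_nonneg _) (by positivity)
          _ = ε / 2 := by field_simp
      rw [h1]
      linarith [norm_add_le ((p - q) (u i)) (q (u i) - a (u i)), hqu i]
  obtain ⟨b, hb, hbc, hba⟩ := exists_cfc_cayley_eq hsa hn
  have hbm : b ∈ generatedVonNeumannAlgebra (A : Set (K →L[ℂ] K)) := by
    rw [mem_generatedVonNeumannAlgebra_starSubalgebra_iff] at ha ⊢
    intro c hc
    exact (hbc c (ha c hc).symm).eq.symm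
  set R : (K →L[ℂ] K) → (K →L[ℂ] K) := fun p => cfc (fun t : ℝ => (1 + t ^ 2)⁻¹) p with hR
  let f : ℝ → ℝ := fun t => 2 * (t * (1 + t ^ 2)⁻¹)
  -- The difference formula below applies `p - b` only to the vectors `R b (u i)` and `b (R b (u
  -- i))`, so approximation on these suffices. No bound on `p` is needed.
  obtain ⟨p, hp, hpsa, hpu⟩ := exists_selfAdjoint_mem_norm_sub_lt hbm hb
    (Sum.elim (fun i => R b (u i)) (fun i => b (R b (u i)))) (by positivity : 0 < ε / 8)
  refine ⟨cfc f p, ?_, norm_cfc_cayley_le p, fun i => ?_⟩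
  · have h1 : cfc f p ∈ StarAlgebra.elemental ℂ p := by
      rw [cfc_real_eq_complex]
      exact cfc_mem_elemental _ p
    refine StarAlgebra.elemental.le_of_mem A.isClosed_topologicalClosure
      (A.le_topologicalClosure hp) h1
  -- The factors to the left of the differences are contractions up to the constant `2`, uniformly
  -- in `p`. This makes the transform strongly continuous.
  have key : cfc f p - a = (2 : ℝ) • (R p * ((p - b) * R b)) +
      cfc f p * ((b - p) * (b * R b)) := by
    rw [(cfc_cayley_eq hpsa).2, ← hba, (cfc_cayley_eq hb).1, smul_mul_assoc, ← smul_sub,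
      ← smul_add]
    congr 1
    have key (r s : K →L[ℂ] K) (e1 : (1 + b * b) * s = 1) (e2 : r * (1 + p * p) = 1) :
        r * p - b * s = r * ((p - b) * s) + r * p * ((b - p) * (b * s)) := by
      calc r * p - b * s = r * p * ((1 + b * b) * s) - (r * (1 + p * p)) * (b * s) := by
            rw [e1, e2, mul_one, one_mul]
        _ = _ := by noncomm_ring
    exact key _ _ (cfc_resolvent_mul hb).2 (cfc_resolvent_mul hpsa).1
  have h1 := hpu (Sum.inl i)
  have h2 := hpu (Sum.inr i)
  simp only [Sum.elim_inl, Sum.elim_inr] at h1 h2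
  have h3 : cfc f p (u i) - a (u i) = (2 : ℝ) • R p (p (R b (u i)) - b (R b (u i))) +
      cfc f p (b (b (R b (u i))) - p (b (R b (u i)))) := by
    have := congrArg (fun T : K →L[ℂ] K => T (u i)) key
    simpa using this
  rw [h3]
  refine (norm_add_le _ _).trans_lt ?_
  rw [norm_smul]
  have h4 := (R p).le_of_opNorm_le (norm_cfc_resolvent_le p) (p (R b (u i)) - b (R b (u i)))
  have h5 := (cfc f p).le_of_opNorm_le (norm_cfc_cayley_le p)
    (b (b (R b (u i))) - p (b (R b (u i))))
  rw [norm_sub_rev] at h2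
  norm_num at h4 h5 ⊢
  linarith

/-- Kaplansky's density theorem: an element of the double commutant of a `*`-algebra is a strong
limit of a bounded ultrafilter of elements of the algebra. -/
theorem exists_bounded_ultrafilter {A : StarSubalgebra ℂ (K →L[ℂ] K)} {a : K →L[ℂ] K}
    (ha : a ∈ generatedVonNeumannAlgebra (A : Set (K →L[ℂ] K))) :
    ∃ (U : Ultrafilter (Finset K × ℕ)) (p : Finset K × ℕ → K →L[ℂ] K) (C : ℝ),
      (∀ i, p i ∈ A) ∧ (∀ i, ‖p i‖ ≤ C) ∧ ∀ v, Tendsto (fun i => p i v) U (𝓝 (a v)) := by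
  classical
  have hsa (b : K →L[ℂ] K) (hb : b ∈ generatedVonNeumannAlgebra (A : Set (K →L[ℂ] K)))
      (hsb : IsSelfAdjoint b) (s : Finset K) {ε : ℝ} (hε : 0 < ε) :
      ∃ p ∈ A, ‖p‖ ≤ 2 * (‖b‖ + 1) ∧ ∀ v ∈ s, ‖p v - b v‖ < ε := by
    -- Scaling by `‖b‖ + 1` reduces to contractions without a separate case `b = 0`.
    have hpos : 0 < ‖b‖ + 1 := by positivity
    have hne : ((‖b‖ + 1 : ℝ) : ℂ) ≠ 0 := by exact_mod_cast hpos.ne'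
    obtain ⟨p, hp, hpn, hpu⟩ := kaplansky_selfAdjoint (A := A)
      (a := (((‖b‖ + 1)⁻¹ : ℝ) : ℂ) • b)
      ((generatedVonNeumannAlgebra (A : Set (K →L[ℂ] K))).toStarSubalgebra.smul_mem hb _)
      (by rw [IsSelfAdjoint, star_smul, hsb.star_eq]; simp)
      (by
        rw [norm_smul, Complex.norm_real, Real.norm_of_nonneg (by positivity),
          inv_mul_le_iff₀ hpos]
        linarith) (fun v : s => (v : K)) (ε := ε / (‖b‖ + 1)) (by positivity)
    refine ⟨((‖b‖ + 1 : ℝ) : ℂ) • p, A.smul_mem hp _, ?_, fun v hv => ?_⟩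
    · rw [norm_smul, Complex.norm_real, Real.norm_of_nonneg hpos.le]
      nlinarith
    · have h1 := hpu ⟨v, hv⟩
      have h2 : (((‖b‖ + 1 : ℝ) : ℂ) • p) v - b v =
          ((‖b‖ + 1 : ℝ) : ℂ) • (p v - ((((‖b‖ + 1)⁻¹ : ℝ) : ℂ) • b) v) := by
        simp only [smul_apply, smul_sub, smul_smul]
        rw [Complex.ofReal_inv, mul_inv_cancel₀ hne, one_smul]
      rw [h2, norm_smul, Complex.norm_real, Real.norm_of_nonneg hpos.le, mul_comm]
      exact (lt_div_iff₀ hpos).1 h1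
  let x : K →L[ℂ] K := realPart a
  let y : K →L[ℂ] K := imaginaryPart a
  have hxy : a = x + Complex.I • y := (realPart_add_I_smul_imaginaryPart a).symm
  have hst := star_mem ha
  have hx : x ∈ generatedVonNeumannAlgebra (A : Set (K →L[ℂ] K)) := by
    have : x = (2⁻¹ : ℂ) • (a + star a) := by
      simp only [x, realPart_apply_coe]
      rw [← Complex.coe_smul]
      simp
    rw [this]
    exact (generatedVonNeumannAlgebra (A : Set (K →L[ℂ] K))).toStarSubalgebra.smul_mem
      (add_mem ha hst) _
  have hy : y ∈ generatedVonNeumannAlgebra (A : Set (K →L[ℂ] K)) := by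
    have : y = (-Complex.I) • (a - x) := by
      rw [hxy, add_sub_cancel_left, smul_smul]
      simp
    rw [this]
    exact (generatedVonNeumannAlgebra (A : Set (K →L[ℂ] K))).toStarSubalgebra.smul_mem
      (sub_mem ha hx) _
  have key (i : Finset K × ℕ) : ∃ p ∈ A, ‖p‖ ≤ 2 * (‖x‖ + 1) + 2 * (‖y‖ + 1) ∧
      ∀ v ∈ i.1, ‖p v - a v‖ < 1 / ((i.2 : ℝ) + 1) := by
    obtain ⟨p, hp, hp1, hp2⟩ := hsa x hx (realPart a).2 i.1
      (ε := 1 / ((i.2 : ℝ) + 1) / 2) (by positivity)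
    obtain ⟨q, hq, hq1, hq2⟩ := hsa y hy (imaginaryPart a).2 i.1
      (ε := 1 / ((i.2 : ℝ) + 1) / 2) (by positivity)
    refine ⟨p + Complex.I • q, add_mem hp (A.smul_mem hq _), ?_, fun v hv => ?_⟩
    · refine (norm_add_le _ _).trans (add_le_add hp1 ?_)
      rw [norm_smul]
      simpa using hq1
    · have h2 : (p + Complex.I • q) v - a v = (p v - x v) + Complex.I • (q v - y v) := by
        conv_lhs => rw [hxy]
        simp only [add_apply, smul_apply]
        module
      rw [h2]
      refine (norm_add_le _ _).trans_lt ?_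
      rw [norm_smul, Complex.norm_I, one_mul]
      linarith [hp2 v hv, hq2 v hv]
  choose p hp hp1 hp2 using key
  -- The index records a finite set of vectors and an accuracy `1 / (n + 1)`. An ultrafilter is
  -- chosen so that other bounded families also have weak limits along it.
  refine ⟨Ultrafilter.of atTop, p, _, hp, hp1, fun v => ?_⟩
  refine Tendsto.mono_left ?_ (Ultrafilter.of_le atTop)
  rw [tendsto_iff_norm_sub_tendsto_zero, Metric.tendsto_atTop]
  intro ε hε
  obtain ⟨n, hn⟩ := exists_nat_one_div_lt hε
  refine ⟨({v}, n), fun i hi => ?_⟩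
  rw [dist_zero_right, norm_norm]
  refine (hp2 i v (hi.1 (Finset.mem_singleton_self v))).trans_le (le_trans ?_ hn.le)
  have : (n : ℝ) ≤ i.2 := by exact_mod_cast hi.2
  gcongr

/-- Bounded ultrafilters of operators converge weakly. -/
theorem exists_weak_limit {I : Type w} (U : Ultrafilter I) (p : I → K →L[ℂ] K) {C : ℝ}
    (h : ∀ i, ‖p i‖ ≤ C) :
    ∃ b : K →L[ℂ] K, ∀ u v, Tendsto (fun i => ⟪u, p i v⟫) U (𝓝 ⟪u, b v⟫) := by
  have hbd (u v : K) (i : I) : ‖⟪p i u, v⟫‖ ≤ C * ‖u‖ * ‖v‖ :=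
    (norm_inner_le_norm _ _).trans
      (mul_le_mul_of_nonneg_right ((p i).le_of_opNorm_le (h i) u) (norm_nonneg _))
  have hlim (u v : K) : ∃ z : ℂ, ‖z‖ ≤ C * ‖u‖ * ‖v‖ ∧
      Tendsto (fun i => ⟪p i u, v⟫) U (𝓝 z) := by
    -- Each matrix coefficient stays in a compact disc, so it converges along the ultrafilter.
    obtain ⟨z, hz, hz'⟩ := (isCompact_closedBall (0 : ℂ) (C * ‖u‖ * ‖v‖)).ultrafilter_le_nhds'
      (U.map fun i => ⟪p i u, v⟫) (Filter.mem_map.2 (Filter.univ_mem' fun i => by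
        simpa using hbd u v i))
    exact ⟨z, by simpa using hz, hz'⟩
  choose B hB1 hB2 using hlim
  let L : K →ₗ⋆[ℂ] K →ₗ[ℂ] ℂ := LinearMap.mk₂'ₛₗ (starRingEnd ℂ) (RingHom.id ℂ) B
    (fun u u' v => tendsto_nhds_unique (hB2 _ _) (by
      simpa only [map_add, inner_add_left] using (hB2 u v).add (hB2 u' v)))
    (fun c u v => tendsto_nhds_unique (hB2 _ _) (by
      simpa only [map_smul, inner_smul_left, smul_eq_mul] using (hB2 u v).const_mul _))
    (fun u v v' => tendsto_nhds_unique (hB2 _ _) (by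
      simpa only [inner_add_right] using (hB2 u v).add (hB2 u v')))
    (fun c u v => tendsto_nhds_unique (hB2 _ _) (by
      simpa only [inner_smul_right, smul_eq_mul, RingHom.id_apply] using (hB2 u v).const_mul _))
  -- The limits form a bounded sesquilinear form, represented by `b`.
  let b := InnerProductSpace.continuousLinearMapOfBilin (L.mkContinuous₂ C hB1)
  have hb (u v : K) : ⟪b u, v⟫ = B u v :=
    InnerProductSpace.continuousLinearMapOfBilin_apply _ _ _
  refine ⟨b, fun u v => ?_⟩
  have h1 := (Complex.continuous_conj.tendsto _).comp (hB2 v u)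
  rw [← hb] at h1
  simpa only [Function.comp_def, inner_conj_symm] using h1

omit [CompleteSpace K] in
/-- Normal functionals are continuous along bounded weakly convergent families. -/
theorem tendsto_tsum_inner {I : Type w} {l : Filter I} {p : I → K →L[ℂ] K} {b : K →L[ℂ] K} {C : ℝ}
    (h : ∀ i, ‖p i‖ ≤ C) (hb : ∀ u v, Tendsto (fun i => ⟪u, p i v⟫) l (𝓝 ⟪u, b v⟫))
    {ι : Type v} {ξ η : ι → K} (hξ : Summable fun i => ‖ξ i‖ ^ 2)
    (hη : Summable fun i => ‖η i‖ ^ 2) :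
    Tendsto (fun i => ∑' n, ⟪ξ n, p i (η n)⟫) l (𝓝 (∑' n, ⟪ξ n, b (η n)⟫)) := by
  refine tendsto_tsum_of_dominated_convergence (bound := fun n => |C| * (‖ξ n‖ ^ 2 + ‖η n‖ ^ 2))
    ((hξ.add hη).mul_left _) (fun n => hb _ _) (Eventually.of_forall fun i n => ?_)
  have h1 := norm_inner_le_norm (𝕜 := ℂ) (ξ n) (p i (η n))
  have h2 := (p i).le_of_opNorm_le ((h i).trans (le_abs_self C)) (η n)
  have h3 : ‖ξ n‖ * ‖p i (η n)‖ ≤ ‖ξ n‖ * (|C| * ‖η n‖) :=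
    mul_le_mul_of_nonneg_left h2 (norm_nonneg _)
  nlinarith [abs_nonneg C, mul_nonneg (abs_nonneg C) (sq_nonneg (‖ξ n‖ - ‖η n‖)),
    mul_nonneg (abs_nonneg C) (sq_nonneg (‖ξ n‖)), mul_nonneg (abs_nonneg C) (sq_nonneg (‖η n‖))]

/-- A von Neumann algebra is closed under weak limits. -/
theorem VonNeumannAlgebra.mem_of_tendsto_inner (M : VonNeumannAlgebra K) {I : Type w}
    {l : Filter I} [l.NeBot] {p : I → K →L[ℂ] K} {b : K →L[ℂ] K} (hp : ∀ i, p i ∈ M)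
    (hb : ∀ u v, Tendsto (fun i => ⟪u, p i v⟫) l (𝓝 ⟪u, b v⟫)) : b ∈ M := by
  rw [M.mem_iff_forall_commutant]
  intro c hc
  ext v
  refine ext_inner_left ℂ fun u => ?_
  have h1 := hb (star c u) v
  simp only [ContinuousLinearMap.star_eq_adjoint, ContinuousLinearMap.adjoint_inner_left] at h1
  refine tendsto_nhds_unique h1 ((hb u (c v)).congr fun i => ?_)
  have := congrArg (fun T : K →L[ℂ] K => T v) (VonNeumannAlgebra.mem_commutant_iff.1 hc _ (hp i))
  simp only [mul_apply_eq_comp] at this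
  rw [this]

end Density

theorem VonNeumannAlgebra.isClosed {K : Type u} [NormedAddCommGroup K] [InnerProductSpace ℂ K]
    [CompleteSpace K] (M : VonNeumannAlgebra K) :
    IsClosed (M.toStarSubalgebra : Set (K →L[ℂ] K)) := by
  have h : (M.toStarSubalgebra : Set (K →L[ℂ] K)) =
      ⋂ b ∈ M.commutant, {a | b * a = a * b} := by
    ext a
    simp only [Set.mem_iInter, Set.mem_ofPred_eq]
    exact M.mem_iff_forall_commutant
  rw [h]
  exact isClosed_biInter fun b _ => isClosed_eq (by fun_prop) (by fun_prop)

/-- Norm closedness makes `M` a C*-algebra, and `*`-automorphisms of C*-algebras are isometric. -/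
theorem norm_starAlgEquiv_apply {K : Type u} [NormedAddCommGroup K] [InnerProductSpace ℂ K]
    [CompleteSpace K] {M : StarSubalgebra ℂ (K →L[ℂ] K)} (hM : IsClosed (M : Set (K →L[ℂ] K)))
    (θ : M ≃⋆ₐ[ℂ] M) (a : M) : ‖(θ a : K →L[ℂ] K)‖ = ‖(a : K →L[ℂ] K)‖ :=
  have : IsClosed (M : Set (K →L[ℂ] K)) := hM
  StarAlgEquiv.norm_map θ a

/-! ### Normal functionals and faithful normal traces. -/

section Traces

variable {K : Type u} [NormedAddCommGroup K] [InnerProductSpace ℂ K]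

theorem summable_inner_apply {ξ η : ℕ → K} (hξ : Summable fun n => ‖ξ n‖ ^ 2)
    (hη : Summable fun n => ‖η n‖ ^ 2) (a : K →L[ℂ] K) : Summable fun n => ⟪ξ n, a (η n)⟫ := by
  refine Summable.of_norm_bounded (g := fun n => ‖a‖ * (‖ξ n‖ ^ 2 + ‖η n‖ ^ 2))
    ((hξ.add hη).mul_left _) fun n => ?_
  have h1 := norm_inner_le_norm (𝕜 := ℂ) (ξ n) (a (η n))
  have h3 : ‖ξ n‖ * ‖a (η n)‖ ≤ ‖ξ n‖ * (‖a‖ * ‖η n‖) :=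
    mul_le_mul_of_nonneg_left (a.le_opNorm _) (norm_nonneg _)
  nlinarith [norm_nonneg a, mul_nonneg (norm_nonneg a) (sq_nonneg (‖ξ n‖ - ‖η n‖)),
    mul_nonneg (norm_nonneg a) (sq_nonneg (‖ξ n‖)),
    mul_nonneg (norm_nonneg a) (sq_nonneg (‖η n‖))]

/-- The normal functional `a ↦ ∑ ⟪ξ n, a (η n)⟫`. -/
def vectorFunctional (ξ η : ℕ → K) (hξ : Summable fun n => ‖ξ n‖ ^ 2)
    (hη : Summable fun n => ‖η n‖ ^ 2) : (K →L[ℂ] K) →ₗ[ℂ] ℂ :=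
  have hs := summable_inner_apply hξ hη
  { toFun := fun a => ∑' n, ⟪ξ n, a (η n)⟫
    map_add' := fun a b => by
      simp only [add_apply, inner_add_right]
      exact (hs a).tsum_add (hs b)
    map_smul' := fun c a => by
      simp only [smul_apply, inner_smul_right, tsum_mul_left]
      rfl }

variable [CompleteSpace K]

omit [CompleteSpace K] in
/-- Normality (`σ`-weak continuity) of a functional on the algebra of all operators. -/
def IsNormalFunctional (φ : (K →L[ℂ] K) →ₗ[ℂ] ℂ) : Prop :=
  ∃ ξ η : ℕ → K, Summable (fun n => ‖ξ n‖ ^ 2) ∧ Summable (fun n => ‖η n‖ ^ 2) ∧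
    ∀ a, φ a = ∑' n, ⟪ξ n, a (η n)⟫

/-- A faithful normal trace on `M`, given by a normal functional on all operators. -/
structure IsNormalTrace (M : VonNeumannAlgebra K) (φ : (K →L[ℂ] K) →ₗ[ℂ] ℂ) : Prop where
  normal : IsNormalFunctional φ
  nonneg : ∀ a ∈ M, 0 ≤ φ (star a * a)
  faithful : ∀ a ∈ M, φ (star a * a) = 0 → a = 0
  trace : ∀ a ∈ M, ∀ b ∈ M, φ (a * b) = φ (b * a)

/-- The vectors that represent `τ` define a functional on all operators. Working with this extension
allows products and limits to be formed without carrying membership proofs. -/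
theorem IsTracialState.exists_isNormalTrace {M : VonNeumannAlgebra K}
    {τ : M.toStarSubalgebra →ₗ[ℂ] ℂ} (hτ : IsTracialState τ) :
    ∃ φ, IsNormalTrace M φ ∧ ∀ a : M.toStarSubalgebra, τ a = φ a := by
  obtain ⟨ξ, η, hξ, hη, h⟩ := hτ.normal
  have h' (a : M.toStarSubalgebra) : τ a = vectorFunctional ξ η hξ hη a := (h a).tsum_eq.symm
  refine ⟨vectorFunctional ξ η hξ hη, ⟨⟨ξ, η, hξ, hη, fun a => rfl⟩, ?_, ?_, ?_⟩, h'⟩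
  · intro a ha
    have := hτ.nonneg ⟨a, ha⟩
    rwa [h'] at this
  · intro a ha h0
    have := hτ.faithful ⟨a, ha⟩ (by rw [h']; exact h0)
    exact congrArg Subtype.val this
  · intro a ha b hb
    have := hτ.trace ⟨a, ha⟩ ⟨b, hb⟩
    rwa [h', h'] at this

theorem IsNormalTrace.isTracialState {M : VonNeumannAlgebra K} {φ : (K →L[ℂ] K) →ₗ[ℂ] ℂ}
    (h : IsNormalTrace M φ) (h1 : φ 1 = 1) :
    IsTracialState (φ ∘ₗ M.toStarSubalgebra.toSubalgebra.toSubmodule.subtype :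
      M.toStarSubalgebra →ₗ[ℂ] ℂ) where
  map_one := h1
  nonneg a := h.nonneg a a.2
  faithful a ha := Subtype.ext (h.faithful a a.2 ha)
  trace a b := h.trace a a.2 b b.2
  normal := by
    obtain ⟨ξ, η, hξ, hη, hφ⟩ := h.normal
    refine ⟨ξ, η, hξ, hη, fun a => ?_⟩
    change HasSum _ (φ a)
    rw [hφ]
    exact (summable_inner_apply hξ hη a).hasSum

namespace IsNormalFunctional

variable {φ : (K →L[ℂ] K) →ₗ[ℂ] ℂ}

omit [CompleteSpace K] in
theorem tendsto (h : IsNormalFunctional φ) {I : Type w} {l : Filter I} {p : I → K →L[ℂ] K}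
    {b : K →L[ℂ] K} {C : ℝ} (hp : ∀ i, ‖p i‖ ≤ C)
    (hb : ∀ u v, Tendsto (fun i => ⟪u, p i v⟫) l (𝓝 ⟪u, b v⟫)) :
    Tendsto (fun i => φ (p i)) l (𝓝 (φ b)) := by
  obtain ⟨ξ, η, hξ, hη, hφ⟩ := h
  simp only [hφ]
  exact tendsto_tsum_inner hp hb hξ hη

theorem tendsto_mul_left (h : IsNormalFunctional φ) {I : Type w} {l : Filter I} {p : I → K →L[ℂ] K}
    {b : K →L[ℂ] K} {C : ℝ} (hp : ∀ i, ‖p i‖ ≤ C)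
    (hb : ∀ u v, Tendsto (fun i => ⟪u, p i v⟫) l (𝓝 ⟪u, b v⟫)) (c : K →L[ℂ] K) :
    Tendsto (fun i => φ (c * p i)) l (𝓝 (φ (c * b))) := by
  refine h.tendsto (C := ‖c‖ * C) (fun i => (norm_mul_le _ _).trans
    (mul_le_mul_of_nonneg_left (hp i) (norm_nonneg _))) fun u v => ?_
  have := hb (star c u) v
  simp only [ContinuousLinearMap.star_eq_adjoint, ContinuousLinearMap.adjoint_inner_left] at this
  exact this

omit [CompleteSpace K] in
theorem tendsto_mul_right (h : IsNormalFunctional φ) {I : Type w} {l : Filter I}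
    {p : I → K →L[ℂ] K} {b : K →L[ℂ] K} {C : ℝ} (hp : ∀ i, ‖p i‖ ≤ C)
    (hb : ∀ u v, Tendsto (fun i => ⟪u, p i v⟫) l (𝓝 ⟪u, b v⟫)) (c : K →L[ℂ] K) :
    Tendsto (fun i => φ (p i * c)) l (𝓝 (φ (b * c))) :=
  h.tendsto (C := C * ‖c‖) (fun i => (norm_mul_le _ _).trans
    (mul_le_mul_of_nonneg_right (hp i) (norm_nonneg _))) fun u v => hb u (c v)

omit [CompleteSpace K] in
theorem continuous (h : IsNormalFunctional φ) : Continuous φ := by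
  refine continuous_iff_continuousAt.2 fun a => ?_
  have hev : ∀ᶠ b in 𝓝 a, ‖b‖ ≤ ‖a‖ + 1 :=
    (continuous_norm.tendsto a).eventually_le_const (by linarith)
  -- Truncating to a ball around zero makes the family bounded everywhere without changing it near
  -- `a`, so the convergence result for bounded families applies.
  let p : (K →L[ℂ] K) → K →L[ℂ] K := fun b => if ‖b‖ ≤ ‖a‖ + 1 then b else 0
  have hpe : p =ᶠ[𝓝 a] id := hev.mono fun b hb => by simp [p, hb]
  have h1 := h.tendsto (p := p) (l := 𝓝 a) (b := a) (C := ‖a‖ + 1) (fun b => ?_) fun u v => ?_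
  · exact h1.congr' (hpe.mono fun b hb => by rw [hb]; rfl)
  · by_cases hb : ‖b‖ ≤ ‖a‖ + 1
    · simp [p, hb]
    · simp only [p, hb, if_false, norm_zero]
      positivity
  · have h2 : Continuous fun b : K →L[ℂ] K => ⟪u, b v⟫ := by fun_prop
    exact (h2.tendsto a).congr' (hpe.symm.mono fun b hb => by simp only [← hb]; rfl)

end IsNormalFunctional

namespace IsNormalTrace

variable {M : VonNeumannAlgebra K} {φ : (K →L[ℂ] K) →ₗ[ℂ] ℂ}

/-- A faithful normal trace separates `M` already through products with a generating subalgebra. -/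
theorem eq_zero_of_mul_right (h : IsNormalTrace M φ) {A : StarSubalgebra ℂ (K →L[ℂ] K)}
    (hA : ∀ a ∈ M, a ∈ generatedVonNeumannAlgebra (A : Set (K →L[ℂ] K))) {d : K →L[ℂ] K}
    (hd : d ∈ M) (h0 : ∀ q ∈ A, φ (d * q) = 0) : d = 0 := by
  -- Approximating `star d` by elements of the subalgebra gives `φ (d * star d) = 0`, and the trace
  -- property turns this into the form required by faithfulness.
  obtain ⟨U, p, C, hpA, hpC, hp⟩ := exists_bounded_ultrafilter (hA _ (star_mem hd))
  have h1 := h.normal.tendsto_mul_left (l := (U : Filter _)) hpC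
    (fun u v => (tendsto_const_nhds (x := u)).inner (𝕜 := ℂ) (hp v)) d
  have h2 : φ (d * star d) = 0 :=
    tendsto_nhds_unique h1 (by simp only [h0 _ (hpA _)]; exact tendsto_const_nhds)
  rw [h.trace _ hd _ (star_mem hd)] at h2
  exact h.faithful d hd h2

theorem eq_zero_of_mul_right' (h : IsNormalTrace M φ) {d : K →L[ℂ] K}
    (hd : d ∈ M) (h0 : ∀ q ∈ M, φ (d * q) = 0) : d = 0 :=
  h.eq_zero_of_mul_right (A := M.toStarSubalgebra)
    (fun _ ha => subset_generatedVonNeumannAlgebra _ ha) hd h0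

/-- Trace preserving automorphisms are weakly continuous on bounded sets. -/
theorem tendsto_automorphism (h : IsNormalTrace M φ)
    {θ : M.toStarSubalgebra ≃⋆ₐ[ℂ] M.toStarSubalgebra}
    (hθ : ∀ a, φ (θ a : K →L[ℂ] K) = φ a) {I : Type w} (U : Ultrafilter I)
    {p : I → M.toStarSubalgebra} {b : M.toStarSubalgebra} {C : ℝ}
    (hp : ∀ i, ‖(p i : K →L[ℂ] K)‖ ≤ C)
    (hb : ∀ u v, Tendsto (fun i => ⟪u, (p i : K →L[ℂ] K) v⟫) U (𝓝 ⟪u, (b : K →L[ℂ] K) v⟫))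
    (u v : K) : Tendsto (fun i => ⟪u, (θ (p i) : K →L[ℂ] K) v⟫) U
      (𝓝 ⟪u, (θ b : K →L[ℂ] K) v⟫) := by
  have hp' (i) : ‖(θ (p i) : K →L[ℂ] K)‖ ≤ C := by
    rw [norm_starAlgEquiv_apply M.isClosed]
    exact hp i
  obtain ⟨b', hb'⟩ := exists_weak_limit U (fun i => (θ (p i) : K →L[ℂ] K)) hp'
  have hmem : b' ∈ M := M.mem_of_tendsto_inner (l := (U : Filter I)) (fun i => (θ (p i)).2) hb'
  suffices hs : b' - θ b = 0 by
    rw [← sub_eq_zero.1 hs]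
    exact hb' u v
  refine h.eq_zero_of_mul_right' (sub_mem hmem (θ b).2) fun q hq => ?_
  rw [sub_mul, map_sub, sub_eq_zero]
  refine tendsto_nhds_unique (h.normal.tendsto_mul_right (l := (U : Filter I)) hp' hb' q) ?_
  -- Trace invariance moves `θ` to the test element as `θ.symm`. The weak limit `b'` therefore has
  -- the same pairings as `θ b`.
  have key (a : M.toStarSubalgebra) : φ ((θ a : K →L[ℂ] K) * q) =
      φ ((a : K →L[ℂ] K) * (θ.symm ⟨q, hq⟩ : M.toStarSubalgebra)) := by
    have h1 := hθ (a * θ.symm ⟨q, hq⟩)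
    rw [map_mul, StarAlgEquiv.apply_symm_apply] at h1
    exact h1
  simp only [key]
  exact h.normal.tendsto_mul_right hp hb _

/-- Trace preserving multiplicative maps which agree on a dense subset of a generating subalgebra
are equal, if one of them is an automorphism. -/
theorem automorphism_ext (h : IsNormalTrace M φ) {A : StarSubalgebra ℂ (K →L[ℂ] K)}
    (hA : ∀ a ∈ M, a ∈ generatedVonNeumannAlgebra (A : Set (K →L[ℂ] K)))
    {Q : Set (K →L[ℂ] K)} (hQ : ∀ a ∈ A, a ∈ closure Q) (hQM : ∀ q ∈ Q, q ∈ M)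
    {θ : M.toStarSubalgebra ≃⋆ₐ[ℂ] M.toStarSubalgebra}
    {θ' : M.toStarSubalgebra → M.toStarSubalgebra} (hmul : ∀ a b, θ' (a * b) = θ' a * θ' b)
    (hθ : ∀ a, φ (θ a : K →L[ℂ] K) = φ a) (hθ' : ∀ a, φ (θ' a : K →L[ℂ] K) = φ a)
    (he : ∀ a : M.toStarSubalgebra, (a : K →L[ℂ] K) ∈ Q → θ a = θ' a) (b : M.toStarSubalgebra) :
    θ b = θ' b := by
  -- Pulling the difference back by `θ` helps because `θ (d * q) = θ (b * q) - θ' (b * q)` for `q`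
  -- in `Q`. Both terms have trace `φ (b * q)`, so `φ (d * q) = 0`.
  obtain ⟨d, hd⟩ : ∃ d, θ d = θ b - θ' b := EquivLike.surjective θ (θ b - θ' b)
  suffices h0 : (d : K →L[ℂ] K) = 0 by
    have h1 : d = 0 := Subtype.ext h0
    rw [h1, map_zero] at hd
    exact (sub_eq_zero.1 hd.symm)
  refine h.eq_zero_of_mul_right hA d.2 fun q hq => ?_
  have hcl : IsClosed {q : K →L[ℂ] K | φ (d * q) = 0} :=
    isClosed_eq (h.normal.continuous.comp (by fun_prop)) continuous_const
  refine closure_minimal (fun q hq => ?_) hcl (hQ q hq)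
  let q' : M.toStarSubalgebra := ⟨q, hQM q hq⟩
  have h1 : θ (d * q') = θ (b * q') - θ' (b * q') := by
    rw [map_mul, hd, sub_mul, map_mul, hmul, ← he q' hq]
  have h2 := hθ (d * q')
  rw [h1] at h2
  change φ ((θ (b * q') : K →L[ℂ] K) - (θ' (b * q') : K →L[ℂ] K)) = φ ((d : K →L[ℂ] K) * q) at h2
  change φ ((d : K →L[ℂ] K) * q) = 0
  rw [← h2, map_sub, hθ, hθ', sub_self]

theorem smul (h : IsNormalTrace M φ) {r : ℝ} (hr : 0 < r) : IsNormalTrace M ((r : ℂ) • φ) where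
  normal := by
    obtain ⟨ξ, η, hξ, hη, hφ⟩ := h.normal
    refine ⟨ξ, fun n => (r : ℂ) • η n, hξ, ?_, fun a => ?_⟩
    · simpa only [norm_smul, mul_pow] using hη.mul_left _
    · simp only [map_smul, inner_smul_right, tsum_mul_left]
      rw [← hφ]
      rfl
  nonneg a ha := mul_nonneg (by exact_mod_cast hr.le) (h.nonneg a ha)
  faithful a ha h0 := h.faithful a ha
    ((mul_eq_zero.1 h0).resolve_left (by exact_mod_cast hr.ne'))
  trace a ha b hb := congrArg (fun z => (r : ℂ) * z) (h.trace a ha b hb)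

/-! ### Extending a trace preserving partial graph to an automorphism. -/

section Extension

variable {G : StarSubalgebra ℂ ((K →L[ℂ] K) × (K →L[ℂ] K))}

/-- On the norm closure of `G` the first projection is injective: if `z.1 = 0`, equality of traces
gives `φ (star z.2 * z.2) = 0`, so `z.2 = 0`. Injective `*`-homomorphisms of C*-algebras are
isometric, hence `‖y‖ = ‖y.1‖`. -/
theorem norm_snd_le (h : IsNormalTrace M φ) (hGM : ∀ y ∈ G, y.1 ∈ M ∧ y.2 ∈ M)
    (hG : ∀ y ∈ G, φ y.1 = φ y.2) {y : (K →L[ℂ] K) × (K →L[ℂ] K)} (hy : y ∈ G) :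
    ‖y.2‖ ≤ ‖y.1‖ := by
  let G' := G.topologicalClosure
  have : IsClosed (G' : Set ((K →L[ℂ] K) × (K →L[ℂ] K))) := G.isClosed_topologicalClosure
  have hcl (z) (hz : z ∈ G') : (z.1 ∈ M ∧ z.2 ∈ M) ∧ φ z.1 = φ z.2 := by
    have hc : IsClosed {z : (K →L[ℂ] K) × (K →L[ℂ] K) | (z.1 ∈ M ∧ z.2 ∈ M) ∧ φ z.1 = φ z.2} :=
      ((M.isClosed.preimage continuous_fst).inter (M.isClosed.preimage continuous_snd)).inter
        (isClosed_eq (h.normal.continuous.comp continuous_fst)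
          (h.normal.continuous.comp continuous_snd))
    refine closure_minimal (s := (G : Set ((K →L[ℂ] K) × (K →L[ℂ] K)))) (fun w hw => ?_) hc hz
    exact ⟨hGM w hw, hG w hw⟩
  let f : G' →⋆ₐ[ℂ] (K →L[ℂ] K) := (StarAlgHom.fst ℂ _ _).comp G'.subtype
  have hf : Function.Injective f := by
    rw [injective_iff_map_eq_zero]
    intro z hz
    have hz1 : (z : (K →L[ℂ] K) × (K →L[ℂ] K)).1 = 0 := hz
    refine Subtype.ext (Prod.ext hz1 ?_)
    have h1 := (hcl (star z * z : G') (star z * z : G').2).2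
    refine h.faithful _ (hcl z z.2).1.2 ?_
    change φ (star (z : (K →L[ℂ] K) × (K →L[ℂ] K)).1 * (z : (K →L[ℂ] K) × (K →L[ℂ] K)).1) =
      φ (star (z : (K →L[ℂ] K) × (K →L[ℂ] K)).2 * (z : (K →L[ℂ] K) × (K →L[ℂ] K)).2) at h1
    rw [← h1, hz1, mul_zero, map_zero]
  have h1 := NonUnitalStarAlgHom.norm_map f hf ⟨y, G.le_topologicalClosure hy⟩
  change ‖y.1‖ = ‖y‖ at h1
  rw [h1]
  exact _root_.norm_snd_le y

/-- `(b, b')` is a weak limit of a bounded ultrafilter in `G`. -/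
def IsGraphLimit (G : StarSubalgebra ℂ ((K →L[ℂ] K) × (K →L[ℂ] K))) (b b' : K →L[ℂ] K) : Prop :=
  ∃ (U : Ultrafilter (Finset K × ℕ)) (y : Finset K × ℕ → (K →L[ℂ] K) × (K →L[ℂ] K)) (C : ℝ),
    (∀ i, y i ∈ G) ∧ (∀ i, ‖y i‖ ≤ C) ∧
    (∀ u v, Tendsto (fun i => ⟪u, (y i).1 v⟫) U (𝓝 ⟪u, b v⟫)) ∧
    ∀ u v, Tendsto (fun i => ⟪u, (y i).2 v⟫) U (𝓝 ⟪u, b' v⟫)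

/-- Kaplansky's theorem provides bounded first coordinates converging to `b`. The second coordinates
are bounded by the same constant, so weak compactness supplies `b'`. -/
theorem exists_isGraphLimit (h : IsNormalTrace M φ) (hGM : ∀ y ∈ G, y.1 ∈ M ∧ y.2 ∈ M)
    (hG : ∀ y ∈ G, φ y.1 = φ y.2)
    (hG1 : ∀ a ∈ M, a ∈ generatedVonNeumannAlgebra
      (Prod.fst '' (G : Set ((K →L[ℂ] K) × (K →L[ℂ] K))))) {b : K →L[ℂ] K}
    (hb : b ∈ M) : ∃ b' ∈ M, IsGraphLimit G b b' := by
  have hb1 := hG1 b hb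
  have he : Prod.fst '' (G : Set ((K →L[ℂ] K) × (K →L[ℂ] K))) =
      ((G.map (StarAlgHom.fst ℂ (K →L[ℂ] K) (K →L[ℂ] K)) : StarSubalgebra ℂ (K →L[ℂ] K)) :
        Set (K →L[ℂ] K)) := rfl
  rw [he] at hb1
  obtain ⟨U, p, C, hpA, hpC, hp⟩ := exists_bounded_ultrafilter hb1
  choose y hyG hyp using hpA
  have hyp' (i) : (y i).1 = p i := hyp i
  have hn (i) : ‖(y i).2‖ ≤ C :=
    (h.norm_snd_le hGM hG (hyG i)).trans (by rw [hyp']; exact hpC i)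
  obtain ⟨b', hb'⟩ := exists_weak_limit U (fun i => (y i).2) hn
  refine ⟨b', M.mem_of_tendsto_inner (l := (U : Filter _)) (fun i => (hGM _ (hyG i)).2) hb',
    U, y, C, hyG, fun i => ?_, fun u v => ?_, hb'⟩
  · exact max_le (by rw [hyp']; exact hpC i) (hn i)
  · simp only [hyp']
    exact tendsto_const_nhds.inner (hp v)

theorem IsGraphLimit.star {b b' : K →L[ℂ] K} (hb : IsGraphLimit G b b') :
    IsGraphLimit G (star b) (star b') := by
  obtain ⟨U, y, C, hy, hC, h1, h2⟩ := hb
  refine ⟨U, fun i => Star.star (y i), C, fun i => star_mem (hy i), fun i => ?_, fun u v => ?_,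
    fun u v => ?_⟩
  · rw [norm_star]; exact hC i
  · have h3 := (Complex.continuous_conj.tendsto _).comp (h1 v u)
    simp only [Function.comp_def, inner_conj_symm] at h3
    simpa only [Prod.fst_star, ContinuousLinearMap.star_eq_adjoint,
      ContinuousLinearMap.adjoint_inner_right] using h3
  · have h3 := (Complex.continuous_conj.tendsto _).comp (h2 v u)
    simp only [Function.comp_def, inner_conj_symm] at h3
    simpa only [Prod.snd_star, ContinuousLinearMap.star_eq_adjoint,
      ContinuousLinearMap.adjoint_inner_right] using h3

theorem IsGraphLimit.swap {b b' : K →L[ℂ] K} (hb : IsGraphLimit G b b') :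
    IsGraphLimit (G.map ((StarAlgHom.snd ℂ (K →L[ℂ] K) (K →L[ℂ] K)).prod
      (StarAlgHom.fst ℂ (K →L[ℂ] K) (K →L[ℂ] K)))) b' b := by
  obtain ⟨U, y, C, hy, hC, h1, h2⟩ := hb
  refine ⟨U, fun i => (y i).swap, C, fun i => ⟨y i, hy i, rfl⟩, fun i => ?_, h2, h1⟩
  refine le_trans (le_of_eq ?_) (hC i)
  exact max_comm _ _

/-- Products of elements of `G` lie in `G` and have coordinates of equal trace, and this passes to
the weak limit. Faithfulness later makes this pairing relation determine each of `b` and `b'` from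
the other. -/
theorem IsGraphLimit.apply_mul (h : IsNormalTrace M φ) (hG : ∀ y ∈ G, φ y.1 = φ y.2)
    {b b' : K →L[ℂ] K} (hb : IsGraphLimit G b b') {y : (K →L[ℂ] K) × (K →L[ℂ] K)} (hy : y ∈ G) :
    φ (b * y.1) = φ (b' * y.2) := by
  obtain ⟨U, z, C, hz, hC, h1, h2⟩ := hb
  refine tendsto_nhds_unique (h.normal.tendsto_mul_right (l := (U : Filter _))
    (fun i => (norm_fst_le _).trans (hC i)) h1 _) ?_
  refine (h.normal.tendsto_mul_right (l := (U : Filter _))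
    (fun i => (_root_.norm_snd_le _).trans (hC i)) h2 _).congr fun i => ?_
  exact (hG _ (mul_mem (hz i) hy)).symm

/-- Let `G` be a `*`-algebra of pairs of elements of `M`, on which the trace of the two coordinates
agrees and both projections of which generate `M`. Then `G` is contained in the graph of a trace
preserving automorphism of `M`, which is determined by its pairing with `G`. -/
theorem exists_automorphism (h : IsNormalTrace M φ) (hGM : ∀ y ∈ G, y.1 ∈ M ∧ y.2 ∈ M)
    (hG : ∀ y ∈ G, φ y.1 = φ y.2)
    (hG1 : ∀ a ∈ M, a ∈ generatedVonNeumannAlgebra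
      (Prod.fst '' (G : Set ((K →L[ℂ] K) × (K →L[ℂ] K)))))
    (hG2 : ∀ a ∈ M, a ∈ generatedVonNeumannAlgebra
      (Prod.snd '' (G : Set ((K →L[ℂ] K) × (K →L[ℂ] K))))) :
    ∃ θ : M.toStarSubalgebra ≃⋆ₐ[ℂ] M.toStarSubalgebra,
      (∀ a, φ (θ a : K →L[ℂ] K) = φ a) ∧
      ∀ b b' : M.toStarSubalgebra, (∀ y ∈ G, φ (b * y.1) = φ (b' * y.2)) → θ b = b' := by
  set G' := G.map ((StarAlgHom.snd ℂ (K →L[ℂ] K) (K →L[ℂ] K)).prod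
      (StarAlgHom.fst ℂ (K →L[ℂ] K) (K →L[ℂ] K))) with hG'
  have hGM' : ∀ y ∈ G', y.1 ∈ M ∧ y.2 ∈ M := by
    rintro _ ⟨y, hy, rfl⟩
    exact (hGM y hy).symm
  have hGt' : ∀ y ∈ G', φ y.1 = φ y.2 := by
    rintro _ ⟨y, hy, rfl⟩
    exact (hG y hy).symm
  have hG1' : ∀ a ∈ M, a ∈ generatedVonNeumannAlgebra
      (Prod.fst '' (G' : Set ((K →L[ℂ] K) × (K →L[ℂ] K)))) := by
    have : Prod.fst '' (G' : Set ((K →L[ℂ] K) × (K →L[ℂ] K))) =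
        Prod.snd '' (G : Set ((K →L[ℂ] K) × (K →L[ℂ] K))) := by
      rw [hG', StarSubalgebra.coe_map, Set.image_image]
      rfl
    rwa [this]
  have hex (b : M.toStarSubalgebra) : ∃ b' : M.toStarSubalgebra, IsGraphLimit G b b' := by
    obtain ⟨b', hb', hl⟩ := h.exists_isGraphLimit hGM hG hG1 b.2
    exact ⟨⟨b', hb'⟩, hl⟩
  have hex' (b : M.toStarSubalgebra) : ∃ b' : M.toStarSubalgebra, IsGraphLimit G b' b := by
    obtain ⟨b', hb', hl⟩ := h.exists_isGraphLimit hGM' hGt' hG1' b.2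
    have hl' := hl.swap
    have hGG : (G'.map ((StarAlgHom.snd ℂ (K →L[ℂ] K) (K →L[ℂ] K)).prod
      (StarAlgHom.fst ℂ (K →L[ℂ] K) (K →L[ℂ] K)))) = G := by
      refine SetLike.ext fun y => ⟨?_, fun hy => StarSubalgebra.mem_map.2
        ⟨y.swap, StarSubalgebra.mem_map.2 ⟨y, hy, rfl⟩, rfl⟩⟩
      rintro ⟨_, ⟨z, hz, rfl⟩, rfl⟩
      exact hz
    rw [hGG] at hl'
    exact ⟨⟨b', hb'⟩, hl'⟩
  -- The pairing with second coordinates separates `M`. Every algebraic property of `f` is therefore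
  -- proved by verifying a pairing identity.
  have huniq (b b' b'' : M.toStarSubalgebra) (h1 : ∀ y ∈ G, φ (b * y.1) = φ (b' * y.2))
      (h2 : ∀ y ∈ G, φ (b * y.1) = φ (b'' * y.2)) : b' = b'' := by
    refine Subtype.ext (sub_eq_zero.1 ?_)
    refine h.eq_zero_of_mul_right
      (A := G.map (StarAlgHom.snd ℂ (K →L[ℂ] K) (K →L[ℂ] K))) hG2 (sub_mem b'.2 b''.2) ?_
    rintro _ ⟨y, hy, rfl⟩
    rw [sub_mul, map_sub, sub_eq_zero]
    exact (h1 y hy).symm.trans (h2 y hy)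
  have huniq' (b b' b'' : M.toStarSubalgebra) (h1 : ∀ y ∈ G, φ (b * y.1) = φ (b'' * y.2))
      (h2 : ∀ y ∈ G, φ (b' * y.1) = φ (b'' * y.2)) : b = b' := by
    refine Subtype.ext (sub_eq_zero.1 ?_)
    refine h.eq_zero_of_mul_right
      (A := G.map (StarAlgHom.fst ℂ (K →L[ℂ] K) (K →L[ℂ] K))) hG1 (sub_mem b.2 b'.2) ?_
    rintro _ ⟨y, hy, rfl⟩
    rw [sub_mul, map_sub, sub_eq_zero]
    exact (h1 y hy).trans (h2 y hy).symm
  choose f hf using hex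
  choose g hg using hex'
  have hR (b : M.toStarSubalgebra) (y) (hy : y ∈ G) : φ (b * y.1) = φ (f b * y.2) :=
    (hf b).apply_mul h hG hy
  -- The pairing identity passes from `G` to all of `M` by approximating the second factor along its
  -- graph limit.
  have hR2 (b c : M.toStarSubalgebra) : φ (b * c : K →L[ℂ] K) = φ (f b * f c : K →L[ℂ] K) := by
    obtain ⟨U, z, C, hz, hC, h1, h2⟩ := hf c
    refine tendsto_nhds_unique (h.normal.tendsto_mul_left (l := (U : Filter _))
      (fun i => (norm_fst_le _).trans (hC i)) h1 b) ?_
    refine (h.normal.tendsto_mul_left (l := (U : Filter _))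
      (fun i => (_root_.norm_snd_le _).trans (hC i)) h2 _).congr fun i => ?_
    exact (hR b _ (hz i)).symm
  have hfy (c : M.toStarSubalgebra) (y) (hy : y ∈ G) :
      (f (c * ⟨y.1, (hGM y hy).1⟩) : K →L[ℂ] K) = f c * y.2 := by
    refine congrArg Subtype.val (huniq (c * ⟨y.1, (hGM y hy).1⟩) _ (f c * ⟨y.2, (hGM y hy).2⟩)
      (hR _) fun z hz => ?_)
    have := hR c _ (mul_mem hy hz)
    simp only [Prod.fst_mul, Prod.snd_mul, ← mul_assoc] at this
    exact this
  refine ⟨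
    { toFun := f
      invFun := g
      left_inv := fun b => huniq' _ _ (f b) (fun y hy => (hg (f b)).apply_mul h hG hy) (hR b)
      right_inv := fun b => huniq _ _ _ (hR (g b)) fun y hy => (hg b).apply_mul h hG hy
      map_mul' := fun b c => huniq _ _ _ (hR _) fun y hy => ?_
      map_add' := fun b c => huniq _ _ _ (hR _) fun y hy => ?_
      map_star' := fun b => huniq _ _ _ (hR _) fun y hy => (hf b).star.apply_mul h hG hy
      map_smul' := fun r b => huniq _ _ _ (hR _) fun y hy => ?_ }, fun b => ?_, fun b b' hb =>
        huniq b _ _ (hR b) hb⟩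
  -- Multiplicativity: `φ (b * c * y.1)` equals `φ (f b * f (c * y.1))` by `hR2`, and `f (c * y.1) =
  -- f c * y.2` by `hfy`.
  · have h1 := hR2 b (c * ⟨y.1, (hGM y hy).1⟩)
    rw [hfy c y hy] at h1
    change φ (((b : K →L[ℂ] K) * c) * y.1) = φ (((f b : K →L[ℂ] K) * f c) * y.2)
    rw [mul_assoc, mul_assoc]
    exact h1
  · have h1 := hR b y hy
    have h2 := hR c y hy
    change φ (((b : K →L[ℂ] K) + c) * y.1) = φ (((f b : K →L[ℂ] K) + f c) * y.2)
    rw [add_mul, add_mul, map_add, map_add, h1, h2]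
  · change φ ((r • (b : K →L[ℂ] K)) * y.1) = φ ((r • (f b : K →L[ℂ] K)) * y.2)
    rw [smul_mul_assoc, smul_mul_assoc, map_smul, map_smul, hR b y hy]
  · have h1 := hR b 1 (one_mem G)
    simp only [Prod.fst_one, Prod.snd_one, mul_one] at h1
    exact h1.symm

end Extension

end IsNormalTrace

end Traces

/-- The closure of a set which is stable under the algebraic operations and under scalars from a
dense sequence, as a `*`-subalgebra. -/
def closureStarSubalgebra {A : Type*} [TopologicalSpace A] [Ring A] [IsTopologicalRing A]
    [StarRing A] [ContinuousStar A] [Algebra ℂ A] [ContinuousSMul ℂ A] [StarModule ℂ A] (Q : Set A)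
    (hone : 1 ∈ Q) (hadd : ∀ a ∈ Q, ∀ b ∈ Q, a + b ∈ Q) (hmul : ∀ a ∈ Q, ∀ b ∈ Q, a * b ∈ Q)
    (hstar : ∀ a ∈ Q, star a ∈ Q)
    (hsmul : ∀ (k : ℕ), ∀ a ∈ Q, TopologicalSpace.denseSeq ℂ k • a ∈ Q) : StarSubalgebra ℂ A where
  carrier := closure Q
  mul_mem' ha hb := map_mem_closure₂ continuous_mul ha hb hmul
  add_mem' ha hb := map_mem_closure₂ continuous_add ha hb hadd
  star_mem' ha := map_mem_closure continuous_star ha hstar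
  algebraMap_mem' r := by
    rw [Algebra.algebraMap_eq_smul_one]
    refine map_mem_closure₂ (f := fun (r : ℂ) (a : A) => r • a) continuous_smul
      (TopologicalSpace.denseRange_denseSeq ℂ r) (subset_closure hone) ?_
    rintro _ ⟨k, rfl⟩ a ha
    exact hsmul k a ha

/-! ### Extending trace properties from a generating subalgebra. -/

section FiberTrace

variable {K : Type u} [NormedAddCommGroup K] [InnerProductSpace ℂ K] [CompleteSpace K]
  {M : VonNeumannAlgebra K} {φ : (K →L[ℂ] K) →ₗ[ℂ] ℂ} {A : StarSubalgebra ℂ (K →L[ℂ] K)}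

omit [CompleteSpace K] in
theorem tendsto_inner_apply {I : Type w} {l : Filter I} {p : I → K →L[ℂ] K} {a : K →L[ℂ] K}
    (h : ∀ v, Tendsto (fun i => p i v) l (𝓝 (a v))) (u v : K) :
    Tendsto (fun i => ⟪u, p i v⟫) l (𝓝 ⟪u, a v⟫) :=
  tendsto_const_nhds.inner (h v)

theorem IsNormalFunctional.tendsto_star_mul_self (h : IsNormalFunctional φ) {I : Type w}
    {l : Filter I} {p : I → K →L[ℂ] K} {a : K →L[ℂ] K} {C : ℝ} (hC : ∀ i, ‖p i‖ ≤ C)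
    (hp : ∀ v, Tendsto (fun i => p i v) l (𝓝 (a v))) :
    Tendsto (fun i => φ (star (p i) * p i)) l (𝓝 (φ (star a * a))) := by
  refine h.tendsto (C := C * C) (fun i => ?_) fun u v => ?_
  · refine (norm_mul_le _ _).trans ?_
    rw [norm_star]
    exact mul_le_mul (hC i) (hC i) (norm_nonneg _) ((norm_nonneg _).trans (hC i))
  · have h1 := (hp u).inner (𝕜 := ℂ) (hp v)
    simp only [mul_apply_eq_comp, ContinuousLinearMap.star_eq_adjoint,
      ContinuousLinearMap.adjoint_inner_right]
    exact h1

/-- The trace property extends from a generating subalgebra. -/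
theorem IsNormalFunctional.trace_of_generating (h : IsNormalFunctional φ)
    (hA : ∀ a ∈ M, a ∈ generatedVonNeumannAlgebra (A : Set (K →L[ℂ] K)))
    (hφ : ∀ a ∈ A, ∀ b ∈ A, φ (a * b) = φ (b * a)) {a b : K →L[ℂ] K} (ha : a ∈ M) (hb : b ∈ M) :
    φ (a * b) = φ (b * a) := by
  have h1 (a) (ha : a ∈ A) : φ (a * b) = φ (b * a) := by
    obtain ⟨U, p, C, hpA, hpC, hp⟩ := exists_bounded_ultrafilter (hA b hb)
    refine tendsto_nhds_unique (h.tendsto_mul_left (l := (U : Filter _)) hpC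
      (tendsto_inner_apply hp) a) ?_
    simp only [hφ _ ha _ (hpA _)]
    exact h.tendsto_mul_right hpC (tendsto_inner_apply hp) a
  obtain ⟨U, p, C, hpA, hpC, hp⟩ := exists_bounded_ultrafilter (hA a ha)
  refine tendsto_nhds_unique (h.tendsto_mul_right (l := (U : Filter _)) hpC
    (tendsto_inner_apply hp) b) ?_
  simp only [h1 _ (hpA _)]
  exact h.tendsto_mul_left hpC (tendsto_inner_apply hp) b

/-- Positivity extends from a generating subalgebra. -/
theorem IsNormalFunctional.nonneg_of_generating (h : IsNormalFunctional φ)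
    (hA : ∀ a ∈ M, a ∈ generatedVonNeumannAlgebra (A : Set (K →L[ℂ] K)))
    (hφ : ∀ a ∈ A, 0 ≤ φ (star a * a)) {a : K →L[ℂ] K} (ha : a ∈ M) : 0 ≤ φ (star a * a) := by
  obtain ⟨U, p, C, hpA, hpC, hp⟩ := exists_bounded_ultrafilter (hA a ha)
  exact ge_of_tendsto (h.tendsto_star_mul_self (l := (U : Filter _)) hpC hp)
    (Eventually.of_forall fun i => hφ _ (hpA i))

/-- Failure of faithfulness is witnessed by bounded sequences in a dense subset of a generating
subalgebra. -/
theorem IsNormalFunctional.exists_of_not_faithful (h : IsNormalFunctional φ)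
    (hA : ∀ a ∈ M, a ∈ generatedVonNeumannAlgebra (A : Set (K →L[ℂ] K)))
    {Q : Set (K →L[ℂ] K)} (hQ : ∀ a ∈ A, a ∈ closure Q) {ζ : ℕ → K}
    (hζ : (Submodule.span ℂ (Set.range ζ)).topologicalClosure = ⊤) {a : K →L[ℂ] K} (ha : a ∈ M)
    (h0 : φ (star a * a) = 0) (hne : a ≠ 0) :
    ∃ n C m : ℕ, ∀ k : ℕ, ∃ q ∈ Q, ‖q‖ ≤ C ∧ (φ (star q * q)).re ≤ (1 / 2 : ℝ) ^ k ∧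
      1 / ((m : ℝ) + 1) ≤ ‖q (ζ n)‖ := by
  obtain ⟨n, hn⟩ : ∃ n, a (ζ n) ≠ 0 := by
    by_contra hcon
    push Not at hcon
    refine hne (ContinuousLinearMap.ext_on
      (Submodule.dense_iff_topologicalClosure_eq_top.2 hζ) ?_)
    rintro _ ⟨n, rfl⟩
    exact hcon n
  obtain ⟨U, p, C, hpA, hpC, hp⟩ := exists_bounded_ultrafilter (hA a ha)
  obtain ⟨m, hm⟩ := exists_nat_one_div_lt (norm_pos_iff.2 hn)
  obtain ⟨N, hN⟩ := exists_nat_gt C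
  -- The three parameters are natural numbers so that, over a field of functionals, failure of
  -- faithfulness becomes a countable union of conditions.
  refine ⟨n, N, m, fun k => ?_⟩
  have h1 : Tendsto (fun i => (φ (star (p i) * p i)).re) U (𝓝 0) := by
    have := (Complex.continuous_re.tendsto _).comp
      (h.tendsto_star_mul_self (l := (U : Filter _)) hpC hp)
    rwa [h0] at this
  have h2 : Tendsto (fun i => ‖p i (ζ n)‖) U (𝓝 ‖a (ζ n)‖) := (hp _).norm
  obtain ⟨i, hi1, hi2⟩ := ((h1.eventually_lt_const (by positivity : (0 : ℝ) < (1 / 2) ^ k)).and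
    (h2.eventually_const_lt hm)).exists
  -- The conditions are made strict so that they define an open set, which then meets the norm dense
  -- set `Q`.
  let O : Set (K →L[ℂ] K) := {q | ‖q‖ < N ∧ (φ (star q * q)).re < (1 / 2 : ℝ) ^ k ∧
    1 / ((m : ℝ) + 1) < ‖q (ζ n)‖}
  have hO : IsOpen O := by
    have h3 : IsOpen {q : K →L[ℂ] K | ‖q‖ < N} := isOpen_lt continuous_norm continuous_const
    have h4 : IsOpen {q : K →L[ℂ] K | (φ (star q * q)).re < (1 / 2 : ℝ) ^ k} :=
      isOpen_lt (Complex.continuous_re.comp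
        (h.continuous.comp (continuous_star.mul continuous_id))) continuous_const
    have h5 : IsOpen {q : K →L[ℂ] K | 1 / ((m : ℝ) + 1) < ‖q (ζ n)‖} :=
      isOpen_lt continuous_const (by fun_prop)
    exact h3.inter (h4.inter h5)
  obtain ⟨q, hqO, hqQ⟩ := mem_closure_iff.1 (hQ _ (hpA i)) O hO ⟨(hpC i).trans_lt hN, hi1, hi2⟩
  exact ⟨q, hqQ, hqO.1.le, hqO.2.1.le, hqO.2.2.le⟩

end FiberTrace

/-- A countable set is contained in a countable set which is stable under countably many unary and
binary operations. -/
theorem exists_countable_stable {E : Type*} {ι κ : Type*} [Countable ι] [Countable κ]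
    (f : ι → E → E) (g : κ → E → E → E) {S : Set E} (hS : S.Countable) :
    ∃ T : Set E, T.Countable ∧ S ⊆ T ∧ (∀ i, ∀ a ∈ T, f i a ∈ T) ∧
      ∀ k, ∀ a ∈ T, ∀ b ∈ T, g k a b ∈ T := by
  let step : Set E → Set E := fun T => (T ∪ ⋃ i, f i '' T) ∪ ⋃ k, Set.image2 (g k) T T
  have hstep (T : Set E) : T ⊆ step T := fun a ha => Or.inl (Or.inl ha)
  let T : ℕ → Set E := fun n => step^[n] S
  have hsucc (n : ℕ) : T (n + 1) = step (T n) := Function.iterate_succ_apply' step n S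
  have hmono : Monotone T := monotone_nat_of_le_succ fun n => by rw [hsucc]; exact hstep _
  have hcount (n : ℕ) : (T n).Countable := by
    induction n with
    | zero => exact hS
    | succ n ih =>
      rw [hsucc]
      exact (ih.union (Set.countable_iUnion fun i => ih.image _)).union
        (Set.countable_iUnion fun k => ih.image2 ih _)
  refine ⟨⋃ n, T n, Set.countable_iUnion hcount, Set.subset_iUnion T 0, fun i a ha => ?_,
    fun k a ha b hb => ?_⟩
  · obtain ⟨n, hn⟩ := Set.mem_iUnion.1 ha
    refine Set.mem_iUnion.2 ⟨n + 1, ?_⟩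
    rw [hsucc]
    exact Or.inl (Or.inr (Set.mem_iUnion.2 ⟨i, a, hn, rfl⟩))
  · obtain ⟨n, hn⟩ := Set.mem_iUnion.1 ha
    obtain ⟨m, hm⟩ := Set.mem_iUnion.1 hb
    refine Set.mem_iUnion.2 ⟨max n m + 1, ?_⟩
    rw [hsucc]
    exact Or.inr (Set.mem_iUnion.2 ⟨k, a, hmono (le_max_left n m) hn, b,
      hmono (le_max_right n m) hm, rfl⟩)

/-! ### Total sequences and measurability of sections. -/

namespace HilbertField

variable {X : Type u} [MeasurableSpace X] {μ : Measure X} {H : X → Type v}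
  [∀ x, NormedAddCommGroup (H x)] [∀ x, InnerProductSpace ℂ (H x)]

section Sections

variable {F : HilbertField μ H}

theorem smul_mem_sections {f : X → ℂ} (hf : AEMeasurable f μ) {ζ : ∀ x, H x}
    (hζ : ζ ∈ F.sections) : (fun x => f x • ζ x) ∈ F.sections := by
  refine (F.mem_sections_iff _).2 fun θ hθ => ?_
  simp only [inner_smul_right]
  exact hf.mul (F.aemeasurable_inner hθ hζ)

theorem mem_sections_congr {ζ ζ' : ∀ x, H x} (hζ : ζ ∈ F.sections) (h : ∀ᵐ x ∂μ, ζ x = ζ' x) :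
    ζ' ∈ F.sections := by
  refine (F.mem_sections_iff _).2 fun θ hθ => ?_
  refine (F.aemeasurable_inner hθ hζ).congr ?_
  filter_upwards [h] with x hx
  rw [hx]

/-- A sequence of sections which is total in almost every fiber. -/
def IsTotal (F : HilbertField μ H) (ζ : ℕ → F.L2) : Prop :=
  ∀ᵐ x ∂μ, (Submodule.span ℂ (Set.range fun n => ζ n x)).topologicalClosure = ⊤

/-- Choose an integrable, strictly positive `g`. Multiplying `ζ n` by `√g / (1 + ‖ζ n‖)` makes it
square integrable and leaves the spans in the fibers unchanged. -/
theorem exists_isTotal (F : HilbertField μ H) [SigmaFinite μ] : ∃ ζ : ℕ → F.L2, F.IsTotal ζ := by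
  obtain ⟨ζ, hζ, ht⟩ := F.exists_total
  obtain ⟨g, hg0, hgm, hg⟩ := exists_pos_lintegral_lt_of_sigmaFinite μ one_ne_zero
  let r : ℕ → X → ℝ := fun n x => √(g x) / (1 + ‖ζ n x‖)
  have hr0 n x : 0 < r n x := div_pos (Real.sqrt_pos.2 (hg0 x)) (by positivity)
  have hrm n : AEMeasurable (r n) μ :=
    (Real.continuous_sqrt.measurable.comp
      (NNReal.continuous_coe.measurable.comp hgm)).aemeasurable.div
        (aemeasurable_const.add (F.aemeasurable_norm (hζ n)))
  have hsec n : (fun x => (r n x : ℂ) • ζ n x) ∈ F.sections :=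
    smul_mem_sections (Complex.continuous_ofReal.measurable.comp_aemeasurable (hrm n)) (hζ n)
  have hgi : Integrable (fun x => (g x : ℝ)) μ :=
    integrable_toReal_of_lintegral_ne_top (f := fun x => (g x : ℝ≥0∞))
      (hgm.coe_nnreal_ennreal.aemeasurable) (hg.trans ENNReal.one_lt_top).ne
  have hL n : (fun x => (r n x : ℂ) • ζ n x) ∈ F.squareIntegrable := by
    refine ⟨hsec n, hgi.mono' ((F.aemeasurable_norm (hsec n)).pow_const 2).aestronglyMeasurable
      (Eventually.of_forall fun x => ?_)⟩
    have h1 : ‖(r n x : ℂ) • ζ n x‖ ≤ √(g x) := by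
      rw [norm_smul, Complex.norm_real, Real.norm_of_nonneg (hr0 n x).le]
      simp only [r]
      rw [div_mul_eq_mul_div, div_le_iff₀ (by positivity)]
      nlinarith [Real.sqrt_nonneg (g x), norm_nonneg (ζ n x)]
    rw [norm_pow, norm_norm, ← Real.sq_sqrt (NNReal.coe_nonneg (g x))]
    exact pow_le_pow_left₀ (norm_nonneg _) h1 2
  refine ⟨fun n => L2.of _ (hL n), ?_⟩
  filter_upwards [ht] with x hx
  rw [eq_top_iff, ← hx]
  refine Submodule.topologicalClosure_mono (Submodule.span_le.2 ?_)
  rintro _ ⟨n, rfl⟩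
  have h0 : (r n x : ℂ) ≠ 0 := by exact_mod_cast (hr0 n x).ne'
  have h1 := Submodule.smul_mem (Submodule.span ℂ (Set.range fun n => (r n x : ℂ) • ζ n x))
    (r n x : ℂ)⁻¹ (Submodule.subset_span ⟨n, rfl⟩)
  simp only [smul_smul, inv_mul_cancel₀ h0, one_smul] at h1
  exact h1

/-- Finite linear combinations with coefficients from a fixed dense sequence. -/
def combination (F : HilbertField μ H) (ζ : ℕ → F.L2) (j : Finset ℕ × ℕ) : F.L2 :=
  ∑ i ∈ j.1, (TopologicalSpace.denseSeq (ℕ → ℂ) j.2 i) • ζ i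

theorem combination_apply (ζ : ℕ → F.L2) (j : Finset ℕ × ℕ) (x : X) :
    F.combination ζ j x = ∑ i ∈ j.1, (TopologicalSpace.denseSeq (ℕ → ℂ) j.2 i) • ζ i x := by
  rw [combination, map_sum, Finset.sum_apply]
  rfl

/-- For a fixed finite support the combination depends continuously on the coefficients in the
product topology of `ℕ → ℂ`, so a dense sequence of coefficients suffices. This yields countably
many sections, dense in almost every fiber. -/
theorem IsTotal.denseRange {ζ : ℕ → F.L2} (hζ : F.IsTotal ζ) :
    ∀ᵐ x ∂μ, DenseRange fun j => F.combination ζ j x := by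
  filter_upwards [hζ] with x hx
  rw [DenseRange, dense_iff_closure_eq, Set.eq_univ_iff_forall]
  intro v
  have hv : v ∈ closure (Submodule.span ℂ (Set.range fun n => ζ n x) : Set (H x)) := by
    rw [← Submodule.topologicalClosure_coe, hx]
    trivial
  refine closure_minimal ?_ isClosed_closure hv
  intro y hy
  obtain ⟨c, rfl⟩ := Finsupp.mem_span_range_iff_exists_finsupp.1 hy
  have hcont : Continuous fun z : ℕ → ℂ => ∑ i ∈ c.support, z i • ζ i x := by fun_prop
  have hd := TopologicalSpace.denseRange_denseSeq (ℕ → ℂ)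
  have := hcont.range_subset_closure_image_dense hd ⟨(c : ℕ → ℂ), rfl⟩
  refine closure_mono ?_ this
  rintro _ ⟨_, ⟨k, rfl⟩, rfl⟩
  exact ⟨(c.support, k), combination_apply ζ _ x⟩

/-- `2 Re ⟪w, u⟫ - ‖w‖² = ‖u‖² - ‖u - w‖²`, so `‖u‖²` is the supremum of the left side over a
countable dense family of `w`. -/
theorem IsTotal.aemeasurable_norm_sq {ζ : ℕ → F.L2} (hζ : F.IsTotal ζ) {u : ∀ x, H x}
    (hu : ∀ n, AEMeasurable (fun x => ⟪ζ n x, u x⟫) μ) :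
    AEMeasurable (fun x => ‖u x‖ ^ 2) μ := by
  refine AEMeasurable.isLUB (ι := Finset ℕ × ℕ)
    (f := fun j x => 2 * (⟪F.combination ζ j x, u x⟫).re - ‖F.combination ζ j x‖ ^ 2)
    (fun j => ?_) ?_
  · refine AEMeasurable.sub (AEMeasurable.const_mul ?_ _)
      ((F.aemeasurable_norm (F.combination ζ j).mem_sections).pow_const 2)
    refine Complex.measurable_re.comp_aemeasurable ?_
    simp only [combination_apply, sum_inner, inner_smul_left]
    exact Finset.aemeasurable_fun_sum _ fun i _ => (hu i).const_mul _
  · filter_upwards [hζ.denseRange] with x hx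
    have key (w : H x) : 2 * (⟪w, u x⟫).re - ‖w‖ ^ 2 = ‖u x‖ ^ 2 - ‖u x - w‖ ^ 2 := by
      have h1 := norm_sub_sq (𝕜 := ℂ) (u x) w
      have h2 : RCLike.re ⟪u x, w⟫ = (⟪w, u x⟫).re := inner_re_symm (𝕜 := ℂ) _ _
      rw [h2] at h1
      linarith
    simp only [key]
    constructor
    · rintro _ ⟨j, rfl⟩
      linarith [sq_nonneg ‖u x - F.combination ζ j x‖]
    · intro b hb
      refine le_of_forall_pos_le_add fun ε hε => ?_
      obtain ⟨j, hj⟩ := hx.exists_dist_lt (u x) (Real.sqrt_pos.2 hε)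
      have h1 : ‖u x‖ ^ 2 - ‖u x - F.combination ζ j x‖ ^ 2 ≤ b := hb ⟨j, rfl⟩
      rw [dist_eq_norm] at hj
      have h2 : ‖u x - F.combination ζ j x‖ ^ 2 < ε := by
        rw [← Real.sq_sqrt hε.le]
        exact pow_lt_pow_left₀ hj (norm_nonneg _) two_ne_zero
      linarith

/-- Measurability of a section can be tested on a total sequence. -/
theorem IsTotal.mem_sections {ζ : ℕ → F.L2} (hζ : F.IsTotal ζ) {u : ∀ x, H x}
    (hu : ∀ n, AEMeasurable (fun x => ⟪ζ n x, u x⟫) μ) : u ∈ F.sections := by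
  refine (F.mem_sections_iff u).2 fun θ hθ => ?_
  -- Polarization: the real part of the inner product is a combination of squared norms, which are
  -- measurable by the preceding criterion.
  have hre (θ : ∀ x, H x) (hθ : θ ∈ F.sections) : AEMeasurable (fun x => (⟪θ x, u x⟫).re) μ := by
    have h1 := hζ.aemeasurable_norm_sq (u := fun x => u x + θ x) fun n => by
      simp only [inner_add_right]
      exact (hu n).add (F.aemeasurable_inner (ζ n).mem_sections hθ)
    have h2 := (((h1.sub (hζ.aemeasurable_norm_sq hu)).sub
      ((F.aemeasurable_norm hθ).pow_const 2)).div_const 2)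
    refine h2.congr (Eventually.of_forall fun x => ?_)
    have h3 := norm_add_sq (𝕜 := ℂ) (u x) (θ x)
    have h4 : RCLike.re ⟪u x, θ x⟫ = (⟪θ x, u x⟫).re := inner_re_symm (𝕜 := ℂ) _ _
    rw [h4] at h3
    simp only [Pi.sub_apply]
    rw [h3]
    ring
  have him := hre _ (F.sections.smul_mem Complex.I hθ)
  have h5 : AEMeasurable (fun x => (((⟪θ x, u x⟫).re : ℂ) +
      ((⟪(Complex.I • θ) x, u x⟫).re : ℂ) * Complex.I)) μ :=
    (Complex.measurable_ofReal.comp_aemeasurable (hre θ hθ)).add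
      ((Complex.measurable_ofReal.comp_aemeasurable him).mul_const _)
  refine h5.congr (Eventually.of_forall fun x => ?_)
  simp only [Pi.smul_apply, inner_smul_left, Complex.conj_I, neg_mul, Complex.neg_re,
    Complex.I_mul_re, neg_neg]
  exact Complex.re_add_im _

/-- The adjoint field applied to `η` is a measurable section, since its inner products with `ζ n`
are those of `T x (ζ n x)` with `η`. Moving the operator back then handles an arbitrary `ξ`. -/
theorem IsTotal.isMeasurableOperatorField [∀ x, CompleteSpace (H x)] {ζ : ℕ → F.L2}
    (hζ : F.IsTotal ζ) {T : ∀ x, H x →L[ℂ] H x}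
    (hT : ∀ n, (fun x => T x (ζ n x)) ∈ F.sections) (hb : ∃ C : ℝ, ∀ᵐ x ∂μ, ‖T x‖ ≤ C) :
    F.IsMeasurableOperatorField T := by
  refine ⟨fun ξ hξ η hη => ?_, hb⟩
  have h1 : (fun x => star (T x) (η x)) ∈ F.sections := hζ.mem_sections fun n => by
    refine (F.aemeasurable_inner (hT n) hη).congr (Eventually.of_forall fun x => ?_)
    exact (ContinuousLinearMap.adjoint_inner_right (T x) (ζ n x) (η x)).symm
  refine (F.aemeasurable_inner hξ h1).congr (Eventually.of_forall fun x => ?_)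
  exact ContinuousLinearMap.adjoint_inner_right (T x) (ξ x) (η x)

theorem IsMeasurableOperatorField.congr {T T' : ∀ x, H x →L[ℂ] H x}
    (hT : F.IsMeasurableOperatorField T) (h : ∀ᵐ x ∂μ, T x = T' x) :
    F.IsMeasurableOperatorField T' := by
  refine ⟨fun ξ hξ η hη => (hT.aemeasurable ξ hξ η hη).congr ?_, ?_⟩
  · filter_upwards [h] with x hx
    rw [hx]
  · obtain ⟨C, hC⟩ := hT.bounded
    refine ⟨C, ?_⟩
    filter_upwards [h, hC] with x hx hC
    rwa [← hx]

theorem IsMeasurableOperatorField.diagonal (F : HilbertField μ H) {f : X → ℂ} (hf : MemLp f ∞ μ) :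
    F.IsMeasurableOperatorField (fun x => f x • (1 : H x →L[ℂ] H x)) := by
  refine ⟨fun ξ hξ η hη => ?_, (eLpNormEssSup f μ).toReal, ?_⟩
  · exact F.aemeasurable_inner (smul_mem_sections hf.1.aemeasurable hξ) hη
  · have h1 := ae_le_eLpNormEssSup (f := f) (μ := μ)
    have h2 : eLpNormEssSup f μ ≠ ∞ := by
      have := hf.2
      rw [eLpNorm_exponent_top] at this
      exact this.ne
    filter_upwards [h1] with x hx
    rw [norm_smul]
    refine (mul_le_of_le_one_right (norm_nonneg _) ContinuousLinearMap.norm_id_le).trans ?_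
    rw [← toReal_enorm]
    exact ENNReal.toReal_mono h2 hx

end Sections

/-! ### Decomposable operators and uniqueness of their fields. -/

namespace IsMeasurableOperatorField

variable {F : HilbertField μ H} {T S : ∀ x, H x →L[ℂ] H x}

theorem exists_isDirectIntegral (hT : F.IsMeasurableOperatorField T) :
    ∃ A, F.IsDirectIntegral A T := by
  obtain ⟨C, hC⟩ := hT.bounded
  have hbd (ζ : F.L2) : ‖DirectIntegral.mk (hT.apply ζ)‖ ≤ |C| * ‖DirectIntegral.mk ζ‖ := by
    rw [DirectIntegral.norm_mk, DirectIntegral.norm_mk,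
      ← sq_le_sq₀ (norm_nonneg _) (by positivity), mul_pow, L2.norm_sq_eq, L2.norm_sq_eq,
      ← integral_const_mul]
    refine integral_mono_ae (L2.integrable _) ((L2.integrable _).const_mul _) ?_
    filter_upwards [hC] with x hx
    rw [← mul_pow]
    exact pow_le_pow_left₀ (norm_nonneg _) ((T x).le_of_opNorm_le (hx.trans (le_abs_self C)) _) 2
  -- Representatives are chosen arbitrarily; `hmk` shows that the resulting class does not depend on
  -- the choice.
  let s : F.DirectIntegral → F.L2 := Function.surjInv DirectIntegral.mk_surjective
  have hs (u : F.DirectIntegral) : DirectIntegral.mk (s u) = u :=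
    Function.surjInv_eq DirectIntegral.mk_surjective u
  have hmk (ζ : F.L2) : DirectIntegral.mk (hT.apply (s (DirectIntegral.mk ζ))) =
      DirectIntegral.mk (hT.apply ζ) := by
    rw [DirectIntegral.mk_eq_mk_iff]
    filter_upwards [(DirectIntegral.mk_eq_mk_iff _ _).1 (hs (DirectIntegral.mk ζ))] with x hx
    rw [apply_apply, apply_apply, hx]
  let A : F.DirectIntegral →ₗ[ℂ] F.DirectIntegral :=
    { toFun := fun u => DirectIntegral.mk (hT.apply (s u))
      map_add' := fun u v => by
        conv_lhs => rw [← hs u, ← hs v, ← DirectIntegral.mk_add, hmk]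
        rw [← DirectIntegral.mk_add, DirectIntegral.mk_eq_mk_iff]
        exact Eventually.of_forall fun x => by simp
      map_smul' := fun c u => by
        conv_lhs => rw [← hs u, ← DirectIntegral.mk_smul, hmk]
        rw [RingHom.id_apply, ← DirectIntegral.mk_smul, DirectIntegral.mk_eq_mk_iff]
        exact Eventually.of_forall fun x => by simp }
  refine ⟨A.mkContinuous |C| fun u => ?_, hT, hmk⟩
  have := hbd (s u)
  rwa [hs] at this

end IsMeasurableOperatorField

namespace IsDirectIntegral

variable {F : HilbertField μ H} {A A' : F.DirectIntegral →L[ℂ] F.DirectIntegral}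
  {T T' : ∀ x, H x →L[ℂ] H x}

theorem apply_mk_eq_iff (h : F.IsDirectIntegral A T) (ζ η : F.L2) :
    A (DirectIntegral.mk ζ) = DirectIntegral.mk η ↔ ∀ᵐ x ∂μ, T x (ζ x) = η x := by
  obtain ⟨hT, h⟩ := h
  rw [h, DirectIntegral.mk_eq_mk_iff]
  rfl

theorem congr (h : F.IsDirectIntegral A T) (he : ∀ᵐ x ∂μ, T x = T' x) :
    F.IsDirectIntegral A T' := by
  obtain ⟨hT, h⟩ := h
  refine ⟨hT.congr he, fun ζ => ?_⟩
  rw [h, DirectIntegral.mk_eq_mk_iff]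
  filter_upwards [he] with x hx
  simp [hx]

theorem eq_of_isDirectIntegral (h : F.IsDirectIntegral A T) (h' : F.IsDirectIntegral A' T) :
    A = A' := by
  obtain ⟨hT, h⟩ := h
  obtain ⟨hT', h'⟩ := h'
  ext u
  obtain ⟨ζ, rfl⟩ := DirectIntegral.mk_surjective u
  rw [h, h']

theorem mul (h : F.IsDirectIntegral A T) (h' : F.IsDirectIntegral A' T') :
    F.IsDirectIntegral (A * A') fun x => T x * T' x := by
  obtain ⟨hT, h⟩ := h
  obtain ⟨hT', h'⟩ := h'
  refine ⟨hT.mul hT', fun ζ => ?_⟩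
  change A (A' _) = _
  rw [h', h]
  rfl

theorem add (h : F.IsDirectIntegral A T) (h' : F.IsDirectIntegral A' T') :
    F.IsDirectIntegral (A + A') fun x => T x + T' x := by
  obtain ⟨hT, h⟩ := h
  obtain ⟨hT', h'⟩ := h'
  refine ⟨hT.add hT', fun ζ => ?_⟩
  change A _ + A' _ = _
  rw [h', h]
  rfl

theorem smul_one (F : HilbertField μ H) (r : ℂ) :
    F.IsDirectIntegral (r • (1 : F.DirectIntegral →L[ℂ] F.DirectIntegral))
      fun x => r • (1 : H x →L[ℂ] H x) :=
  ⟨.smul_one F r, fun _ => rfl⟩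

theorem one (F : HilbertField μ H) :
    F.IsDirectIntegral (1 : F.DirectIntegral →L[ℂ] F.DirectIntegral)
      fun x => (1 : H x →L[ℂ] H x) := by
  simpa only [one_smul] using smul_one F 1

theorem smul (h : F.IsDirectIntegral A T) (r : ℂ) :
    F.IsDirectIntegral (r • A) fun x => r • T x := by
  have := (smul_one F r).mul h
  simpa only [smul_mul_assoc, one_mul] using this

theorem sub (h : F.IsDirectIntegral A T) (h' : F.IsDirectIntegral A' T') :
    F.IsDirectIntegral (A - A') fun x => T x - T' x := by
  have := h.add (h'.smul (-1))
  simpa only [neg_smul, one_smul, ← sub_eq_add_neg] using this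

theorem star [∀ x, CompleteSpace (H x)] (h : F.IsDirectIntegral A T) :
    F.IsDirectIntegral (star A) fun x => star (T x) := by
  obtain ⟨hT, h⟩ := h
  refine ⟨hT.star, fun ζ => ?_⟩
  refine ext_inner_right ℂ fun v => ?_
  obtain ⟨η, rfl⟩ := DirectIntegral.mk_surjective v
  rw [ContinuousLinearMap.star_eq_adjoint, ContinuousLinearMap.adjoint_inner_left, h,
    DirectIntegral.inner_mk_mk, DirectIntegral.inner_mk_mk]
  refine integral_congr_ae (Eventually.of_forall fun x => ?_)
  exact (ContinuousLinearMap.adjoint_inner_left (T x) (η x) (ζ x)).symm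

theorem inner_mk_mk (h : F.IsDirectIntegral A T) (ζ η : F.L2) :
    ⟪DirectIntegral.mk ζ, A (DirectIntegral.mk η)⟫ = ∫ x, ⟪ζ x, T x (η x)⟫ ∂μ := by
  obtain ⟨hT, h⟩ := h
  rw [h, DirectIntegral.inner_mk_mk]
  rfl

/-- The field of a decomposable operator is unique almost everywhere. -/
theorem ae_eq [SigmaFinite μ] (h : F.IsDirectIntegral A T) (h' : F.IsDirectIntegral A T') :
    ∀ᵐ x ∂μ, T x = T' x := by
  obtain ⟨ζ, hζ⟩ := F.exists_isTotal
  obtain ⟨hT', h2⟩ := h'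
  have h1 : ∀ᵐ x ∂μ, ∀ n, T x (ζ n x) = T' x (ζ n x) :=
    ae_all_iff.2 fun n => (h.apply_mk_eq_iff _ _).1 (h2 (ζ n))
  filter_upwards [h1, hζ] with x hx ht
  refine ContinuousLinearMap.ext_on (Submodule.dense_iff_topologicalClosure_eq_top.2 ht) ?_
  rintro _ ⟨n, rfl⟩
  exact hx n

end IsDirectIntegral

/-! ### The commutant of the diagonal algebra. -/

/-- Commutation with the diagonal algebra `L^∞(X, μ)`. -/
def CommutesWithDiagonal (F : HilbertField μ H) (A : F.DirectIntegral →L[ℂ] F.DirectIntegral) :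
    Prop :=
  ∀ (f : X → ℂ) (D : F.DirectIntegral →L[ℂ] F.DirectIntegral), MemLp f ∞ μ →
    F.IsDirectIntegral D (fun x => f x • (1 : H x →L[ℂ] H x)) → A * D = D * A

theorem IsDirectIntegral.commutesWithDiagonal {F : HilbertField μ H}
    {A : F.DirectIntegral →L[ℂ] F.DirectIntegral} {T : ∀ x, H x →L[ℂ] H x}
    (h : F.IsDirectIntegral A T) : F.CommutesWithDiagonal A := by
  intro f D _ hD
  refine (h.mul hD).eq_of_isDirectIntegral ?_
  simpa only [mul_smul_comm, smul_mul_assoc, mul_one, one_mul] using hD.mul h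

theorem memLp_top_indicator_one (μ : Measure X) {E : Set X} (hE : MeasurableSet E) :
    MemLp (E.indicator fun _ => (1 : ℂ)) ∞ μ :=
  (memLp_top_const (1 : ℂ)).indicator hE

/-- `A` commutes with multiplication by the indicator of `E`, so its norm bound may be applied to
the restriction of `ζ` to `E`. Varying `E` then gives a pointwise bound. -/
theorem setIntegral_norm_sq_le {F : HilbertField μ H} {A : F.DirectIntegral →L[ℂ] F.DirectIntegral}
    (hA : F.CommutesWithDiagonal A) {ζ η : F.L2}
    (h : A (DirectIntegral.mk ζ) = DirectIntegral.mk η) {E : Set X} (hE : MeasurableSet E) :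
    ∫ x in E, ‖η x‖ ^ 2 ∂μ ≤ ∫ x in E, (‖A‖ * ‖ζ x‖) ^ 2 ∂μ := by
  have hf := memLp_top_indicator_one μ hE
  obtain ⟨D, hD⟩ := (IsMeasurableOperatorField.diagonal F hf).exists_isDirectIntegral
  have hDn (θ : F.L2) : ‖D (DirectIntegral.mk θ)‖ ^ 2 = ∫ x in E, ‖θ x‖ ^ 2 ∂μ := by
    obtain ⟨hT, h2⟩ := hD
    rw [h2, DirectIntegral.norm_mk, L2.norm_sq_eq, ← integral_indicator hE]
    refine integral_congr_ae (Eventually.of_forall fun x => ?_)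
    by_cases hx : x ∈ E <;> simp [hx]
  have h1 := congrArg (fun S => S (DirectIntegral.mk ζ)) (hA _ D hf hD)
  simp only [mul_apply_eq_comp] at h1
  rw [h] at h1
  simp only [mul_pow]
  rw [integral_const_mul, ← hDn, ← hDn, ← h1, ← mul_pow]
  exact pow_le_pow_left₀ (norm_nonneg _) (A.le_opNorm _) 2

theorem ae_norm_le {F : HilbertField μ H} {A : F.DirectIntegral →L[ℂ] F.DirectIntegral}
    (hA : F.CommutesWithDiagonal A) {ζ η : F.L2}
    (h : A (DirectIntegral.mk ζ) = DirectIntegral.mk η) : ∀ᵐ x ∂μ, ‖η x‖ ≤ ‖A‖ * ‖ζ x‖ := by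
  have hi : Integrable (fun x => (‖A‖ * ‖ζ x‖) ^ 2) μ := by
    simpa only [mul_pow] using ζ.integrable.const_mul _
  have h1 := ae_le_of_forall_setIntegral_le η.integrable hi fun E hE _ =>
    setIntegral_norm_sq_le hA h hE
  filter_upwards [h1] with x hx
  exact (sq_le_sq₀ (norm_nonneg _) (by positivity)).1 hx

/-- Orthogonality of `θ` to all restrictions of `ζ n` to measurable sets forces `⟪ζ n x, θ x⟫ = 0`
almost everywhere, and totality gives `θ = 0`. -/
theorem dense_span_diagonal [∀ x, CompleteSpace (H x)] {F : HilbertField μ H} {ζ : ℕ → F.L2}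
    (hζ : F.IsTotal ζ) :
    Dense (Submodule.span ℂ {u : F.DirectIntegral | ∃ (n : ℕ) (E : Set X)
      (D : F.DirectIntegral →L[ℂ] F.DirectIntegral), MeasurableSet E ∧ F.IsDirectIntegral D
        (fun x => E.indicator (fun _ => (1 : ℂ)) x • (1 : H x →L[ℂ] H x)) ∧
        u = D (DirectIntegral.mk (ζ n))} : Set F.DirectIntegral) := by
  rw [Submodule.dense_iff_topologicalClosure_eq_top, Submodule.topologicalClosure_eq_top_iff,
    Submodule.eq_bot_iff]
  intro u hu
  obtain ⟨θ, rfl⟩ := DirectIntegral.mk_surjective u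
  have h0 : ∀ᵐ x ∂μ, ∀ n, ⟪ζ n x, θ x⟫ = 0 := by
    refine ae_all_iff.2 fun n => ?_
    refine Integrable.ae_eq_zero_of_forall_setIntegral_eq_zero (L2.integrable_inner _ _) ?_
    intro E hE _
    obtain ⟨D, hD⟩ := (IsMeasurableOperatorField.diagonal F
      (memLp_top_indicator_one μ hE)).exists_isDirectIntegral
    have h1 := (Submodule.mem_orthogonal _ _).1 hu _ (Submodule.subset_span ⟨n, E, D, hE, hD, rfl⟩)
    obtain ⟨hT, h2⟩ := hD
    rw [h2, DirectIntegral.inner_mk_mk] at h1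
    rw [← integral_indicator hE, ← h1]
    refine integral_congr_ae (Eventually.of_forall fun x => ?_)
    by_cases hx : x ∈ E <;> simp [hx]
  have h3 : (0 : F.DirectIntegral) = DirectIntegral.mk 0 := rfl
  rw [h3, DirectIntegral.mk_eq_mk_iff]
  filter_upwards [h0, hζ] with x hx ht
  have h4 : θ x ∈ (Submodule.span ℂ (Set.range fun n => ζ n x))ᗮ := by
    rw [Submodule.mem_orthogonal]
    intro v hv
    induction hv using Submodule.span_induction with
    | mem v hv => obtain ⟨n, rfl⟩ := hv; exact hx n
    | zero => simp
    | add v w _ _ h1 h2 => rw [inner_add_left, h1, h2, add_zero]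
    | smul c v _ h1 => rw [inner_smul_left, h1, mul_zero]
  rw [Submodule.topologicalClosure_eq_top_iff] at ht
  rw [ht] at h4
  exact (Submodule.mem_bot ℂ).1 h4

/-- The commutant of the diagonal algebra consists of the decomposable operators. -/
theorem CommutesWithDiagonal.exists_isDirectIntegral [∀ x, CompleteSpace (H x)] [SigmaFinite μ]
    {F : HilbertField μ H} {A : F.DirectIntegral →L[ℂ] F.DirectIntegral}
    (hA : F.CommutesWithDiagonal A) :
    ∃ T : ∀ x, H x →L[ℂ] H x, F.IsDirectIntegral A T ∧ ∀ᵐ x ∂μ, ‖T x‖ ≤ ‖A‖ := by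
  obtain ⟨ζ, hζ⟩ := F.exists_isTotal
  choose η hη using fun n => DirectIntegral.mk_surjective (A (DirectIntegral.mk (ζ n)))
  have hcomb (j : Finset ℕ × ℕ) : A (DirectIntegral.mk (F.combination ζ j)) =
      DirectIntegral.mk (F.combination η j) := by
    have hlin (θ : ℕ → F.L2) : DirectIntegral.mk (F.combination θ j) =
        ∑ i ∈ j.1, (TopologicalSpace.denseSeq (ℕ → ℂ) j.2 i) • DirectIntegral.mk (θ i) :=
      map_sum ({ toFun := DirectIntegral.mk, map_zero' := rfl, map_add' := fun _ _ => rfl } :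
        F.L2 →+ F.DirectIntegral) _ _
    rw [hlin, hlin, map_sum]
    exact Finset.sum_congr rfl fun i _ => by rw [map_smul, hη]
  -- The pointwise bound holds off one null set for the countably many combinations with
  -- coefficients in the dense sequence. Continuity in the coefficients extends it to all of them at
  -- the same `x`.
  have hbd : ∀ᵐ x ∂μ, ∀ c : ℕ →₀ ℂ, ‖Finsupp.linearCombination ℂ (fun n => η n x) c‖ ≤
      ‖A‖ * ‖Finsupp.linearCombination ℂ (fun n => ζ n x) c‖ := by
    filter_upwards [ae_all_iff.2 fun j => ae_norm_le hA (hcomb j)] with x hx c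
    rw [Finsupp.linearCombination_apply, Finsupp.linearCombination_apply, Finsupp.sum, Finsupp.sum]
    have hcl : IsClosed {z : ℕ → ℂ | ‖∑ i ∈ c.support, z i • η i x‖ ≤
        ‖A‖ * ‖∑ i ∈ c.support, z i • ζ i x‖} :=
      isClosed_le (by fun_prop) (by fun_prop)
    refine hcl.closure_subset_iff.2 (Set.range_subset_iff.2 fun k => ?_)
      (TopologicalSpace.denseRange_denseSeq (ℕ → ℂ) (c : ℕ → ℂ))
    have := hx (c.support, k)
    rwa [combination_apply, combination_apply] at this
  let T : ∀ x, H x →L[ℂ] H x := fun x =>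
    (Finsupp.linearCombination ℂ fun n => η n x).extendOfNorm
      (Finsupp.linearCombination ℂ fun n => ζ n x)
  have hdr : ∀ᵐ x ∂μ, DenseRange (Finsupp.linearCombination ℂ fun n => ζ n x) := by
    filter_upwards [hζ] with x hx
    rw [DenseRange, ← LinearMap.coe_range, Finsupp.range_linearCombination]
    exact Submodule.dense_iff_topologicalClosure_eq_top.2 hx
  have hTζ : ∀ᵐ x ∂μ, ∀ n, T x (ζ n x) = η n x := by
    filter_upwards [hbd, hdr] with x hx hd n
    have h1 := LinearMap.extendOfNorm_eq (f := Finsupp.linearCombination ℂ fun n => η n x)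
      hd ⟨‖A‖, hx⟩ (Finsupp.single n 1)
    simpa using h1
  have hTn : ∀ᵐ x ∂μ, ‖T x‖ ≤ ‖A‖ := by
    filter_upwards [hbd, hdr] with x hx hd
    exact ContinuousLinearMap.opNorm_le_bound _ (norm_nonneg _) fun v =>
      LinearMap.norm_extendOfNorm_apply_le hd _ hx v
  have hT : F.IsMeasurableOperatorField T := by
    refine hζ.isMeasurableOperatorField (fun n => ?_) ⟨_, hTn⟩
    refine mem_sections_congr (η n).mem_sections ?_
    filter_upwards [hTζ] with x hx
    exact (hx n).symm
  refine ⟨T, ?_, hTn⟩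
  obtain ⟨A', hA'⟩ := hT.exists_isDirectIntegral
  suffices h : A = A' by rwa [h]
  -- Both operators commute with indicators and agree on the sections `ζ n`, hence on a dense span.
  refine ContinuousLinearMap.ext_on (dense_span_diagonal hζ) ?_
  rintro _ ⟨n, E, D, hE, hD, rfl⟩
  have hmem := memLp_top_indicator_one μ hE
  have h1 := congrArg (fun S => S (DirectIntegral.mk (ζ n))) (hA _ D hmem hD)
  have h2 := congrArg (fun S => S (DirectIntegral.mk (ζ n)))
    (hA'.commutesWithDiagonal _ D hmem hD)
  simp only [mul_apply_eq_comp] at h1 h2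
  rw [h1, h2]
  congr 1
  rw [← hη, eq_comm, hA'.apply_mk_eq_iff]
  filter_upwards [hTζ] with x hx
  exact hx n

theorem IsDirectIntegral.ae_norm_le_opNorm [∀ x, CompleteSpace (H x)] [SigmaFinite μ]
    {F : HilbertField μ H} {A : F.DirectIntegral →L[ℂ] F.DirectIntegral} {T : ∀ x, H x →L[ℂ] H x}
    (h : F.IsDirectIntegral A T) : ∀ᵐ x ∂μ, ‖T x‖ ≤ ‖A‖ := by
  obtain ⟨T', hT', hn⟩ := h.commutesWithDiagonal.exists_isDirectIntegral
  filter_upwards [h.ae_eq hT', hn] with x hx hn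
  rwa [hx]

end HilbertField

theorem eq_of_total_inner {K : Type u} [NormedAddCommGroup K] [InnerProductSpace ℂ K]
    {ι : Type w} {ζ : ι → K} (h : (Submodule.span ℂ (Set.range ζ)).topologicalClosure = ⊤)
    {u v : K} (he : ∀ i, ⟪ζ i, u⟫ = ⟪ζ i, v⟫) : u = v := by
  refine Dense.eq_of_inner_left (𝕜 := ℂ) (Submodule.dense_iff_topologicalClosure_eq_top.2 h)
    fun w hw => ?_
  rw [← inner_conj_symm, ← inner_conj_symm v]
  congr 1
  induction hw using Submodule.span_induction with
  | mem w hw => obtain ⟨n, rfl⟩ := hw; exact he n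
  | zero => simp
  | add w w' _ _ h1 h2 => rw [inner_add_left, h1, h2, inner_add_left]
  | smul c w _ h1 => rw [inner_smul_left, h1, inner_smul_left]

/-! ### Generators of a direct integral of von Neumann algebras. -/

namespace HilbertField

variable {X : Type u} [MeasurableSpace X] {μ : Measure X} {H : X → Type v}
  [∀ x, NormedAddCommGroup (H x)] [∀ x, InnerProductSpace ℂ (H x)]

/-- By Tonelli the integral of the pointwise sum is the sum of the squared norms, so the pointwise
sum is finite almost everywhere. -/
theorem ae_summable_norm_sq {F : HilbertField μ H} {θ : ℕ → F.L2}
    (h : Summable fun k => ‖DirectIntegral.mk (θ k)‖ ^ 2) :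
    ∀ᵐ x ∂μ, Summable fun k => ‖θ k x‖ ^ 2 := by
  have hm k : AEMeasurable (fun x => ENNReal.ofReal (‖θ k x‖ ^ 2)) μ :=
    ((F.aemeasurable_norm (θ k).mem_sections).pow_const 2).ennreal_ofReal
  have h1 : ∫⁻ x, ∑' k, ENNReal.ofReal (‖θ k x‖ ^ 2) ∂μ ≠ ∞ := by
    rw [lintegral_tsum hm]
    have h2 k : ∫⁻ x, ENNReal.ofReal (‖θ k x‖ ^ 2) ∂μ =
        ENNReal.ofReal (‖DirectIntegral.mk (θ k)‖ ^ 2) := by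
      rw [DirectIntegral.norm_mk, L2.norm_sq_eq, ofReal_integral_eq_lintegral_ofReal
        (L2.integrable _) (Eventually.of_forall fun x => sq_nonneg _)]
    simp only [h2]
    rw [← ENNReal.ofReal_tsum_of_nonneg (fun k => sq_nonneg _) h]
    exact ENNReal.ofReal_ne_top
  filter_upwards [ae_lt_top' (AEMeasurable.tsum hm) h1] with x hx
  refine (ENNReal.summable_toReal hx.ne).congr fun k => ?_
  rw [ENNReal.toReal_ofReal (sq_nonneg _)]

theorem ae_tendsto_zero_of_summable {F : HilbertField μ H} {θ : ℕ → F.L2}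
    (h : Summable fun k => ‖DirectIntegral.mk (θ k)‖ ^ 2) :
    ∀ᵐ x ∂μ, Tendsto (fun k => ‖θ k x‖) atTop (𝓝 0) := by
  filter_upwards [ae_summable_norm_sq h] with x hx
  have h5 := (Real.continuous_sqrt.tendsto _).comp hx.tendsto_atTop_zero
  simp only [Real.sqrt_zero] at h5
  exact h5.congr fun k => Real.sqrt_sq (norm_nonneg _)

/-- The diagonal algebra `L^∞(X, μ)`. -/
def diagonalOperators (F : HilbertField μ H) : Set (F.DirectIntegral →L[ℂ] F.DirectIntegral) :=
  {D | ∃ f : X → ℂ, MemLp f ∞ μ ∧ F.IsDirectIntegral D (fun x => f x • (1 : H x →L[ℂ] H x))}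

variable [∀ x, CompleteSpace (H x)] [SigmaFinite μ] {F : HilbertField μ H}
  {N : ∀ x, VonNeumannAlgebra (H x)}

omit [SigmaFinite μ] in
theorem diagonalOperators_subset_integralAlgebra {D : F.DirectIntegral →L[ℂ] F.DirectIntegral}
    (hD : D ∈ F.diagonalOperators) (N : ∀ x, VonNeumannAlgebra (H x)) :
    D ∈ F.integralAlgebra N := by
  obtain ⟨f, _, hD⟩ := hD
  refine ⟨_, hD, Eventually.of_forall fun x => ?_⟩
  exact (N x).toStarSubalgebra.smul_mem (one_mem _) _

/-- An operator commuting with the diagonal algebra is decomposable. If it also commutes with `A n`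
and its adjoint for all `n`, then off one null set its fibers commute with all `a n x` and their
adjoints, hence with `N x`. -/
theorem mem_generated_of_mem_integralAlgebra {A : ℕ → F.DirectIntegral →L[ℂ] F.DirectIntegral}
    {a : ℕ → ∀ x, H x →L[ℂ] H x} (hA : ∀ n, F.IsDirectIntegral (A n) (a n))
    (hN : ∀ᵐ x ∂μ, N x = generatedVonNeumannAlgebra (Set.range fun n => a n x))
    {T : F.DirectIntegral →L[ℂ] F.DirectIntegral} (hT : T ∈ F.integralAlgebra N) :
    T ∈ generatedVonNeumannAlgebra (Set.range A ∪ F.diagonalOperators) := by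
  rw [mem_generatedVonNeumannAlgebra_iff]
  intro S hS
  obtain ⟨Tx, hTx, hTN⟩ := hT
  have hSd : F.CommutesWithDiagonal S := fun f D hf hD => (hS D (Or.inr ⟨f, hf, hD⟩)).1
  obtain ⟨Sx, hSx, -⟩ := hSd.exists_isDirectIntegral
  refine (hSx.mul hTx).eq_of_isDirectIntegral ((hTx.mul hSx).congr ?_)
  have h1 n : ∀ᵐ x ∂μ, Sx x * a n x = a n x * Sx x := by
    have h2 := (hS (A n) (Or.inl ⟨n, rfl⟩)).1
    exact (hSx.mul (hA n)).ae_eq (by rw [h2]; exact (hA n).mul hSx)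
  have h1' n : ∀ᵐ x ∂μ, Sx x * star (a n x) = star (a n x) * Sx x := by
    have h2 := (hS (A n) (Or.inl ⟨n, rfl⟩)).2
    exact (hSx.mul (hA n).star).ae_eq (by rw [h2]; exact (hA n).star.mul hSx)
  filter_upwards [ae_all_iff.2 h1, ae_all_iff.2 h1', hN, hTN] with x h1 h2 hN hTN
  rw [hN, mem_generatedVonNeumannAlgebra_iff] at hTN
  refine (hTN (Sx x) ?_).symm
  rintro _ ⟨n, rfl⟩
  exact ⟨h1 n, h2 n⟩

/-- `T` is decomposable because it commutes with the diagonal algebra. Strong-`*` approximants at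
distance less than `2⁻ᵏ` on the first `k` total sections converge pointwise almost everywhere, by
summability. Convergence of the adjoints as well lets commutation with the commutant of `N x` pass
to the limit through matrix coefficients, without a uniform bound on the approximants. -/
theorem mem_integralAlgebra_of_mem_generated {S : Set (F.DirectIntegral →L[ℂ] F.DirectIntegral)}
    (hS : ∀ s ∈ S, s ∈ F.integralAlgebra N)
    {T : F.DirectIntegral →L[ℂ] F.DirectIntegral} (hT : T ∈ generatedVonNeumannAlgebra S) :
    T ∈ F.integralAlgebra N := by
  have hTd : F.CommutesWithDiagonal T := by
    intro f D hf hD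
    refine (mem_generatedVonNeumannAlgebra_iff.1 hT D fun s hs => ?_).symm
    obtain ⟨sx, hsx, -⟩ := hS s hs
    exact ⟨(hsx.commutesWithDiagonal f D hf hD).symm,
      (hsx.star.commutesWithDiagonal f D hf hD).symm⟩
  obtain ⟨Tx, hTx, -⟩ := hTd.exists_isDirectIntegral
  refine ⟨Tx, hTx, ?_⟩
  obtain ⟨ζ, hζ⟩ := F.exists_isTotal
  have hT' : T ∈ generatedVonNeumannAlgebra (StarAlgebra.adjoin ℂ S : Set _) := by
    rwa [generatedVonNeumannAlgebra_adjoin]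
  have hle : StarAlgebra.adjoin ℂ S ≤ F.integralAlgebra N := StarAlgebra.adjoin_le hS
  choose p hpS hp using fun k : ℕ => exists_mem_norm_sub_lt_and_star hT'
    (fun i : Fin k => DirectIntegral.mk (ζ i)) (ε := (1 / 2 : ℝ) ^ k) (by positivity)
  choose px hpx hpN using fun k => hle (hpS k)
  have hsum (q : ℕ → F.DirectIntegral →L[ℂ] F.DirectIntegral)
      (Q : F.DirectIntegral →L[ℂ] F.DirectIntegral) (qx : ℕ → ∀ x, H x →L[ℂ] H x)
      (Qx : ∀ x, H x →L[ℂ] H x) (hq : ∀ k, F.IsDirectIntegral (q k) (qx k))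
      (hQ : F.IsDirectIntegral Q Qx) (n : ℕ)
      (hb : ∀ k, n < k →
        ‖q k (DirectIntegral.mk (ζ n)) - Q (DirectIntegral.mk (ζ n))‖ < (1 / 2 : ℝ) ^ k) :
      ∀ᵐ x ∂μ, Tendsto (fun k => qx k x (ζ n x)) atTop (𝓝 (Qx x (ζ n x))) := by
    choose hd1 hd2 using fun k => (hq k).sub hQ
    have h1 := ae_tendsto_zero_of_summable (θ := fun k => (hd1 k).apply (ζ n)) ?_
    · filter_upwards [h1] with x hx
      rw [tendsto_iff_norm_sub_tendsto_zero]
      exact hx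
    · rw [← summable_nat_add_iff (n + 1)]
      refine Summable.of_nonneg_of_le (fun k => sq_nonneg _) (fun k => ?_)
        ((summable_nat_add_iff (n + 1)).2 summable_geometric_two)
      rw [← hd2]
      have h2 := hb (k + (n + 1)) (by omega)
      change ‖q (k + (n + 1)) (DirectIntegral.mk (ζ n)) - Q (DirectIntegral.mk (ζ n))‖ ^ 2 ≤ _
      refine (pow_le_pow_left₀ (norm_nonneg _) h2.le 2).trans ?_
      rw [pow_two]
      exact mul_le_of_le_one_left (by positivity) (pow_le_one₀ (by norm_num) (by norm_num))
  have h1 : ∀ᵐ x ∂μ, ∀ n, Tendsto (fun k => px k x (ζ n x)) atTop (𝓝 (Tx x (ζ n x))) :=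
    ae_all_iff.2 fun n => hsum p T px Tx hpx hTx n fun k hk => (hp k ⟨n, hk⟩).1
  have h2 : ∀ᵐ x ∂μ, ∀ n, Tendsto (fun k => star (px k x) (ζ n x)) atTop
      (𝓝 (star (Tx x) (ζ n x))) :=
    ae_all_iff.2 fun n => hsum (fun k => star (p k)) (star T) (fun k x => star (px k x))
      (fun x => star (Tx x)) (fun k => (hpx k).star) hTx.star n fun k hk => (hp k ⟨n, hk⟩).2
  filter_upwards [h1, h2, hζ, ae_all_iff.2 hpN] with x h1 h2 hx hpN
  rw [VonNeumannAlgebra.mem_iff_forall_commutant]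
  intro c hc
  refine ContinuousLinearMap.ext_on (Submodule.dense_iff_topologicalClosure_eq_top.2 hx) ?_
  rintro _ ⟨n, rfl⟩
  refine eq_of_total_inner hx fun m => ?_
  have e1 : Tendsto (fun k => ⟪ζ m x, c (px k x (ζ n x))⟫) atTop
      (𝓝 ⟪ζ m x, c (Tx x (ζ n x))⟫) :=
    tendsto_const_nhds.inner ((c.continuous.tendsto _).comp (h1 n))
  have e2 : Tendsto (fun k => ⟪star (px k x) (ζ m x), c (ζ n x)⟫) atTop
      (𝓝 ⟪star (Tx x) (ζ m x), c (ζ n x)⟫) := (h2 m).inner tendsto_const_nhds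
  simp only [ContinuousLinearMap.star_eq_adjoint, ContinuousLinearMap.adjoint_inner_left] at e2
  refine tendsto_nhds_unique e1 (e2.congr fun k => ?_)
  have := congrArg (fun S : H x →L[ℂ] H x => S (ζ n x))
    (VonNeumannAlgebra.mem_commutant_iff.1 hc _ (hpN k))
  simp only [mul_apply_eq_comp] at this
  rw [this]

/-- The direct integral of a measurable field of von Neumann algebras is generated by a sequence of
decomposable operators and the diagonal algebra. -/
theorem mem_integralAlgebra_iff {A : ℕ → F.DirectIntegral →L[ℂ] F.DirectIntegral}
    {a : ℕ → ∀ x, H x →L[ℂ] H x} (hA : ∀ n, F.IsDirectIntegral (A n) (a n))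
    (hN : ∀ᵐ x ∂μ, N x = generatedVonNeumannAlgebra (Set.range fun n => a n x))
    {T : F.DirectIntegral →L[ℂ] F.DirectIntegral} : T ∈ F.integralAlgebra N ↔
      T ∈ generatedVonNeumannAlgebra (Set.range A ∪ F.diagonalOperators) := by
  refine ⟨mem_generated_of_mem_integralAlgebra hA hN,
    mem_integralAlgebra_of_mem_generated ?_⟩
  rintro s (⟨n, rfl⟩ | hs)
  · refine ⟨a n, hA n, ?_⟩
    filter_upwards [hN] with x hx
    rw [hx]
    exact subset_generatedVonNeumannAlgebra _ ⟨n, rfl⟩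
  · exact diagonalOperators_subset_integralAlgebra hs N

/-- The direct integral of a measurable field of von Neumann algebras, as a von Neumann algebra. -/
def integralVonNeumannAlgebra (hN : F.IsMeasurableAlgebraField N) :
    VonNeumannAlgebra F.DirectIntegral where
  toStarSubalgebra := F.integralAlgebra N
  centralizer_centralizer' := by
    obtain ⟨a, ha, hN⟩ := hN
    choose A hA using fun n => (ha n).exists_isDirectIntegral
    have h : (F.integralAlgebra N) =
        (generatedVonNeumannAlgebra (Set.range A ∪ F.diagonalOperators)).toStarSubalgebra :=
      SetLike.ext fun T => mem_integralAlgebra_iff hA hN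
    rw [h]
    exact VonNeumannAlgebra.centralizer_centralizer' _

omit [SigmaFinite μ] in
/-- A decomposition with values in the fibers everywhere. -/
theorem exists_fiber_field {T : F.DirectIntegral →L[ℂ] F.DirectIntegral}
    (hT : T ∈ F.integralAlgebra N) : ∃ Tx : ∀ x, (N x).toStarSubalgebra,
      F.IsDirectIntegral T (fun x => (Tx x : H x →L[ℂ] H x)) := by
  classical
  obtain ⟨S, hS, hSN⟩ := hT
  -- The default value `0` is taken only on a null set.
  refine ⟨fun x => if h : S x ∈ N x then ⟨S x, h⟩ else 0, hS.congr ?_⟩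
  filter_upwards [hSN] with x hx
  rw [dif_pos hx]

end HilbertField

/-! ### Crossed products: copies, canonical unitaries and generation. -/

section CrossedProduct

variable {B : Type w} {K : Type u} [NormedAddCommGroup K] [InnerProductSpace ℂ K]
  [CompleteSpace K]

/-- The isometric isomorphism of von Neumann algebras preserves generation. -/
theorem conj_mem_generatedVonNeumannAlgebra_iff {K' : Type v} [NormedAddCommGroup K']
    [InnerProductSpace ℂ K'] [CompleteSpace K'] (Ψ : (K →L[ℂ] K) ≃⋆ₐ[ℂ] (K' →L[ℂ] K'))
    (S : Set (K →L[ℂ] K)) (T : K →L[ℂ] K) :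
    Ψ T ∈ generatedVonNeumannAlgebra (Ψ '' S) ↔ T ∈ generatedVonNeumannAlgebra S := by
  rw [mem_generatedVonNeumannAlgebra_iff, mem_generatedVonNeumannAlgebra_iff]
  have hinj := EquivLike.injective Ψ
  have hmul (a b : K →L[ℂ] K) : Ψ (a * b) = Ψ a * Ψ b := Ψ.map_mul' a b
  have hstar (a : K →L[ℂ] K) : Ψ (star a) = star (Ψ a) := Ψ.map_star' a
  constructor
  · intro h b hb
    refine hinj ?_
    rw [hmul, hmul]
    refine h (Ψ b) ?_
    rintro _ ⟨s, hs, rfl⟩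
    rw [← hstar, ← hmul, ← hmul, ← hmul, ← hmul, (hb s hs).1, (hb s hs).2]
    exact ⟨rfl, rfl⟩
  · intro h b' hb
    obtain ⟨b, rfl⟩ := EquivLike.surjective Ψ b'
    rw [← hmul, ← hmul, h b]
    intro s hs
    have h1 := hb _ ⟨s, hs, rfl⟩
    rw [← hstar, ← hmul, ← hmul, ← hmul, ← hmul] at h1
    exact ⟨hinj h1.1, hinj h1.2⟩

/-- A `*`-isomorphism restricts to `*`-subalgebras which correspond to each other. -/
def starAlgEquivRestrict {A A' : Type*} [Ring A] [StarRing A] [Algebra ℂ A] [StarModule ℂ A]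
    [Ring A'] [StarRing A'] [Algebra ℂ A'] [StarModule ℂ A'] (Ψ : A ≃⋆ₐ[ℂ] A')
    (S : StarSubalgebra ℂ A) (S' : StarSubalgebra ℂ A') (h : ∀ a, Ψ a ∈ S' ↔ a ∈ S) :
    S ≃⋆ₐ[ℂ] S' where
  toFun a := ⟨Ψ a, (h a).2 a.2⟩
  invFun b := ⟨Ψ.symm b, (h _).1 (by rw [StarAlgEquiv.apply_symm_apply]; exact b.2)⟩
  left_inv a := Subtype.ext (StarAlgEquiv.symm_apply_apply Ψ (a : A))
  right_inv b := Subtype.ext (StarAlgEquiv.apply_symm_apply Ψ (b : A'))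
  map_mul' a b := Subtype.ext (map_mul Ψ (a : A) b)
  map_add' a b := Subtype.ext (map_add Ψ (a : A) b)
  map_star' a := Subtype.ext (map_star Ψ (a : A))
  map_smul' r a := Subtype.ext (map_smul Ψ r (a : A))

theorem coe_starAlgEquivRestrict {A A' : Type*} [Ring A] [StarRing A] [Algebra ℂ A]
    [StarModule ℂ A] [Ring A'] [StarRing A'] [Algebra ℂ A'] [StarModule ℂ A'] (Ψ : A ≃⋆ₐ[ℂ] A')
    (S : StarSubalgebra ℂ A) (S' : StarSubalgebra ℂ A') (h : ∀ a, Ψ a ∈ S' ↔ a ∈ S) (a : S) :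
    (starAlgEquivRestrict Ψ S S' h a : A') = Ψ a := rfl

/-- The C*-identity gives the bound; it is an inequality since `K` may be zero. -/
theorem norm_unitary_le_one {M : StarSubalgebra ℂ (K →L[ℂ] K)} (c : unitary M) :
    ‖((c : M) : K →L[ℂ] K)‖ ≤ 1 := by
  have h1 : star ((c : M) : K →L[ℂ] K) * ((c : M) : K →L[ℂ] K) = 1 :=
    congrArg Subtype.val (Unitary.coe_star_mul_self c)
  have h2 := CStarRing.norm_star_mul_self (x := ((c : M) : K →L[ℂ] K))
  rw [h1] at h2
  have h3 : ‖(1 : K →L[ℂ] K)‖ ≤ 1 := ContinuousLinearMap.norm_id_le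
  nlinarith [norm_nonneg ((c : M) : K →L[ℂ] K)]

variable {M : StarSubalgebra ℂ (K →L[ℂ] K)} (hM : IsClosed (M : Set (K →L[ℂ] K)))
  (α : B → (M ≃⋆ₐ[ℂ] M))

/-- The copy of `a ∈ M` in the crossed product. -/
def crossedCopy (a : M) : lp (fun _ : B => K) 2 →L[ℂ] lp (fun _ : B => K) 2 :=
  weightedShift (Equiv.refl B) (fun h => ((α h).symm a : K →L[ℂ] K)) ‖(a : K →L[ℂ] K)‖
    fun h => (norm_starAlgEquiv_apply hM (α h).symm a).le

theorem crossedCopy_apply (a : M) (ξ : lp (fun _ : B => K) 2) (h : B) :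
    crossedCopy hM α a ξ h = ((α h).symm a : K →L[ℂ] K) (ξ h) := rfl

theorem eq_crossedCopy_iff {a : M} {T : lp (fun _ : B => K) 2 →L[ℂ] lp (fun _ : B => K) 2} :
    IsCopy α a T ↔ T = crossedCopy hM α a := by
  constructor
  · intro h
    ext ξ k
    exact h ξ k
  · rintro rfl ξ k
    rfl

theorem crossedCopy_mul (a b : M) :
    crossedCopy hM α (a * b) = crossedCopy hM α a * crossedCopy hM α b := by
  ext ξ k
  change ((α k).symm (a * b) : K →L[ℂ] K) (ξ k) = _
  rw [map_mul]
  rfl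

theorem crossedCopy_add (a b : M) :
    crossedCopy hM α (a + b) = crossedCopy hM α a + crossedCopy hM α b := by
  ext ξ k
  change ((α k).symm (a + b) : K →L[ℂ] K) (ξ k) = _
  rw [map_add]
  rfl

theorem crossedCopy_algebraMap (r : ℂ) :
    crossedCopy hM α (algebraMap ℂ M r) = algebraMap ℂ _ r := by
  ext ξ k
  rw [Algebra.algebraMap_eq_smul_one, Algebra.algebraMap_eq_smul_one, crossedCopy_apply, map_smul,
    map_one]
  rfl

theorem crossedCopy_star (a : M) : crossedCopy hM α (star a) = star (crossedCopy hM α a) := by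
  rw [ContinuousLinearMap.star_eq_adjoint, ContinuousLinearMap.eq_adjoint_iff]
  intro ξ η
  rw [lp.inner_eq_tsum, lp.inner_eq_tsum]
  refine tsum_congr fun k => ?_
  rw [crossedCopy_apply, crossedCopy_apply, map_star]
  exact ContinuousLinearMap.adjoint_inner_left _ _ _

variable [Group B]

/-- The canonical unitary `u_g` of the crossed product. -/
def crossedUnitary (c : B → B → unitary M) (g : B) :
    lp (fun _ : B => K) 2 →L[ℂ] lp (fun _ : B => K) 2 :=
  weightedShift (Equiv.mulLeft g⁻¹) (fun k => ((α k).symm (c g (g⁻¹ * k) : M) : K →L[ℂ] K)) 1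
    fun k => (norm_starAlgEquiv_apply hM (α k).symm _).trans_le (norm_unitary_le_one _)

theorem eq_crossedUnitary_iff {c : B → B → unitary M} {g : B}
    {T : lp (fun _ : B => K) 2 →L[ℂ] lp (fun _ : B => K) 2} :
    IsCanonicalUnitary α c g T ↔ T = crossedUnitary hM α c g := by
  constructor
  · intro h
    ext ξ k
    exact h ξ k
  · rintro rfl ξ k
    rfl

end CrossedProduct

/-- Copies of `a ∈ M` in the crossed product by a trace preserving action lie in the von Neumann
algebra generated by the copies of a generating set. -/
theorem crossedCopy_mem_generated {B : Type w} {K : Type u} [NormedAddCommGroup K]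
    [InnerProductSpace ℂ K] [CompleteSpace K] {M : VonNeumannAlgebra K}
    {φ : (K →L[ℂ] K) →ₗ[ℂ] ℂ} (hφ : IsNormalTrace M φ)
    {α : B → (M.toStarSubalgebra ≃⋆ₐ[ℂ] M.toStarSubalgebra)}
    (hα : ∀ g a, φ (α g a : K →L[ℂ] K) = φ a) {S : Set (K →L[ℂ] K)}
    (hS : M = generatedVonNeumannAlgebra S) (N : VonNeumannAlgebra (lp (fun _ : B => K) 2))
    (hN : ∀ a : M.toStarSubalgebra, (a : K →L[ℂ] K) ∈ S → crossedCopy M.isClosed α a ∈ N)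
    (a : M.toStarSubalgebra) : crossedCopy M.isClosed α a ∈ N := by
  -- The elements whose copies lie in `N` form a `*`-algebra containing `S`. It remains to pass to
  -- limits of bounded families from it.
  let A : StarSubalgebra ℂ (K →L[ℂ] K) :=
    { carrier := {b | ∃ h : b ∈ M, crossedCopy M.isClosed α ⟨b, h⟩ ∈ N}
      mul_mem' := by
        rintro b b' ⟨h, hb⟩ ⟨h', hb'⟩
        refine ⟨mul_mem h h', ?_⟩
        have := crossedCopy_mul M.isClosed α ⟨b, h⟩ ⟨b', h'⟩
        rw [MulMemClass.mk_mul_mk] at this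
        rw [this]
        exact mul_mem hb hb'
      add_mem' := by
        rintro b b' ⟨h, hb⟩ ⟨h', hb'⟩
        refine ⟨add_mem h h', ?_⟩
        have := crossedCopy_add M.isClosed α ⟨b, h⟩ ⟨b', h'⟩
        rw [AddMemClass.mk_add_mk] at this
        rw [this]
        exact add_mem hb hb'
      algebraMap_mem' := fun r => by
        refine ⟨M.toStarSubalgebra.algebraMap_mem r, ?_⟩
        have := crossedCopy_algebraMap M.isClosed α r
        exact this ▸ N.toStarSubalgebra.algebraMap_mem r
      star_mem' := by
        rintro b ⟨h, hb⟩
        refine ⟨star_mem h, ?_⟩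
        have := crossedCopy_star M.isClosed α ⟨b, h⟩
        exact this ▸ star_mem hb }
  have hSA : StarAlgebra.adjoin ℂ S ≤ A := by
    refine StarAlgebra.adjoin_le fun s hs => ?_
    have hsM : s ∈ M := by
      rw [hS]
      exact subset_generatedVonNeumannAlgebra S hs
    exact ⟨hsM, hN ⟨s, hsM⟩ hs⟩
  have ha : (a : K →L[ℂ] K) ∈ generatedVonNeumannAlgebra (StarAlgebra.adjoin ℂ S : Set _) := by
    rw [generatedVonNeumannAlgebra_adjoin, ← hS]
    exact a.2
  obtain ⟨U, p, C, hpA, hpC, hp⟩ := exists_bounded_ultrafilter ha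
  choose hpM hpN using fun i => hSA (hpA i)
  refine N.mem_of_tendsto_inner (l := (U : Filter _)) hpN fun ξ η => ?_
  simp only [lp.inner_eq_tsum, crossedCopy_apply]
  have hn (i h) : ‖((α h).symm ⟨p i, hpM i⟩ : K →L[ℂ] K)‖ ≤ C := by
    rw [norm_starAlgEquiv_apply M.isClosed]
    exact hpC i
  -- The copies converge weakly: each coefficient converges because `(α h).symm` preserves the
  -- trace, and the uniform bound on norms dominates the sum over `B`.
  refine tendsto_tsum_of_dominated_convergence
    (bound := fun n => |C| * (‖ξ n‖ ^ 2 + ‖η n‖ ^ 2))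
    (((lp_summable_sq ξ).add (lp_summable_sq η)).mul_left _) (fun h => ?_)
    (Eventually.of_forall fun i h => ?_)
  · refine hφ.tendsto_automorphism (θ := (α h).symm) (fun b => ?_) U
      (p := fun i => ⟨p i, hpM i⟩) hpC (fun u v => tendsto_const_nhds.inner (hp v)) _ _
    rw [← hα h, StarAlgEquiv.apply_symm_apply]
  · set q := ((α h).symm ⟨p i, hpM i⟩ : K →L[ℂ] K)
    have h1 := norm_inner_le_norm (𝕜 := ℂ) (ξ h) (q (η h))
    have h2 := q.le_of_opNorm_le ((hn i h).trans (le_abs_self C)) (η h)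
    have h3 : ‖ξ h‖ * ‖q (η h)‖ ≤ ‖ξ h‖ * (|C| * ‖η h‖) :=
      mul_le_mul_of_nonneg_left h2 (norm_nonneg _)
    nlinarith [abs_nonneg C, mul_nonneg (abs_nonneg C) (sq_nonneg (‖ξ h‖ - ‖η h‖)),
      mul_nonneg (abs_nonneg C) (sq_nonneg (‖ξ h‖)),
      mul_nonneg (abs_nonneg C) (sq_nonneg (‖η h‖))]

/-! ### The identification of `∫ ℓ²(B, H x)` with `ℓ²(B, ∫ H x)`. -/

namespace HilbertField

variable {X : Type u} [MeasurableSpace X] {μ : Measure X} {H : X → Type v}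
  [∀ x, NormedAddCommGroup (H x)] [∀ x, InnerProductSpace ℂ (H x)] [∀ x, CompleteSpace (H x)]
  {B : Type w} [Countable B]

section EllTwo

variable {F : HilbertField μ H}

/-- The coordinate at `b` of a square integrable section of `ℓ²(B, H x)`. -/
def ellTwoCoord (b : B) (ζ : (F.ellTwo B).L2) : F.L2 :=
  L2.of (fun x => ζ x b) ⟨ζ.mem_sections b, by
    refine ζ.integrable.mono'
      ((F.aemeasurable_norm (ζ.mem_sections b)).pow_const 2).aestronglyMeasurable
      (Eventually.of_forall fun x => ?_)
    rw [norm_pow, norm_norm]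
    exact pow_le_pow_left₀ (norm_nonneg _) (lp.norm_apply_le_norm (by norm_num) (ζ x) b) 2⟩

@[simp]
theorem ellTwoCoord_apply (b : B) (ζ : (F.ellTwo B).L2) (x : X) :
    ellTwoCoord b ζ x = ζ x b := rfl

/-- Sum and integral are interchanged; the finite partial sums are bounded by the integral of `‖ζ
x‖²`. -/
theorem hasSum_norm_ellTwoCoord (ζ : (F.ellTwo B).L2) :
    HasSum (fun b => ‖DirectIntegral.mk (ellTwoCoord b ζ)‖ ^ 2) (‖DirectIntegral.mk ζ‖ ^ 2) := by
  have hn (b : B) : ‖DirectIntegral.mk (ellTwoCoord b ζ)‖ ^ 2 = ∫ x, ‖ζ x b‖ ^ 2 ∂μ := by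
    rw [DirectIntegral.norm_mk, L2.norm_sq_eq]
    rfl
  have hi (b : B) : Integrable (fun x => ‖ζ x b‖ ^ 2) μ := (ellTwoCoord b ζ).integrable
  simp only [hn]
  rw [DirectIntegral.norm_mk, L2.norm_sq_eq]
  simp only [lp_norm_sq_eq_tsum]
  refine hasSum_integral_of_summable_integral_norm hi ?_
  simp only [norm_pow, norm_norm]
  refine summable_of_sum_le (c := ∫ x, ‖ζ x‖ ^ 2 ∂μ)
    (fun b => integral_nonneg fun x => sq_nonneg _) fun s => ?_
  rw [← integral_finsetSum _ fun b _ => hi b]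
  refine integral_mono (integrable_finsetSum _ fun b _ => hi b) ζ.integrable fun x => ?_
  simp only
  rw [lp_norm_sq_eq_tsum]
  exact (lp_summable_sq (ζ x)).sum_le_tsum s fun b _ => sq_nonneg _

/-- Taking coordinates is isometric, so its range is closed. The range contains every vector with
one coordinate, hence is everything. -/
theorem exists_ellTwo_equiv (F : HilbertField μ H) (B : Type w) [Countable B] :
    ∃ V : (F.ellTwo B).DirectIntegral ≃ₗᵢ[ℂ] lp (fun _ : B => F.DirectIntegral) 2,
      ∀ ζ b, V (DirectIntegral.mk ζ) b = DirectIntegral.mk (ellTwoCoord b ζ) := by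
  classical
  let s : (F.ellTwo B).DirectIntegral → (F.ellTwo B).L2 :=
    Function.surjInv DirectIntegral.mk_surjective
  have hs (u) : DirectIntegral.mk (s u) = u := Function.surjInv_eq DirectIntegral.mk_surjective u
  have hmk (ζ η : (F.ellTwo B).L2) (h : DirectIntegral.mk ζ = DirectIntegral.mk η) (b : B) :
      DirectIntegral.mk (ellTwoCoord b ζ) = DirectIntegral.mk (ellTwoCoord b η) := by
    rw [DirectIntegral.mk_eq_mk_iff] at h ⊢
    filter_upwards [h] with x hx
    rw [ellTwoCoord_apply, ellTwoCoord_apply, hx]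
  let V0 : (F.ellTwo B).DirectIntegral →ₗᵢ[ℂ] lp (fun _ : B => F.DirectIntegral) 2 :=
    { toFun := fun u => ⟨fun b => DirectIntegral.mk (ellTwoCoord b (s u)),
        (memlp_two_iff_summable_sq _).2 (hasSum_norm_ellTwoCoord (s u)).summable⟩
      map_add' := fun u v => lp.ext (funext fun b =>
        hmk (s (u + v)) (s u + s v) (by rw [DirectIntegral.mk_add, hs, hs, hs]) b)
      map_smul' := fun r u => lp.ext (funext fun b =>
        hmk (s (r • u)) (r • s u) (by rw [DirectIntegral.mk_smul, hs, hs]) b)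
      norm_map' := fun u => by
        rw [← sq_eq_sq₀ (norm_nonneg _) (norm_nonneg _)]
        refine (lp_norm_sq_eq_tsum _).trans ((hasSum_norm_ellTwoCoord (s u)).tsum_eq.trans ?_)
        rw [hs] }
  have hV0 (ζ b) : V0 (DirectIntegral.mk ζ) b = DirectIntegral.mk (ellTwoCoord b ζ) :=
    hmk _ _ (hs _) b
  have hsurj : Function.Surjective V0 := by
    have hcl : IsClosed (Set.range V0) := V0.isometry.isClosedEmbedding.isClosed_range
    intro η
    refine hcl.mem_of_tendsto (lp_hasSum_single η) (Eventually.of_forall fun t => ?_)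
    have hsub : (LinearMap.range V0.toLinearMap : Set _) = Set.range V0 := rfl
    rw [← hsub]
    refine Submodule.sum_mem _ fun b _ => ?_
    obtain ⟨θ, hθ⟩ := DirectIntegral.mk_surjective (η b)
    have hsec : (fun x => lp.single 2 b (θ x) : ∀ x, lp (fun _ : B => H x) 2) ∈
        (F.ellTwo B).squareIntegrable := by
      refine ⟨fun b' => ?_, ?_⟩
      · by_cases hb : b' = b
        · subst hb
          simpa using θ.mem_sections
        · have h0 : (fun _ => 0 : ∀ x, H x) ∈ F.sections := F.sections.zero_mem
          simpa only [lp.coeFn_single, Pi.single_eq_of_ne hb] using h0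
      · refine θ.integrable.congr (Eventually.of_forall fun x => ?_)
        simp only
        rw [lp.norm_single (E := fun _ : B => H x) (p := 2) (by norm_num)]
    refine ⟨DirectIntegral.mk (L2.of _ hsec), lp.ext (funext fun b' => ?_)⟩
    change V0 _ b' = _
    rw [hV0]
    by_cases hb : b' = b
    · subst hb
      rw [lp.coeFn_single, Pi.single_eq_same, ← hθ]
      congr 1
      refine Subtype.ext (funext fun x => ?_)
      change (lp.single 2 b' (θ x) : ∀ _, H x) b' = θ x
      simp
    · rw [lp.coeFn_single, Pi.single_eq_of_ne hb]
      change _ = DirectIntegral.mk 0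
      congr 1
      refine Subtype.ext (funext fun x => ?_)
      change (lp.single 2 b (θ x) : ∀ _, H x) b' = 0
      simp [hb]
  exact ⟨LinearIsometryEquiv.ofSurjective V0 hsurj, hV0⟩

/-- A weighted shift with decomposable weights is decomposable. -/
theorem exists_isDirectIntegral_weightedShift [SigmaFinite μ]
    {V : (F.ellTwo B).DirectIntegral ≃ₗᵢ[ℂ] lp (fun _ : B => F.DirectIntegral) 2}
    (hV : ∀ ζ b, V (DirectIntegral.mk ζ) b = DirectIntegral.mk (ellTwoCoord b ζ)) (σ : B ≃ B)
    {A : B → F.DirectIntegral →L[ℂ] F.DirectIntegral} {a : B → ∀ x, H x →L[ℂ] H x}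
    (hA : ∀ b, F.IsDirectIntegral (A b) (a b)) {C : ℝ} (hC : ∀ b, ‖A b‖ ≤ C)
    {T : lp (fun _ : B => F.DirectIntegral) 2 →L[ℂ] lp (fun _ : B => F.DirectIntegral) 2}
    (hT : ∀ ξ k, T ξ k = A k (ξ (σ k))) :
    ∃ T' : ∀ x, lp (fun _ : B => H x) 2 →L[ℂ] lp (fun _ : B => H x) 2,
      (F.ellTwo B).IsDirectIntegral (V.symm.conjStarAlgEquiv T) T' ∧
      ∀ᵐ x ∂μ, ∀ ξ k, T' x ξ k = a k x (ξ (σ k)) := by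
  classical
  have hb : ∀ᵐ x ∂μ, ∀ b, ‖a b x‖ ≤ C := ae_all_iff.2 fun b => by
    filter_upwards [(hA b).ae_norm_le_opNorm] with x hx
    exact hx.trans (hC b)
  -- The weights are bounded by `C` only almost everywhere; elsewhere the operator is set to `0`.
  let T' : ∀ x, lp (fun _ : B => H x) 2 →L[ℂ] lp (fun _ : B => H x) 2 := fun x =>
    if h : ∀ b, ‖a b x‖ ≤ C then weightedShift σ (fun b => a b x) C h else 0
  have hT' : ∀ᵐ x ∂μ, ∀ ξ k, T' x ξ k = a k x (ξ (σ k)) := by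
    filter_upwards [hb] with x hx ξ k
    simp only [T', dif_pos hx, weightedShift_apply]
  have hmeas : (F.ellTwo B).IsMeasurableOperatorField T' := by
    refine ⟨fun ξ hξ η hη => ?_, |C|, ?_⟩
    · have h1 : (fun x => T' x (ξ x)) ∈ (F.ellTwo B).sections := by
        intro k
        choose hm _ using hA
        refine mem_sections_congr ((hm k).apply_mem_sections (hξ (σ k))) ?_
        filter_upwards [hT'] with x hx
        exact (hx _ _).symm
      exact (F.ellTwo B).aemeasurable_inner h1 hη
    · filter_upwards [hb] with x hx
      simp only [T', dif_pos hx]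
      exact norm_weightedShift_le _ _ _ _
  refine ⟨T', ⟨hmeas, fun ζ => ?_⟩, hT'⟩
  rw [LinearIsometryEquiv.conjStarAlgEquiv_apply_apply, LinearIsometryEquiv.symm_symm]
  refine V.injective (lp.ext (funext fun k => ?_))
  rw [LinearIsometryEquiv.apply_symm_apply, hT, hV, hV, (hA k).apply_mk_eq_iff]
  filter_upwards [hT'] with x hx
  exact (hx _ _).symm

end EllTwo

end HilbertField

/-! ### Decomposing the crossed product. -/

namespace HilbertField

variable {X : Type u} [MeasurableSpace X] {μ : Measure X} {H : X → Type v}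
  [∀ x, NormedAddCommGroup (H x)] [∀ x, InnerProductSpace ℂ (H x)] [∀ x, CompleteSpace (H x)]
  {B : Type w} [Group B] {F : HilbertField μ H} {M : ∀ x, VonNeumannAlgebra (H x)}
  {α : B → (F.integralAlgebra M ≃⋆ₐ[ℂ] F.integralAlgebra M)}
  {c : B → B → unitary (F.integralAlgebra M)}
  {α' : ∀ x, B → ((M x).toStarSubalgebra ≃⋆ₐ[ℂ] (M x).toStarSubalgebra)}
  {c' : ∀ x, B → B → unitary (M x).toStarSubalgebra}

theorem isClosed_integralAlgebra [SigmaFinite μ] (hM : F.IsMeasurableAlgebraField M) :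
    IsClosed (F.integralAlgebra M : Set (F.DirectIntegral →L[ℂ] F.DirectIntegral)) :=
  (integralVonNeumannAlgebra hM).isClosed

namespace IsCocycleDecomposition

/-- Decompose `(α g).symm a` with some field `S`. Applying `α g` and using uniqueness of the field
of `a` gives `α' x g (S x) = T x` almost everywhere. -/
theorem symm_automorphism [SigmaFinite μ] (h : F.IsCocycleDecomposition M α c α' c') (g : B)
    {a : F.integralAlgebra M} {T : ∀ x, (M x).toStarSubalgebra}
    (ha : F.IsDirectIntegral a (fun x => (T x : H x →L[ℂ] H x))) :
    F.IsDirectIntegral ((α g).symm a) (fun x => ((α' x g).symm (T x) : H x →L[ℂ] H x)) := by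
  obtain ⟨S, hS⟩ := exists_fiber_field ((α g).symm a).2
  have h1 := h.automorphism g _ S hS
  rw [StarAlgEquiv.apply_symm_apply] at h1
  refine hS.congr ?_
  filter_upwards [h1.ae_eq ha] with x hx
  have h2 : α' x g (S x) = T x := Subtype.ext hx
  rw [← h2, StarAlgEquiv.symm_apply_apply]

variable [Countable B] [SigmaFinite μ] (hM : F.IsMeasurableAlgebraField M)
  {V : (F.ellTwo B).DirectIntegral ≃ₗᵢ[ℂ] lp (fun _ : B => F.DirectIntegral) 2}
  (hV : ∀ ζ b, V (DirectIntegral.mk ζ) b = DirectIntegral.mk (ellTwoCoord b ζ))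

include hV in
-- The copy is a weighted shift whose weight at `h` is `(α h).symm a`. The weights are decomposable
-- by `symm_automorphism`, with the weights of the fiber copies as fields.
theorem isDirectIntegral_crossedCopy (h : F.IsCocycleDecomposition M α c α' c')
    {a : F.integralAlgebra M} {T : ∀ x, (M x).toStarSubalgebra}
    (ha : F.IsDirectIntegral a (fun x => (T x : H x →L[ℂ] H x))) :
    (F.ellTwo B).IsDirectIntegral
      (V.symm.conjStarAlgEquiv (crossedCopy (isClosed_integralAlgebra hM) α a))
      (fun x => crossedCopy (M x).isClosed (α' x) (T x)) := by
  obtain ⟨T', hT', he⟩ := exists_isDirectIntegral_weightedShift hV (Equiv.refl B)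
    (fun b => h.symm_automorphism b ha) (C := ‖(a : F.DirectIntegral →L[ℂ] F.DirectIntegral)‖)
    (fun b => (norm_starAlgEquiv_apply (isClosed_integralAlgebra hM) (α b).symm a).le)
    (T := crossedCopy (isClosed_integralAlgebra hM) α a) (fun ξ k => rfl)
  refine hT'.congr ?_
  filter_upwards [he] with x hx
  ext ξ k
  exact hx ξ k

include hV in
theorem isDirectIntegral_crossedUnitary (h : F.IsCocycleDecomposition M α c α' c') (g : B) :
    (F.ellTwo B).IsDirectIntegral
      (V.symm.conjStarAlgEquiv (crossedUnitary (isClosed_integralAlgebra hM) α c g))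
      (fun x => crossedUnitary (M x).isClosed (α' x) (c' x) g) := by
  obtain ⟨T', hT', he⟩ := exists_isDirectIntegral_weightedShift hV (Equiv.mulLeft g⁻¹)
    (fun b => h.symm_automorphism b (h.cocycle g (g⁻¹ * b))) (C := 1)
    (fun b => (norm_starAlgEquiv_apply (isClosed_integralAlgebra hM) (α b).symm _).trans_le
      (norm_unitary_le_one _))
    (T := crossedUnitary (isClosed_integralAlgebra hM) α c g) (fun ξ k => rfl)
  refine hT'.congr ?_
  filter_upwards [he] with x hx
  ext ξ k
  exact hx ξ k

omit [Countable B] [SigmaFinite μ] in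
/-- The fibers of the crossed product are generated by the copies of generators of the fibers
`M x` and the canonical unitaries. -/
theorem ae_crossedProduct_eq (h : F.IsCocycleDecomposition M α c α' c')
    {a : ℕ → ∀ x, (M x).toStarSubalgebra}
    (ha : ∀ᵐ x ∂μ, M x = generatedVonNeumannAlgebra
      (Set.range fun n => (a n x : H x →L[ℂ] H x)))
    {e : ℕ → ℕ ⊕ B} (he : Function.Surjective e) :
    ∀ᵐ x ∂μ, cocycleCrossedProduct (α' x) (c' x) = generatedVonNeumannAlgebra (Set.range fun n =>
      Sum.elim (fun i => crossedCopy (M x).isClosed (α' x) (a i x))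
        (fun g => crossedUnitary (M x).isClosed (α' x) (c' x) g) (e n)) := by
  filter_upwards [ha, h.field.isCocycleAction] with x hx hτ
  obtain ⟨τ, hτ, hτα⟩ := hτ
  obtain ⟨φ, hφ, hφτ⟩ := hτ.exists_isNormalTrace
  have hφα (g : B) (a : (M x).toStarSubalgebra) :
      φ (α' x g a : H x →L[ℂ] H x) = φ a := by
    rw [← hφτ, ← hφτ]
    exact hτα.trace_preserving g a
  refine VonNeumannAlgebra.ext fun T => ⟨fun hT => ?_, fun hT => ?_⟩
  · refine generatedVonNeumannAlgebra_mono ?_ hT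
    rintro s (⟨b, hs⟩ | ⟨g, hs⟩)
    · rw [eq_crossedCopy_iff (M x).isClosed] at hs
      subst hs
      refine crossedCopy_mem_generated hφ hφα hx _ ?_ b
      rintro b ⟨n, hn⟩
      obtain ⟨m, hm⟩ := he (Sum.inl n)
      refine subset_generatedVonNeumannAlgebra _ ⟨m, ?_⟩
      have hb : b = a n x := Subtype.ext hn.symm
      rw [hb]
      simp only [hm, Sum.elim_inl]
    · rw [eq_crossedUnitary_iff (M x).isClosed] at hs
      subst hs
      obtain ⟨m, hm⟩ := he (Sum.inr g)
      refine subset_generatedVonNeumannAlgebra _ ⟨m, ?_⟩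
      simp only [hm, Sum.elim_inr]
  · refine generatedVonNeumannAlgebra_mono ?_ hT
    rintro _ ⟨n, rfl⟩
    refine subset_generatedVonNeumannAlgebra _ ?_
    simp only
    rcases e n with i | g
    · exact Or.inl ⟨a i x, (eq_crossedCopy_iff (M x).isClosed _).2 rfl⟩
    · exact Or.inr ⟨g, (eq_crossedUnitary_iff (M x).isClosed _).2 rfl⟩

end IsCocycleDecomposition

/-- A measurable algebra field is generated by decomposable operators with values in the fibers. -/
theorem IsMeasurableAlgebraField.exists_generators (hM : F.IsMeasurableAlgebraField M) :
    ∃ (A : ℕ → F.integralAlgebra M) (a : ℕ → ∀ x, (M x).toStarSubalgebra),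
      (∀ n, F.IsDirectIntegral (A n) (fun x => (a n x : H x →L[ℂ] H x))) ∧
      ∀ᵐ x ∂μ, M x = generatedVonNeumannAlgebra
        (Set.range fun n => (a n x : H x →L[ℂ] H x)) := by
  classical
  obtain ⟨a, ha, hgen⟩ := hM
  let a' : ℕ → ∀ x, (M x).toStarSubalgebra := fun n x =>
    if h : a n x ∈ M x then ⟨a n x, h⟩ else 0
  have hmem : ∀ᵐ x ∂μ, ∀ n, (a' n x : H x →L[ℂ] H x) = a n x := by
    filter_upwards [hgen] with x hx n
    have h1 : a n x ∈ M x := by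
      rw [hx]
      exact subset_generatedVonNeumannAlgebra _ ⟨n, rfl⟩
    simp only [a', dif_pos h1]
  choose A hA using fun n => (ha n).exists_isDirectIntegral
  have hA' (n) : F.IsDirectIntegral (A n) (fun x => (a' n x : H x →L[ℂ] H x)) :=
    (hA n).congr (by filter_upwards [hmem] with x hx using (hx n).symm)
  refine ⟨fun n => ⟨A n, _, hA' n, Eventually.of_forall fun x => (a' n x).2⟩, a', hA', ?_⟩
  filter_upwards [hgen, hmem] with x hx hm
  simp only [hm]
  exact hx

namespace IsCocycleDecomposition

variable [Countable B] [SigmaFinite μ] (hM : F.IsMeasurableAlgebraField M)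
  {V : (F.ellTwo B).DirectIntegral ≃ₗᵢ[ℂ] lp (fun _ : B => F.DirectIntegral) 2}
  (hV : ∀ ζ b, V (DirectIntegral.mk ζ) b = DirectIntegral.mk (ellTwoCoord b ζ))

include hM hV in
-- Fiber automorphisms fix scalars, so the copy of the diagonal operator with symbol `f` acts on
-- each fiber `ℓ²(B, H x)` as the scalar `f x`.
theorem exists_eq_crossedCopy_of_mem_diagonalOperators
    (h : F.IsCocycleDecomposition M α c α' c')
    {D : (F.ellTwo B).DirectIntegral →L[ℂ] (F.ellTwo B).DirectIntegral}
    (hD : D ∈ (F.ellTwo B).diagonalOperators) :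
    ∃ a : F.integralAlgebra M, D =
      V.symm.conjStarAlgEquiv (crossedCopy (isClosed_integralAlgebra hM) α a) := by
  obtain ⟨f, hf, hs⟩ := hD
  obtain ⟨D, hD⟩ := (IsMeasurableOperatorField.diagonal F hf).exists_isDirectIntegral
  let D' : F.integralAlgebra M :=
    ⟨D, diagonalOperators_subset_integralAlgebra ⟨f, hf, hD⟩ M⟩
  have hD1 := h.isDirectIntegral_crossedCopy hM hV (a := D')
    (T := fun x => f x • 1) hD
  refine ⟨D', hs.eq_of_isDirectIntegral (hD1.congr (Eventually.of_forall fun x => ?_))⟩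
  ext ξ k
  rw [crossedCopy_apply, map_smul, map_one]
  rfl

include hM in
-- The direct integral on the right is a von Neumann algebra, so only the generators matter. Their
-- conjugates decompose into copies and canonical unitaries of the fibers.
theorem generated_le_integralAlgebra (h : F.IsCocycleDecomposition M α c α' c')
    (hV : ∀ ζ b, V (DirectIntegral.mk ζ) b = DirectIntegral.mk (ellTwoCoord b ζ))
    (hfield : (F.ellTwo B).IsMeasurableAlgebraField
      (fun x => cocycleCrossedProduct (α' x) (c' x)))
    {T : lp (fun _ : B => F.DirectIntegral) 2 →L[ℂ] lp (fun _ : B => F.DirectIntegral) 2}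
    (hT : T ∈ cocycleCrossedProduct α c) : V.symm.conjStarAlgEquiv T ∈
      (F.ellTwo B).integralAlgebra (fun x => cocycleCrossedProduct (α' x) (c' x)) := by
  have hcl := isClosed_integralAlgebra hM
  have h1 := (conj_mem_generatedVonNeumannAlgebra_iff V.symm.conjStarAlgEquiv _ T).2 hT
  refine generatedVonNeumannAlgebra_le (integralVonNeumannAlgebra hfield) ?_ h1
  rintro _ ⟨s, ⟨b, hs⟩ | ⟨g, hs⟩, rfl⟩
  · rw [eq_crossedCopy_iff hcl] at hs
    subst hs
    obtain ⟨b', hb'⟩ := exists_fiber_field b.2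
    exact ⟨_, h.isDirectIntegral_crossedCopy hM hV hb', Eventually.of_forall fun x =>
      subset_generatedVonNeumannAlgebra _
        (Or.inl ⟨b' x, (eq_crossedCopy_iff (M x).isClosed _).2 rfl⟩)⟩
  · rw [eq_crossedUnitary_iff hcl] at hs
    subst hs
    exact ⟨_, h.isDirectIntegral_crossedUnitary hM hV g, Eventually.of_forall fun x =>
      subset_generatedVonNeumannAlgebra _
        (Or.inr ⟨g, (eq_crossedUnitary_iff (M x).isClosed _).2 rfl⟩)⟩

end IsCocycleDecomposition

/-- The direct integral is generated by the conjugates of countably many copies and canonical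
unitaries, together with diagonal operators. The diagonal operators are also conjugates of copies,
so nothing outside the crossed product is needed. -/
theorem IsCocycleDecomposition.conj_mem_integralAlgebra_iff [Countable B] [SigmaFinite μ]
    (hM : F.IsMeasurableAlgebraField M) (h : F.IsCocycleDecomposition M α c α' c')
    {V : (F.ellTwo B).DirectIntegral ≃ₗᵢ[ℂ] lp (fun _ : B => F.DirectIntegral) 2}
    (hV : ∀ ζ b, V (DirectIntegral.mk ζ) b = DirectIntegral.mk (ellTwoCoord b ζ)) :
    (F.ellTwo B).IsMeasurableAlgebraField (fun x => cocycleCrossedProduct (α' x) (c' x)) ∧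
    ∀ T : lp (fun _ : B => F.DirectIntegral) 2 →L[ℂ] lp (fun _ : B => F.DirectIntegral) 2,
      V.symm.conjStarAlgEquiv T ∈
        (F.ellTwo B).integralAlgebra (fun x => cocycleCrossedProduct (α' x) (c' x)) ↔
        T ∈ (cocycleCrossedProduct α c).toStarSubalgebra := by
  obtain ⟨A, a, hA, hgen⟩ := hM.exists_generators
  obtain ⟨e, he⟩ := exists_surjective_nat (ℕ ⊕ B)
  have hcl := isClosed_integralAlgebra hM
  let Gx : ℕ → ∀ x, lp (fun _ : B => H x) 2 →L[ℂ] lp (fun _ : B => H x) 2 := fun n x =>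
    Sum.elim (fun i => crossedCopy (M x).isClosed (α' x) (a i x))
        (fun g => crossedUnitary (M x).isClosed (α' x) (c' x) g) (e n)
  let G0 : ℕ → lp (fun _ : B => F.DirectIntegral) 2 →L[ℂ] lp (fun _ : B => F.DirectIntegral) 2 :=
    fun n => Sum.elim (fun i => crossedCopy hcl α (A i)) (fun g => crossedUnitary hcl α c g) (e n)
  have hG (n) : (F.ellTwo B).IsDirectIntegral (V.symm.conjStarAlgEquiv (G0 n)) (Gx n) := by
    simp only [G0, Gx]
    rcases e n with i | g
    · exact h.isDirectIntegral_crossedCopy hM hV (hA i)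
    · exact h.isDirectIntegral_crossedUnitary hM hV g
  have hN := h.ae_crossedProduct_eq hgen he
  have hfield : (F.ellTwo B).IsMeasurableAlgebraField
      (fun x => cocycleCrossedProduct (α' x) (c' x)) := ⟨Gx, fun n => (hG n).1, hN⟩
  have hcopy (b : F.integralAlgebra M) : crossedCopy hcl α b ∈ cocycleCrossedProduct α c :=
    subset_generatedVonNeumannAlgebra _ (Or.inl ⟨b, (eq_crossedCopy_iff hcl _).2 rfl⟩)
  have hunit (g : B) : crossedUnitary hcl α c g ∈ cocycleCrossedProduct α c :=
    subset_generatedVonNeumannAlgebra _ (Or.inr ⟨g, (eq_crossedUnitary_iff hcl _).2 rfl⟩)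
  refine ⟨hfield, fun T => ?_⟩
  constructor
  · intro hT
    rw [mem_integralAlgebra_iff hG hN] at hT
    refine (conj_mem_generatedVonNeumannAlgebra_iff V.symm.conjStarAlgEquiv _ T).1
      (generatedVonNeumannAlgebra_mono
      (fun s hs => ?_) hT)
    rcases hs with ⟨n, rfl⟩ | hs
    · refine (conj_mem_generatedVonNeumannAlgebra_iff V.symm.conjStarAlgEquiv _ (G0 n)).2 ?_
      simp only [G0]
      rcases e n with i | g
      · exact hcopy _
      · exact hunit _
    · obtain ⟨D', rfl⟩ := h.exists_eq_crossedCopy_of_mem_diagonalOperators hM hV hs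
      exact (conj_mem_generatedVonNeumannAlgebra_iff V.symm.conjStarAlgEquiv _ _).2 (hcopy D')
  · exact h.generated_le_integralAlgebra hM hV hfield

/-- The crossed product of a decomposable cocycle action is the direct integral of the crossed
products of the fibers. -/
theorem IsCocycleDecomposition.exists_crossedProduct_equiv [Countable B] [SigmaFinite μ]
    (hM : F.IsMeasurableAlgebraField M) (h : F.IsCocycleDecomposition M α c α' c') :
    (F.ellTwo B).IsMeasurableAlgebraField (fun x => cocycleCrossedProduct (α' x) (c' x)) ∧
      ∃ Φ : (cocycleCrossedProduct α c).toStarSubalgebra ≃⋆ₐ[ℂ]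
          (F.ellTwo B).integralAlgebra (fun x => cocycleCrossedProduct (α' x) (c' x)),
        (∀ (a : F.integralAlgebra M) (a' : ∀ x, (M x).toStarSubalgebra),
          F.IsDirectIntegral a (fun x => (a' x : H x →L[ℂ] H x)) →
          ∃ (T : (cocycleCrossedProduct α c).toStarSubalgebra)
            (T' : ∀ x, lp (fun _ : B => H x) 2 →L[ℂ] lp (fun _ : B => H x) 2),
            IsCopy α a T ∧ (∀ᵐ x ∂μ, IsCopy (α' x) (a' x) (T' x)) ∧
              (F.ellTwo B).IsDirectIntegral (Φ T) T') ∧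
        ∀ g : B, ∃ (U : (cocycleCrossedProduct α c).toStarSubalgebra)
            (U' : ∀ x, lp (fun _ : B => H x) 2 →L[ℂ] lp (fun _ : B => H x) 2),
            IsCanonicalUnitary α c g U ∧ (∀ᵐ x ∂μ, IsCanonicalUnitary (α' x) (c' x) g (U' x)) ∧
              (F.ellTwo B).IsDirectIntegral (Φ U) U' := by
  obtain ⟨V, hV⟩ := exists_ellTwo_equiv F B
  have hiff := h.conj_mem_integralAlgebra_iff hM hV
  have hcl := isClosed_integralAlgebra hM
  have hcopy (b : F.integralAlgebra M) : crossedCopy hcl α b ∈ cocycleCrossedProduct α c :=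
    subset_generatedVonNeumannAlgebra _ (Or.inl ⟨b, (eq_crossedCopy_iff hcl _).2 rfl⟩)
  have hunit (g : B) : crossedUnitary hcl α c g ∈ cocycleCrossedProduct α c :=
    subset_generatedVonNeumannAlgebra _ (Or.inr ⟨g, (eq_crossedUnitary_iff hcl _).2 rfl⟩)
  refine ⟨hiff.1, starAlgEquivRestrict V.symm.conjStarAlgEquiv _ _ hiff.2,
    fun b b' hb => ⟨⟨_, hcopy b⟩, fun x => crossedCopy (M x).isClosed (α' x) (b' x), ?_, ?_, ?_⟩,
    fun g => ⟨⟨_, hunit g⟩, fun x => crossedUnitary (M x).isClosed (α' x) (c' x) g, ?_, ?_, ?_⟩⟩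
  · exact (eq_crossedCopy_iff hcl _).2 rfl
  · exact Eventually.of_forall fun x => (eq_crossedCopy_iff (M x).isClosed _).2 rfl
  · rw [coe_starAlgEquivRestrict]
    exact h.isDirectIntegral_crossedCopy hM hV hb
  · exact (eq_crossedUnitary_iff hcl _).2 rfl
  · exact Eventually.of_forall fun x => (eq_crossedUnitary_iff (M x).isClosed _).2 rfl
  · rw [coe_starAlgEquivRestrict]
    exact h.isDirectIntegral_crossedUnitary hM hV g

end HilbertField

/-! ### Disintegration of normal functionals. -/

namespace HilbertField

variable {X : Type u} [MeasurableSpace X] {μ : Measure X} {H : X → Type v}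
  [∀ x, NormedAddCommGroup (H x)] [∀ x, InnerProductSpace ℂ (H x)]

/-- `φ` is the integral of the field `ψ` of normal functionals. -/
structure IsFunctionalIntegral (F : HilbertField μ H)
    (φ : (F.DirectIntegral →L[ℂ] F.DirectIntegral) →ₗ[ℂ] ℂ)
    (ψ : ∀ x, (H x →L[ℂ] H x) →ₗ[ℂ] ℂ) : Prop where
  normal : ∀ x, IsNormalFunctional (ψ x)
  integrable : ∀ A T, F.IsDirectIntegral A T → Integrable (fun x => ψ x (T x)) μ
  integral : ∀ A T, F.IsDirectIntegral A T → φ A = ∫ x, ψ x (T x) ∂μ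

theorem integrable_tsum_of_summable {f : ℕ → X → ℂ} {g : ℕ → ℝ}
    (hf : ∀ n, Integrable (f n) μ) (hg : Summable g) (hfg : ∀ n, ∫ x, ‖f n x‖ ∂μ ≤ g n)
    (hs : ∀ᵐ x ∂μ, Summable fun n => f n x) : Integrable (fun x => ∑' n, f n x) μ := by
  refine ⟨?_, ?_⟩
  · refine (aemeasurable_of_tendsto_metrizable_ae atTop
      (f := fun N x => ∑ n ∈ Finset.range N, f n x)
      (fun N => Finset.aemeasurable_fun_sum _ fun n _ => (hf n).aemeasurable)
      ?_).aestronglyMeasurable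
    filter_upwards [hs] with x hx using hx.hasSum.tendsto_sum_nat
  · have h1 : Summable fun n => ∫ x, ‖f n x‖ ∂μ :=
      Summable.of_nonneg_of_le (fun n => integral_nonneg fun x => norm_nonneg _) hfg hg
    refine lt_of_le_of_lt (lintegral_mono fun x => enorm_tsum_le_tsum_enorm) ?_
    rw [lintegral_tsum fun n => (hf n).1.enorm]
    simp only [← ofReal_integral_norm_eq_lintegral_enorm (hf _)]
    rw [← ENNReal.ofReal_tsum_of_nonneg (fun n => integral_nonneg fun x => norm_nonneg _) h1]
    exact ENNReal.ofReal_lt_top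

/-- Represent the vectors defining `φ` by sections. Their fiber values are square summable almost
everywhere and define `ψ x` there; elsewhere `ψ x` is `0`. The Cauchy–Schwarz inequality justifies
exchanging the sum with the integral. -/
theorem exists_isFunctionalIntegral {F : HilbertField μ H}
    {φ : (F.DirectIntegral →L[ℂ] F.DirectIntegral) →ₗ[ℂ] ℂ} (hφ : IsNormalFunctional φ) :
    ∃ ψ, F.IsFunctionalIntegral φ ψ := by
  classical
  obtain ⟨ξ', η', hξ', hη', hφ⟩ := hφ
  choose ξ hξ using fun n => DirectIntegral.mk_surjective (ξ' n)
  choose η hη using fun n => DirectIntegral.mk_surjective (η' n)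
  simp only [← hξ] at hξ' hφ
  simp only [← hη] at hη' hφ
  let ψ : ∀ x, (H x →L[ℂ] H x) →ₗ[ℂ] ℂ := fun x =>
    if h : (Summable fun n => ‖ξ n x‖ ^ 2) ∧ Summable fun n => ‖η n x‖ ^ 2 then
      vectorFunctional (fun n => ξ n x) (fun n => η n x) h.1 h.2 else 0
  have hs := (ae_summable_norm_sq hξ').and (ae_summable_norm_sq hη')
  have key (A T) (h : F.IsDirectIntegral A T) : Integrable (fun x => ψ x (T x)) μ ∧
      φ A = ∫ x, ψ x (T x) ∂μ := by
    have hA := h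
    obtain ⟨hT, h⟩ := h
    have hint n : Integrable (fun x => ⟪ξ n x, T x (η n x)⟫) μ :=
      L2.integrable_inner (ξ n) (hT.apply (η n))
    have hb n : ∫ x, ‖⟪ξ n x, T x (η n x)⟫‖ ∂μ ≤
        ‖DirectIntegral.mk (ξ n)‖ ^ 2 + ‖A‖ ^ 2 * ‖DirectIntegral.mk (η n)‖ ^ 2 := by
      have h2 : ‖DirectIntegral.mk (hT.apply (η n))‖ ^ 2 ≤
          ‖A‖ ^ 2 * ‖DirectIntegral.mk (η n)‖ ^ 2 := by
        rw [← h, ← mul_pow]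
        exact pow_le_pow_left₀ (norm_nonneg _) (A.le_opNorm _) 2
      refine le_trans ?_ (add_le_add_right h2 _)
      rw [DirectIntegral.norm_mk, DirectIntegral.norm_mk, L2.norm_sq_eq, L2.norm_sq_eq,
        ← integral_add (L2.integrable _) (L2.integrable _)]
      refine integral_mono (hint n).norm ((L2.integrable _).add (L2.integrable _)) fun x => ?_
      have h3 := norm_inner_le_norm (𝕜 := ℂ) (ξ n x) (T x (η n x))
      simp only [IsMeasurableOperatorField.apply_apply]
      nlinarith [sq_nonneg (‖ξ n x‖ - ‖T x (η n x)‖), sq_nonneg ‖ξ n x‖,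
        sq_nonneg ‖T x (η n x)‖]
    have hsum : Summable fun n => ‖DirectIntegral.mk (ξ n)‖ ^ 2 +
        ‖A‖ ^ 2 * ‖DirectIntegral.mk (η n)‖ ^ 2 := hξ'.add (hη'.mul_left _)
    have hψ : ∀ᵐ x ∂μ, ∑' n, ⟪ξ n x, T x (η n x)⟫ = ψ x (T x) := by
      filter_upwards [hs] with x hx
      simp only [ψ, dif_pos hx]
      rfl
    refine ⟨(integrable_tsum_of_summable hint hsum hb ?_).congr hψ, ?_⟩
    · filter_upwards [hs] with x hx using summable_inner_apply hx.1 hx.2 _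
    · rw [hφ, ← integral_congr_ae hψ, ← integral_tsum_of_summable_integral_norm hint
        (Summable.of_nonneg_of_le (fun n => integral_nonneg fun x => norm_nonneg _) hb hsum)]
      exact tsum_congr fun n => hA.inner_mk_mk _ _
  refine ⟨ψ, fun x => ?_, fun A T h => (key A T h).1, fun A T h => (key A T h).2⟩
  by_cases hx : (Summable fun n => ‖ξ n x‖ ^ 2) ∧ Summable fun n => ‖η n x‖ ^ 2
  · simp only [ψ, dif_pos hx]
    exact ⟨_, _, hx.1, hx.2, fun a => rfl⟩
  · simp only [ψ, dif_neg hx]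
    exact ⟨fun _ => 0, fun _ => 0, by simp, by simp, by simp⟩

namespace IsFunctionalIntegral

variable {F : HilbertField μ H} {φ : (F.DirectIntegral →L[ℂ] F.DirectIntegral) →ₗ[ℂ] ℂ}
  {ψ : ∀ x, (H x →L[ℂ] H x) →ₗ[ℂ] ℂ} {A A' D : F.DirectIntegral →L[ℂ] F.DirectIntegral}
  {T T' : ∀ x, H x →L[ℂ] H x}

theorem setIntegral_eq (hψ : F.IsFunctionalIntegral φ ψ) (hA : F.IsDirectIntegral A T) {E : Set X}
    (hE : MeasurableSet E) (hD : F.IsDirectIntegral D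
      (fun x => E.indicator (fun _ => (1 : ℂ)) x • (1 : H x →L[ℂ] H x))) :
    ∫ x in E, ψ x (T x) ∂μ = φ (D * A) := by
  rw [hψ.integral _ _ (hD.mul hA), ← integral_indicator hE]
  refine integral_congr_ae (Eventually.of_forall fun x => ?_)
  by_cases hx : x ∈ E <;> simp [hx]

theorem exists_indicator (F : HilbertField μ H) {E : Set X} (hE : MeasurableSet E) :
    ∃ D ∈ F.diagonalOperators, F.IsDirectIntegral D
      (fun x => E.indicator (fun _ => (1 : ℂ)) x • (1 : H x →L[ℂ] H x)) := by
  have hf := memLp_top_indicator_one μ hE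
  obtain ⟨D, hD⟩ := (IsMeasurableOperatorField.diagonal F hf).exists_isDirectIntegral
  exact ⟨D, ⟨_, hf, hD⟩, hD⟩

/-- Multiplication by indicators localizes `φ` to integrals over sets, and an integrable function is
determined by these. -/
theorem ae_eq (hψ : F.IsFunctionalIntegral φ ψ) (hA : F.IsDirectIntegral A T)
    (hA' : F.IsDirectIntegral A' T') (h : ∀ D ∈ F.diagonalOperators, φ (D * A) = φ (D * A')) :
    ∀ᵐ x ∂μ, ψ x (T x) = ψ x (T' x) := by
  refine Integrable.ae_eq_of_forall_setIntegral_eq _ _ (hψ.integrable _ _ hA)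
    (hψ.integrable _ _ hA') fun E hE _ => ?_
  obtain ⟨D, hD, hDE⟩ := exists_indicator F hE
  rw [hψ.setIntegral_eq hA hE hDE, hψ.setIntegral_eq hA' hE hDE, h D hD]

/-- Positivity is needed only for projections `D`, since the localizing operators are indicators.
The real and imaginary parts are treated separately. -/
theorem ae_nonneg [∀ x, CompleteSpace (H x)] (hψ : F.IsFunctionalIntegral φ ψ)
    (hA : F.IsDirectIntegral A T) (h : ∀ D ∈ F.diagonalOperators, star D = D → D * D = D → 0 ≤ φ (D * A)) :
    ∀ᵐ x ∂μ, 0 ≤ ψ x (T x) := by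
  have hi := hψ.integrable _ _ hA
  have key (E : Set X) (hE : MeasurableSet E) : 0 ≤ ∫ x in E, ψ x (T x) ∂μ := by
    obtain ⟨D, hD, hDE⟩ := exists_indicator F hE
    rw [hψ.setIntegral_eq hA hE hDE]
    refine h D hD ?_ ?_
    · refine hDE.star.eq_of_isDirectIntegral (hDE.congr (Eventually.of_forall fun x => ?_))
      by_cases hx : x ∈ E <;> simp [hx]
    · refine (hDE.mul hDE).eq_of_isDirectIntegral (hDE.congr (Eventually.of_forall fun x => ?_))
      by_cases hx : x ∈ E <;> simp [hx]
  have h1 : 0 ≤ᵐ[μ] fun x => (ψ x (T x)).re := by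
    refine ae_nonneg_of_forall_setIntegral_nonneg hi.re fun E hE _ => ?_
    have h3 := (Complex.le_def.1 (key E hE)).1
    exact h3.trans_eq (integral_re (𝕜 := ℂ) hi.integrableOn).symm
  have h2 : (fun x => (ψ x (T x)).im) =ᵐ[μ] 0 := by
    refine Integrable.ae_eq_zero_of_forall_setIntegral_eq_zero hi.im fun E hE _ => ?_
    have h3 := (Complex.le_def.1 (key E hE)).2
    exact (integral_im (𝕜 := ℂ) hi.integrableOn).trans h3.symm
  filter_upwards [h1, h2] with x h1 h2
  exact Complex.le_def.2 ⟨h1, h2.symm⟩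

end IsFunctionalIntegral

end HilbertField

/-! ### Countable stable sets and their values in a fiber. -/

/-- A subset of a `*`-algebra which is stable under the algebraic operations and under scalars
from a dense sequence. -/
structure IsStableSet {E : Type*} [Ring E] [StarRing E] [Algebra ℂ E] (S : Set E) : Prop where
  one_mem : 1 ∈ S
  add_mem : ∀ a ∈ S, ∀ b ∈ S, a + b ∈ S
  mul_mem : ∀ a ∈ S, ∀ b ∈ S, a * b ∈ S
  star_mem : ∀ a ∈ S, star a ∈ S
  smul_mem : ∀ (k : ℕ), ∀ a ∈ S, TopologicalSpace.denseSeq ℂ k • a ∈ S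

/-- The map `r` respects the algebraic operations on the stable set `S`, and its values on `S`
generate `M`. -/
structure IsFiberMap {K : Type u} [NormedAddCommGroup K] [InnerProductSpace ℂ K] [CompleteSpace K]
    (M : VonNeumannAlgebra K) {E : Type*} [Ring E] [StarRing E] [Algebra ℂ E] (S : Set E)
    (r : E → M.toStarSubalgebra) : Prop where
  map_one : r 1 = 1
  map_add : ∀ a ∈ S, ∀ b ∈ S, r (a + b) = r a + r b
  map_mul : ∀ a ∈ S, ∀ b ∈ S, r (a * b) = r a * r b
  map_star : ∀ a ∈ S, r (star a) = star (r a)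
  map_smul : ∀ (k : ℕ), ∀ a ∈ S,
    r (TopologicalSpace.denseSeq ℂ k • a) = TopologicalSpace.denseSeq ℂ k • r a
  generates : ∀ b ∈ M, b ∈ generatedVonNeumannAlgebra ((fun a => (r a : K →L[ℂ] K)) '' S)

namespace IsFiberMap

variable {K : Type u} [NormedAddCommGroup K] [InnerProductSpace ℂ K] [CompleteSpace K]
  {M : VonNeumannAlgebra K} {E : Type*} [Ring E] [StarRing E] [Algebra ℂ E] {S : Set E}
  {r : E → M.toStarSubalgebra}

/-- The norm closure of the values. -/
def closedRange (hr : IsFiberMap M S r) (hS : IsStableSet S) : StarSubalgebra ℂ (K →L[ℂ] K) :=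
  closureStarSubalgebra ((fun a => (r a : K →L[ℂ] K)) '' S) ⟨1, hS.one_mem, by simp [hr.map_one]⟩
    (by
      rintro _ ⟨a, ha, rfl⟩ _ ⟨b, hb, rfl⟩
      exact ⟨a + b, hS.add_mem a ha b hb, by simp [hr.map_add a ha b hb]⟩)
    (by
      rintro _ ⟨a, ha, rfl⟩ _ ⟨b, hb, rfl⟩
      exact ⟨a * b, hS.mul_mem a ha b hb, by simp [hr.map_mul a ha b hb]⟩)
    (by
      rintro _ ⟨a, ha, rfl⟩
      exact ⟨star a, hS.star_mem a ha, by simp [hr.map_star a ha]⟩)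
    (by
      rintro k _ ⟨a, ha, rfl⟩
      exact ⟨_, hS.smul_mem k a ha, by simp [hr.map_smul k a ha]⟩)

theorem closedRange_generates (hr : IsFiberMap M S r) (hS : IsStableSet S) :
    ∀ b ∈ M, b ∈ generatedVonNeumannAlgebra (hr.closedRange hS : Set (K →L[ℂ] K)) := by
  intro b hb
  refine generatedVonNeumannAlgebra_mono (fun _ h => ?_) (hr.generates b hb)
  exact subset_generatedVonNeumannAlgebra _ (subset_closure h)

/-- The identity passes from the values on `S` to their norm closure by continuity, and from there
to `M` by Kaplansky density. -/
theorem trace_of_forall (hr : IsFiberMap M S r) (hS : IsStableSet S)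
    {φ : (K →L[ℂ] K) →ₗ[ℂ] ℂ} (hφ : IsNormalFunctional φ)
    (h : ∀ a ∈ S, ∀ b ∈ S, φ (r (a * b)) = φ (r (b * a))) {a b : K →L[ℂ] K} (ha : a ∈ M)
    (hb : b ∈ M) : φ (a * b) = φ (b * a) := by
  refine hφ.trace_of_generating (hr.closedRange_generates hS) (fun a ha b hb => ?_) ha hb
  have hc : IsClosed {y : (K →L[ℂ] K) × (K →L[ℂ] K) | φ (y.1 * y.2) = φ (y.2 * y.1)} :=
    isClosed_eq (hφ.continuous.comp (continuous_fst.mul continuous_snd))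
      (hφ.continuous.comp (continuous_snd.mul continuous_fst))
  have hmem : (a, b) ∈ closure (((fun a => (r a : K →L[ℂ] K)) '' S) ×ˢ
      ((fun a => (r a : K →L[ℂ] K)) '' S)) := by
    rw [closure_prod_eq]
    exact ⟨ha, hb⟩
  refine closure_minimal ?_ hc hmem
  rintro ⟨_, _⟩ ⟨⟨a, ha, rfl⟩, ⟨b, hb, rfl⟩⟩
  have := h a ha b hb
  rw [hr.map_mul a ha b hb, hr.map_mul b hb a ha] at this
  exact this

theorem nonneg_of_forall (hr : IsFiberMap M S r) (hS : IsStableSet S)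
    {φ : (K →L[ℂ] K) →ₗ[ℂ] ℂ} (hφ : IsNormalFunctional φ)
    (h : ∀ a ∈ S, 0 ≤ φ (r (star a * a))) {a : K →L[ℂ] K} (ha : a ∈ M) :
    0 ≤ φ (star a * a) := by
  refine hφ.nonneg_of_generating (hr.closedRange_generates hS) (fun a ha => ?_) ha
  have hc : IsClosed {y : K →L[ℂ] K | 0 ≤ φ (star y * y)} :=
    isClosed_le continuous_const (hφ.continuous.comp (continuous_star.mul continuous_id))
  refine closure_minimal ?_ hc ha
  rintro _ ⟨a, ha, rfl⟩
  have := h a ha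
  rw [hr.map_mul _ (hS.star_mem a ha) a ha, hr.map_star a ha] at this
  exact this

/-- An alternative to faithfulness in terms of the values on `S`. -/
theorem isNormalTrace_or_exists (hr : IsFiberMap M S r) (hS : IsStableSet S)
    {φ : (K →L[ℂ] K) →ₗ[ℂ] ℂ} (hφ : IsNormalFunctional φ)
    (htr : ∀ a ∈ S, ∀ b ∈ S, φ (r (a * b)) = φ (r (b * a)))
    (hpos : ∀ a ∈ S, 0 ≤ φ (r (star a * a))) {ζ : ℕ → K}
    (hζ : (Submodule.span ℂ (Set.range ζ)).topologicalClosure = ⊤) :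
    IsNormalTrace M φ ∨ ∃ n C m : ℕ, ∀ k : ℕ, ∃ a ∈ S, ‖(r a : K →L[ℂ] K)‖ ≤ C ∧
      (φ (r (star a * a))).re ≤ (1 / 2 : ℝ) ^ k ∧
      1 / ((m : ℝ) + 1) ≤ ‖(r a : K →L[ℂ] K) (ζ n)‖ := by
  by_cases hf : ∀ a ∈ M, φ (star a * a) = 0 → a = 0
  · exact Or.inl ⟨hφ, fun a ha => hr.nonneg_of_forall hS hφ hpos ha, hf,
      fun a ha b hb => hr.trace_of_forall hS hφ htr ha hb⟩
  · push Not at hf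
    obtain ⟨a, ha, h0, hne⟩ := hf
    right
    obtain ⟨n, C, m, h⟩ := hφ.exists_of_not_faithful (hr.closedRange_generates hS)
      (Q := (fun a => (r a : K →L[ℂ] K)) '' S) (fun _ h => h) hζ ha h0 hne
    refine ⟨n, C, m, fun k => ?_⟩
    obtain ⟨_, ⟨q, hq, rfl⟩, h1, h2, h3⟩ := h k
    refine ⟨q, hq, h1, ?_, h3⟩
    rw [hr.map_mul _ (hS.star_mem q hq) q hq, hr.map_star q hq]
    exact h2

/-- Apply the graph extension to the norm closure of the pairs `(r a, r (θ a))`. The second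
coordinates generate `M` because `θ.symm` preserves `S`. -/
theorem exists_automorphism (hr : IsFiberMap M S r) (hS : IsStableSet S)
    {φ : (K →L[ℂ] K) →ₗ[ℂ] ℂ} (hφ : IsNormalTrace M φ) {θ : E ≃⋆ₐ[ℂ] E}
    (hθ : ∀ a ∈ S, θ a ∈ S) (hθ' : ∀ a ∈ S, θ.symm a ∈ S)
    (hφθ : ∀ a ∈ S, φ (r (θ a)) = φ (r a)) :
    ∃ ρ : M.toStarSubalgebra ≃⋆ₐ[ℂ] M.toStarSubalgebra,
      (∀ a, φ (ρ a : K →L[ℂ] K) = φ a) ∧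
      ∀ b b' : M.toStarSubalgebra, (∀ a ∈ S, φ ((b * r a : M.toStarSubalgebra) : K →L[ℂ] K) =
        φ ((b' * r (θ a) : M.toStarSubalgebra) : K →L[ℂ] K)) → ρ b = b' := by
  let Q : Set ((K →L[ℂ] K) × (K →L[ℂ] K)) :=
    (fun a => ((r a : K →L[ℂ] K), (r (θ a) : K →L[ℂ] K))) '' S
  have hθs (a : E) : θ (star a) = star (θ a) := θ.map_star' a
  let G : StarSubalgebra ℂ ((K →L[ℂ] K) × (K →L[ℂ] K)) :=
    closureStarSubalgebra Q ⟨1, hS.one_mem, by simp [hr.map_one, _root_.map_one]⟩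
    (by
      rintro _ ⟨a, ha, rfl⟩ _ ⟨b, hb, rfl⟩
      refine ⟨a + b, hS.add_mem a ha b hb, ?_⟩
      simp [_root_.map_add, hr.map_add a ha b hb, hr.map_add _ (hθ a ha) _ (hθ b hb)])
    (by
      rintro _ ⟨a, ha, rfl⟩ _ ⟨b, hb, rfl⟩
      refine ⟨a * b, hS.mul_mem a ha b hb, ?_⟩
      simp [_root_.map_mul, hr.map_mul a ha b hb, hr.map_mul _ (hθ a ha) _ (hθ b hb)])
    (by
      rintro _ ⟨a, ha, rfl⟩
      refine ⟨star a, hS.star_mem a ha, ?_⟩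
      simp [hθs, hr.map_star a ha, hr.map_star _ (hθ a ha), Prod.star_def])
    (by
      rintro k _ ⟨a, ha, rfl⟩
      refine ⟨_, hS.smul_mem k a ha, ?_⟩
      simp [_root_.map_smul, hr.map_smul k a ha, hr.map_smul k _ (hθ a ha)])
  have hQG (a) (ha : a ∈ S) : ((r a : K →L[ℂ] K), (r (θ a) : K →L[ℂ] K)) ∈ G :=
    subset_closure ⟨a, ha, rfl⟩
  have hc1 : IsClosed {y : (K →L[ℂ] K) × (K →L[ℂ] K) | y.1 ∈ M ∧ y.2 ∈ M} :=
    (M.isClosed.preimage continuous_fst).inter (M.isClosed.preimage continuous_snd)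
  have hc2 : IsClosed {y : (K →L[ℂ] K) × (K →L[ℂ] K) | φ y.1 = φ y.2} :=
    isClosed_eq (hφ.normal.continuous.comp continuous_fst)
      (hφ.normal.continuous.comp continuous_snd)
  have hG1 : ∀ b ∈ M, b ∈ generatedVonNeumannAlgebra
      (Prod.fst '' (G : Set ((K →L[ℂ] K) × (K →L[ℂ] K)))) := by
    intro b hb
    refine generatedVonNeumannAlgebra_mono ?_ (hr.generates b hb)
    rintro _ ⟨a, ha, rfl⟩
    exact subset_generatedVonNeumannAlgebra _ ⟨_, hQG a ha, rfl⟩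
  have hG2 : ∀ b ∈ M, b ∈ generatedVonNeumannAlgebra
      (Prod.snd '' (G : Set ((K →L[ℂ] K) × (K →L[ℂ] K)))) := by
    intro b hb
    refine generatedVonNeumannAlgebra_mono ?_ (hr.generates b hb)
    rintro _ ⟨a, ha, rfl⟩
    refine subset_generatedVonNeumannAlgebra _ ⟨_, hQG _ (hθ' a ha), ?_⟩
    simp only [StarAlgEquiv.apply_symm_apply]
  obtain ⟨ρ, hρ1, hρ2⟩ := hφ.exists_automorphism (G := G)
    (fun y hy => closure_minimal (by rintro _ ⟨a, ha, rfl⟩; exact ⟨(r a).2, (r (θ a)).2⟩) hc1 hy)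
    (fun y hy => closure_minimal (by rintro _ ⟨a, ha, rfl⟩; exact (hφθ a ha).symm) hc2 hy) hG1 hG2
  refine ⟨ρ, hρ1, fun b b' h => hρ2 b b' fun y hy => ?_⟩
  have hc : IsClosed {y : (K →L[ℂ] K) × (K →L[ℂ] K) |
      φ ((b : K →L[ℂ] K) * y.1) = φ ((b' : K →L[ℂ] K) * y.2)} :=
    isClosed_eq (hφ.normal.continuous.comp (continuous_const.mul continuous_fst))
      (hφ.normal.continuous.comp (continuous_const.mul continuous_snd))
  refine closure_minimal ?_ hc hy
  rintro _ ⟨a, ha, rfl⟩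
  exact h a ha

/-- A cocycle action on a stable set with an invariant trace extends to the fiber. -/
theorem exists_cocycleAction (hr : IsFiberMap M S r) (hS : IsStableSet S)
    {φ : (K →L[ℂ] K) →ₗ[ℂ] ℂ} (hφ : IsNormalTrace M φ) {B : Type w} [Group B]
    {α : B → (E ≃⋆ₐ[ℂ] E)} {c : B → B → unitary E}
    (hα : ∀ g, ∀ a ∈ S, α g a ∈ S) (hα' : ∀ g, ∀ a ∈ S, (α g).symm a ∈ S)
    (hc : ∀ g h, (c g h : E) ∈ S) (hφα : ∀ g, ∀ a ∈ S, φ (r (α g a)) = φ (r a))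
    (hmap : ∀ g h a, α g (α h a) = (c g h : E) * α (g * h) a * star (c g h : E))
    (hcoc : ∀ g h k, (c g h : E) * (c (g * h) k : E) = α g (c h k : E) * (c g (h * k) : E))
    (hc1 : ∀ g, c g 1 = 1) (h1c : ∀ g, c 1 g = 1) :
    ∃ (α' : B → (M.toStarSubalgebra ≃⋆ₐ[ℂ] M.toStarSubalgebra))
      (c' : B → B → unitary M.toStarSubalgebra),
      (∀ g (a : M.toStarSubalgebra), φ (α' g a : K →L[ℂ] K) = φ a) ∧
      (∀ g h a, α' g (α' h a) = (c' g h : M.toStarSubalgebra) * α' (g * h) a *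
        star (c' g h : M.toStarSubalgebra)) ∧
      (∀ g h k, (c' g h : M.toStarSubalgebra) * (c' (g * h) k : M.toStarSubalgebra) =
        α' g (c' h k : M.toStarSubalgebra) * (c' g (h * k) : M.toStarSubalgebra)) ∧
      (∀ g, c' g 1 = 1) ∧ (∀ g, c' 1 g = 1) ∧
      (∀ g h, (c' g h : M.toStarSubalgebra) = r (c g h)) ∧
      ∀ g, ∀ b b' : M.toStarSubalgebra, (∀ a ∈ S,
        φ ((b * r a : M.toStarSubalgebra) : K →L[ℂ] K) =
        φ ((b' * r (α g a) : M.toStarSubalgebra) : K →L[ℂ] K)) → α' g b = b' := by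
  choose α' hα1 hα2 using fun g => hr.exists_automorphism hS hφ (hα g) (hα' g) (hφα g)
  -- The extended automorphism is defined by its pairing with `S`; on values of `S` this pairing is
  -- the invariance of the trace applied to `a * b`.
  have hαr (g) (a) (ha : a ∈ S) : α' g (r a) = r (α g a) := by
    refine hα2 g _ _ fun b hb => ?_
    rw [← hr.map_mul a ha b hb, ← hr.map_mul _ (hα g a ha) _ (hα g b hb), ← _root_.map_mul]
    exact (hφα g _ (hS.mul_mem a ha b hb)).symm
  have hcs (g h) : star (c g h : E) ∈ S := hS.star_mem _ (hc g h)
  have hu (g h) : r (c g h) ∈ unitary M.toStarSubalgebra := by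
    have h1 := Unitary.mem_iff.1 (c g h).2
    rw [Unitary.mem_iff, ← hr.map_star _ (hc g h), ← hr.map_mul _ (hcs g h) _ (hc g h),
      ← hr.map_mul _ (hc g h) _ (hcs g h), h1.1, h1.2, hr.map_one]
    exact ⟨rfl, rfl⟩
  refine ⟨α', fun g h => ⟨r (c g h), hu g h⟩, hα1, fun g h a => ?_, fun g h k => ?_, fun g => ?_,
    fun g => ?_, fun g h => rfl, hα2⟩
  · have hun := Unitary.mem_iff.1 (hu g h)
    -- Both sides are multiplicative and trace preserving and agree on the values of `S`. The left
    -- side is an automorphism, so they agree on `M`.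
    refine hφ.automorphism_ext (hr.closedRange_generates hS)
      (Q := (fun a => (r a : K →L[ℂ] K)) '' S) (fun _ h => h) ?_ (θ := (α' h).trans (α' g))
      (θ' := fun a => r (c g h) * α' (g * h) a * star (r (c g h))) (fun a b => ?_) (fun a => ?_)
      (fun a => ?_) ?_ a
    · rintro _ ⟨a, _, rfl⟩
      exact (r a).2
    · simp only [_root_.map_mul, mul_assoc]
      rw [← mul_assoc (star (r (c g h))) (r (c g h)), hun.1, one_mul]
    · change φ (α' g (α' h a) : K →L[ℂ] K) = _
      rw [hα1, hα1]
    · have h2 := hφ.trace ((r (c g h) * α' (g * h) a : M.toStarSubalgebra) : K →L[ℂ] K)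
        (r (c g h) * α' (g * h) a).2 (star (r (c g h)) : M.toStarSubalgebra)
        (star (r (c g h))).2
      have h3 : star (r (c g h)) * (r (c g h) * α' (g * h) a) = α' (g * h) a := by
        rw [← mul_assoc, hun.1, one_mul]
      have h4 := congrArg (fun b : M.toStarSubalgebra => φ (b : K →L[ℂ] K)) h3
      exact (h2.trans h4).trans (hα1 _ _)
    · rintro a ⟨b, hb, hab⟩
      have hab' : a = r b := Subtype.ext hab.symm
      subst hab'
      change α' g (α' h (r b)) = r (c g h) * α' (g * h) (r b) * star (r (c g h))
      rw [hαr h b hb, hαr g _ (hα h b hb), hαr _ b hb, hmap, hr.map_mul _ (hS.mul_mem _ (hc g h) _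
        (hα _ _ hb)) _ (hcs g h), hr.map_mul _ (hc g h) _ (hα _ _ hb), hr.map_star _ (hc g h)]
  · change r (c g h) * r (c (g * h) k) = α' g (r (c h k)) * r (c g (h * k))
    rw [hαr g _ (hc h k), ← hr.map_mul _ (hc g h) _ (hc _ _), hcoc,
      hr.map_mul _ (hα g _ (hc h k)) _ (hc _ _)]
  · refine Subtype.ext ?_
    change r (c g 1) = 1
    rw [hc1, OneMemClass.coe_one, hr.map_one]
  · refine Subtype.ext ?_
    change r (c 1 g) = 1
    rw [h1c, OneMemClass.coe_one, hr.map_one]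

end IsFiberMap

/-! ### Faithfulness in almost every fiber by measurable selection. -/

/-- On bounded sets, convergence in the `2`-norm of a faithful normal trace implies strong
convergence. -/
theorem IsNormalTrace.tendsto_norm_apply {K : Type u} [NormedAddCommGroup K]
    [InnerProductSpace ℂ K] [CompleteSpace K] {M : VonNeumannAlgebra K}
    {φ : (K →L[ℂ] K) →ₗ[ℂ] ℂ} (h : IsNormalTrace M φ) {I : Type w} (U : Ultrafilter I)
    {p : I → K →L[ℂ] K} {C : ℝ} (hM : ∀ i, p i ∈ M) (hC : ∀ i, ‖p i‖ ≤ C)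
    (h0 : Tendsto (fun i => φ (star (p i) * p i)) U (𝓝 0)) (v : K) :
    Tendsto (fun i => ‖p i v‖ ^ 2) U (𝓝 0) := by
  have hC' (i) : ‖star (p i) * p i‖ ≤ C * C := by
    refine (norm_mul_le _ _).trans ?_
    rw [norm_star]
    exact mul_le_mul (hC i) (hC i) (norm_nonneg _) ((norm_nonneg _).trans (hC i))
  -- The weak limit `b` of `star (p i) * p i` is a positive element of `M` with `φ b = 0`. Applying
  -- faithfulness to its square root, which lies in `M`, shows `b = 0`.
  obtain ⟨b, hb⟩ := exists_weak_limit U _ hC'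
  have hbv (v : K) : Tendsto (fun i => ((‖p i v‖ ^ 2 : ℝ) : ℂ)) U (𝓝 ⟪v, b v⟫) := by
    refine (hb v v).congr fun i => ?_
    simp only [mul_apply_eq_comp, ContinuousLinearMap.star_eq_adjoint,
      ContinuousLinearMap.adjoint_inner_right, inner_self_eq_norm_sq_to_K]
    norm_cast
  have hbM : b ∈ M :=
    M.mem_of_tendsto_inner (l := (U : Filter I)) (fun i => mul_mem (star_mem (hM i)) (hM i)) hb
  have hφb : φ b = 0 := tendsto_nhds_unique (h.normal.tendsto hC' hb) h0
  have hb0 : 0 ≤ b := by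
    rw [ContinuousLinearMap.nonneg_iff_isPositive, ContinuousLinearMap.isPositive_iff_complex]
    intro v
    have h1 : (0 : ℂ) ≤ ⟪v, b v⟫ := ge_of_tendsto (hbv v) (Eventually.of_forall fun i => by
      exact_mod_cast sq_nonneg ‖p i v‖)
    have h2 := Complex.le_def.1 h1
    have h3 : ⟪b v, v⟫ = ⟪v, b v⟫ := by
      rw [← inner_conj_symm, Complex.conj_eq_iff_im.2 h2.2.symm]
    rw [h3]
    exact ⟨Complex.ext (by simp) (by simpa using h2.2), h2.1⟩
  have hs : star (CFC.sqrt b) = CFC.sqrt b := (IsSelfAdjoint.of_nonneg (CFC.sqrt_nonneg b)).star_eq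
  have hsM : CFC.sqrt b ∈ M := by
    rw [M.mem_iff_forall_commutant]
    intro c hc
    have h1 : Commute b c := ((M.mem_iff_forall_commutant).1 hbM c hc).symm
    exact (h1.cfcₙ_nnreal NNReal.sqrt).symm
  have hs0 : CFC.sqrt b = 0 := by
    refine h.faithful _ hsM ?_
    rw [hs, CFC.sqrt_mul_sqrt_self b hb0, hφb]
  have hb00 : b = 0 := by
    rw [← CFC.sqrt_mul_sqrt_self b hb0, hs0, zero_mul]
  have h3 := (Complex.continuous_re.tendsto _).comp (hbv v)
  rw [hb00] at h3
  simpa only [Function.comp_def, Complex.ofReal_re, zero_apply, inner_zero_right,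
    Complex.zero_re] using h3

/-- Replace each `f i` by a measurable representative; the resulting function on `ℕ × X` is
measurable because the index is countable. -/
theorem aemeasurable_of_countable_index {X : Type u} [MeasurableSpace X] {μ : Measure X}
    {f : ℕ → X → ℂ} (hf : ∀ i, AEMeasurable (f i) μ) {g : X → ℕ} (hg : Measurable g) :
    AEMeasurable (fun x => f (g x) x) μ := by
  refine ⟨fun x => (hf (g x)).mk _ x, ?_, ?_⟩
  · have h1 : Measurable fun y : ℕ × X => (hf y.1).mk _ y.2 :=
      measurable_from_prod_countable_right fun i => (hf i).measurable_mk
    exact h1.comp (hg.prodMk measurable_id)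
  · filter_upwards [ae_all_iff.2 fun i => (hf i).ae_eq_mk] with x hx using hx _

namespace HilbertField

variable {X : Type u} [MeasurableSpace X] {μ : Measure X} {H : X → Type v}
  [∀ x, NormedAddCommGroup (H x)] [∀ x, InnerProductSpace ℂ (H x)] {F : HilbertField μ H}

theorem IsDirectIntegral.norm_le {A : F.DirectIntegral →L[ℂ] F.DirectIntegral}
    {T : ∀ x, H x →L[ℂ] H x} (h : F.IsDirectIntegral A T) {C : ℝ} (hC0 : 0 ≤ C)
    (hC : ∀ᵐ x ∂μ, ‖T x‖ ≤ C) : ‖A‖ ≤ C := by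
  refine A.opNorm_le_bound hC0 fun u => ?_
  obtain ⟨ζ, rfl⟩ := DirectIntegral.mk_surjective u
  obtain ⟨hT, h⟩ := h
  rw [h, DirectIntegral.norm_mk, DirectIntegral.norm_mk,
    ← sq_le_sq₀ (norm_nonneg _) (by positivity), mul_pow, L2.norm_sq_eq, L2.norm_sq_eq,
    ← integral_const_mul]
  refine integral_mono_ae (L2.integrable _) ((L2.integrable _).const_mul _) ?_
  filter_upwards [hC] with x hx
  rw [← mul_pow]
  exact pow_le_pow_left₀ (norm_nonneg _) ((T x).le_of_opNorm_le hx _) 2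

/-- The operator norm bound can be tested on countably many sections that are dense in almost every
fiber. -/
theorem IsMeasurableOperatorField.nullMeasurableSet_norm_le [SigmaFinite μ]
    {T : ∀ x, H x →L[ℂ] H x} (hT : F.IsMeasurableOperatorField T) {C : ℝ} (hC : 0 ≤ C) :
    NullMeasurableSet {x | ‖T x‖ ≤ C} μ := by
  obtain ⟨ζ, hζ⟩ := F.exists_isTotal
  have h1 : NullMeasurableSet (⋂ j, {x | ‖T x (F.combination ζ j x)‖ ≤
      C * ‖F.combination ζ j x‖}) μ := by
    refine NullMeasurableSet.iInter fun j => nullMeasurableSet_le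
      (F.aemeasurable_norm (hT.apply_mem_sections (F.combination ζ j).mem_sections))
      ((F.aemeasurable_norm (F.combination ζ j).mem_sections).const_mul _)
  refine h1.congr ?_
  filter_upwards [hζ.denseRange] with x hx
  refine propext ?_
  change x ∈ (⋂ j, {x | ‖T x (F.combination ζ j x)‖ ≤ C * ‖F.combination ζ j x‖}) ↔ ‖T x‖ ≤ C
  simp only [Set.mem_iInter, Set.mem_ofPred_eq]
  refine ⟨fun h => (T x).opNorm_le_bound hC fun v => ?_, fun h j => (T x).le_of_opNorm_le h _⟩
  have hc : IsClosed {v | ‖T x v‖ ≤ C * ‖v‖} := isClosed_le (by fun_prop) (by fun_prop)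
  refine closure_minimal ?_ hc (hx v)
  rintro _ ⟨j, rfl⟩
  exact h j

/-- A measurable choice among countably many fields of operators, on a measurable set. -/
theorem isMeasurableOperatorField_choice {T : ℕ → ∀ x, H x →L[ℂ] H x}
    (hT : ∀ i, F.IsMeasurableOperatorField (T i)) {g : X → ℕ} (hg : Measurable g) {C : ℝ}
    (hC0 : 0 ≤ C) {E : Set X} [DecidablePred (· ∈ E)] (hE : MeasurableSet E)
    (hC : ∀ x ∈ E, ‖T (g x) x‖ ≤ C) :
    F.IsMeasurableOperatorField (fun x => if x ∈ E then T (g x) x else 0) := by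
  refine ⟨fun ξ hξ η hη => ?_, C, Eventually.of_forall fun x => ?_⟩
  · refine ((aemeasurable_of_countable_index (fun i => (hT i).aemeasurable ξ hξ η hη)
      hg).indicator hE).congr (Eventually.of_forall fun x => ?_)
    by_cases hx : x ∈ E <;> simp [hx]
  · by_cases hx : x ∈ E
    · simpa [hx] using hC x hx
    · simpa [hx] using hC0

end HilbertField

namespace HilbertField

variable {X : Type u} [MeasurableSpace X] {μ : Measure X} {H : X → Type v}
  [∀ x, NormedAddCommGroup (H x)] [∀ x, InnerProductSpace ℂ (H x)] [∀ x, CompleteSpace (H x)]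
  [SigmaFinite μ] {F : HilbertField μ H} {M : ∀ x, VonNeumannAlgebra (H x)}

/-- The measurable selection behind the faithfulness of almost every functional in the integral
decomposition of a faithful trace. -/
theorem exists_measurable_selection {N : ℕ → ℕ → Set X} (hN : ∀ i k, NullMeasurableSet (N i k) μ)
    (hpos : μ {x | ∀ k, ∃ i, x ∈ N i k} ≠ 0) :
    ∃ (E : Set X) (g : ℕ → X → ℕ), MeasurableSet E ∧ 0 < μ E ∧ μ E < ∞ ∧ (∀ k, Measurable (g k)) ∧
      ∀ k, ∀ x ∈ E, x ∈ N (g k x) k := by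
  classical
  choose N' hsub hm hae using fun i k => (hN i k).exists_measurable_subset_ae_eq
  let Bad : Set X := ⋂ k, ⋃ i, N' i k
  have hBad : MeasurableSet Bad :=
    MeasurableSet.iInter fun k => MeasurableSet.iUnion fun i => hm i k
  have hBad0 : 0 < μ Bad := by
    refine pos_iff_ne_zero.2 fun h0 => hpos ?_
    have h1 : {x | ∀ k, ∃ i, x ∈ N i k} = ⋂ k, ⋃ i, N i k := by
      ext x
      simp
    rw [h1, ← h0]
    exact measure_congr (Filter.EventuallyEq.countable_iInter fun k =>
      Filter.EventuallyEq.countable_iUnion fun i => (hae i k).symm)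
  obtain ⟨E, hE, hEB, hE0, hEf⟩ := Measure.exists_subset_measure_lt_top hBad hBad0
  -- The second alternative ensures that a least index exists at every `x`; it is excluded on `E`.
  have hp (k : ℕ) (x : X) : ∃ i, x ∈ N' i k ∨ x ∉ ⋃ i, N' i k := by
    by_cases hx : x ∈ ⋃ i, N' i k
    · obtain ⟨i, hi⟩ := Set.mem_iUnion.1 hx
      exact ⟨i, Or.inl hi⟩
    · exact ⟨0, Or.inr hx⟩
  refine ⟨E, fun k x => Nat.find (hp k x), hE, hE0, hEf, fun k => ?_, fun k x hx => ?_⟩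
  · exact measurable_find _ fun i => (hm i k).union (MeasurableSet.iUnion fun i => hm i k).compl
  · refine hsub _ _ ?_
    exact (Nat.find_spec (hp k x)).resolve_right fun h => h (Set.mem_iInter.1 (hEB hx) k)

namespace IsFunctionalIntegral

/-- Otherwise the witnesses could be selected measurably on a set `E` of finite positive measure.
The glued operators `p k` are bounded by `C`, and `φ (star (p k) * p k)` is at most `2⁻ᵏ μ(E)`, so
they tend strongly to zero. But the squared norm of `p k` applied to `ζ` is at least `δ² μ(E)`. -/
theorem ae_not_forall_exists {φ : (F.DirectIntegral →L[ℂ] F.DirectIntegral) →ₗ[ℂ] ℂ}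
    {ψ : ∀ x, (H x →L[ℂ] H x) →ₗ[ℂ] ℂ} (hψ : F.IsFunctionalIntegral φ ψ)
    (hM : F.IsMeasurableAlgebraField M) (hφ : IsNormalTrace (F.integralVonNeumannAlgebra hM) φ)
    {A : ℕ → F.DirectIntegral →L[ℂ] F.DirectIntegral} {T : ℕ → ∀ x, H x →L[ℂ] H x}
    (hA : ∀ i, F.IsDirectIntegral (A i) (T i)) (hT : ∀ᵐ x ∂μ, ∀ i, T i x ∈ M x) (ζ : F.L2)
    {C δ : ℝ} (hC : 0 ≤ C) (hδ : 0 < δ) :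
    ∀ᵐ x ∂μ, ¬ ∀ k : ℕ, ∃ i, ‖T i x‖ ≤ C ∧
      (ψ x (star (T i x) * T i x)).re ≤ (1 / 2 : ℝ) ^ k ∧ δ ≤ ‖T i x (ζ x)‖ := by
  classical
  let N : ℕ → ℕ → Set X := fun i k => {x | ‖T i x‖ ≤ C} ∩
    ({x | (ψ x (star (T i x) * T i x)).re ≤ (1 / 2 : ℝ) ^ k} ∩ {x | δ ≤ ‖T i x (ζ x)‖})
  have hN (i k) : NullMeasurableSet (N i k) μ := by
    refine ((hA i).1.nullMeasurableSet_norm_le hC).inter (NullMeasurableSet.inter ?_ ?_)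
    · exact nullMeasurableSet_le (hψ.integrable _ _ ((hA i).star.mul (hA i))).re.aemeasurable
        aemeasurable_const
    · exact nullMeasurableSet_le aemeasurable_const
        (F.aemeasurable_norm ((hA i).1.apply_mem_sections ζ.mem_sections))
  by_contra hcon
  obtain ⟨E, g, hE, hE0, hEf, hg, hEN⟩ := exists_measurable_selection hN (by
    intro h0
    refine hcon ?_
    rw [ae_iff]
    simp only [not_not]
    exact h0)
  have hEr : 0 < μ.real E := ENNReal.toReal_pos hE0.ne' hEf.ne
  let P : ℕ → ∀ x, H x →L[ℂ] H x := fun k x => if x ∈ E then T (g k x) x else 0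
  have hPm (k) : F.IsMeasurableOperatorField (P k) :=
    isMeasurableOperatorField_choice (fun i => (hA i).1) (hg k) hC hE fun x hx => (hEN k x hx).1
  choose p hp using fun k => (hPm k).exists_isDirectIntegral
  have hpC (k) : ‖p k‖ ≤ C := (hp k).norm_le hC (Eventually.of_forall fun x => by
    by_cases hx : x ∈ E
    · simpa [P, hx] using (hEN k x hx).1
    · simpa [P, hx] using hC)
  have hpM (k) : p k ∈ F.integralVonNeumannAlgebra hM := by
    refine ⟨P k, hp k, ?_⟩
    filter_upwards [hT] with x hx
    by_cases hxE : x ∈ E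
    · simpa [P, hxE] using hx (g k x)
    · simp [P, hxE]
  have hφre (k) : (φ (star (p k) * p k)).re ≤ (1 / 2 : ℝ) ^ k * μ.real E := by
    have hi := hψ.integrable _ _ ((hp k).star.mul (hp k))
    rw [hψ.integral _ _ ((hp k).star.mul (hp k))]
    refine (integral_re (𝕜 := ℂ) hi).symm.le.trans ?_
    have h1 : (1 / 2 : ℝ) ^ k * μ.real E = ∫ x, E.indicator (fun _ => (1 / 2 : ℝ) ^ k) x ∂μ := by
      rw [integral_indicator hE, setIntegral_const, smul_eq_mul, mul_comm]
    rw [h1]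
    refine integral_mono hi.re ((integrable_indicator_iff hE).2
      (integrableOn_const hEf.ne)) fun x => ?_
    by_cases hx : x ∈ E
    · simpa [P, hx] using (hEN k x hx).2.1
    · simp [P, hx]
  have hφ0 : Tendsto (fun k => φ (star (p k) * p k)) atTop (𝓝 0) := by
    have h1 (k) := Complex.le_def.1 (hφ.nonneg _ (hpM k))
    have h2 : Tendsto (fun k => (φ (star (p k) * p k)).re) atTop (𝓝 0) := by
      refine squeeze_zero (fun k => (h1 k).1) hφre ?_
      have h3 := (tendsto_pow_atTop_nhds_zero_of_lt_one (r := (1 / 2 : ℝ)) (by norm_num)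
        (by norm_num)).mul_const (μ.real E)
      rwa [zero_mul] at h3
    have h3 := (Complex.continuous_ofReal.tendsto _).comp h2
    refine h3.congr fun k => ?_
    exact Complex.ext rfl (h1 k).2
  have h1 := hφ.tendsto_norm_apply (hyperfilter ℕ) hpM hpC
    (hφ0.mono_left (by rw [← Nat.cofinite_eq_atTop]; exact hyperfilter_le_cofinite))
    (DirectIntegral.mk ζ)
  have h2 (k) : δ ^ 2 * μ.real E ≤ ‖p k (DirectIntegral.mk ζ)‖ ^ 2 := by
    have h3 : δ ^ 2 * μ.real E = ∫ x, E.indicator (fun _ => δ ^ 2) x ∂μ := by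
      rw [integral_indicator hE, setIntegral_const, smul_eq_mul, mul_comm]
    obtain ⟨hk, hk'⟩ := hp k
    rw [hk', DirectIntegral.norm_mk, L2.norm_sq_eq, h3]
    refine integral_mono ((integrable_indicator_iff hE).2
      (integrableOn_const hEf.ne)) (L2.integrable _) fun x => ?_
    by_cases hx : x ∈ E
    · simpa [P, hx] using pow_le_pow_left₀ hδ.le (hEN k x hx).2.2 2
    · simp [P, hx]
  exact (mul_pos (pow_pos hδ 2) hEr).not_ge (ge_of_tendsto h1 (Eventually.of_forall h2))

end IsFunctionalIntegral

end HilbertField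

/-- Faithfulness and `1 ≠ 0` give `φ 1 > 0`, so the trace can be normalized. -/
theorem IsNormalTrace.exists_isTracialState {K : Type u} [NormedAddCommGroup K]
    [InnerProductSpace ℂ K] [CompleteSpace K] {M : VonNeumannAlgebra K}
    {φ : (K →L[ℂ] K) →ₗ[ℂ] ℂ} (h : IsNormalTrace M φ) (h1 : (1 : K →L[ℂ] K) ≠ 0) :
    ∃ τ : M.toStarSubalgebra →ₗ[ℂ] ℂ, IsTracialState τ ∧
      ∃ r : ℂ, ∀ a : M.toStarSubalgebra, τ a = r * φ a := by
  have h2 := h.nonneg 1 (one_mem M)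
  have h3 : φ (star 1 * 1) ≠ 0 := fun h0 => h1 (h.faithful 1 (one_mem M) h0)
  rw [star_one, one_mul] at h2 h3
  have h4 := Complex.le_def.1 h2
  have h5 : φ 1 = ((φ 1).re : ℂ) := Complex.ext rfl h4.2.symm
  have h6 : 0 < (φ 1).re := lt_of_le_of_ne h4.1 fun h0 => h3 (by rw [h5, ← h0]; rfl)
  refine ⟨_, (h.smul (inv_pos.2 h6)).isTracialState ?_, _, fun a => rfl⟩
  change (((φ 1).re⁻¹ : ℝ) : ℂ) * φ 1 = 1
  rw [h5, Complex.ofReal_re, ← Complex.ofReal_mul, inv_mul_cancel₀ h6.ne', Complex.ofReal_one]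

/-! ### Traces and fiber values at almost every point. -/

namespace HilbertField

variable {X : Type u} [MeasurableSpace X] {μ : Measure X} {H : X → Type v}
  [∀ x, NormedAddCommGroup (H x)] [∀ x, InnerProductSpace ℂ (H x)] [∀ x, CompleteSpace (H x)]
  [SigmaFinite μ] {F : HilbertField μ H} {M : ∀ x, VonNeumannAlgebra (H x)}
  {R : F.integralAlgebra M → ∀ x, (M x).toStarSubalgebra}

/-- Countability of `S` reduces this to single identities, each of which holds almost everywhere by
uniqueness of the field of a decomposable operator. -/
theorem ae_isFiberMap {S : Set (F.integralAlgebra M)} (hSc : S.Countable)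
    (hR : ∀ s : F.integralAlgebra M, F.IsDirectIntegral s (fun x => (R s x : H x →L[ℂ] H x)))
    {A : ℕ → F.integralAlgebra M} {a : ℕ → ∀ x, H x →L[ℂ] H x}
    (hA : ∀ n, F.IsDirectIntegral (A n) (a n)) (hAS : ∀ n, A n ∈ S)
    (hM : ∀ᵐ x ∂μ, M x = generatedVonNeumannAlgebra (Set.range fun n => a n x)) :
    ∀ᵐ x ∂μ, IsFiberMap (M x) S (fun s => R s x) := by
  have h1 : ∀ᵐ x ∂μ, (R 1 x : H x →L[ℂ] H x) = 1 := (hR 1).ae_eq (IsDirectIntegral.one F)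
  have h2 : ∀ᵐ x ∂μ, ∀ s ∈ S, ∀ t ∈ S,
      (R (s + t) x : H x →L[ℂ] H x) = R s x + R t x :=
    (ae_ball_iff hSc).2 fun s _ => (ae_ball_iff hSc).2 fun t _ => (hR _).ae_eq ((hR s).add (hR t))
  have h3 : ∀ᵐ x ∂μ, ∀ s ∈ S, ∀ t ∈ S,
      (R (s * t) x : H x →L[ℂ] H x) = R s x * R t x :=
    (ae_ball_iff hSc).2 fun s _ => (ae_ball_iff hSc).2 fun t _ => (hR _).ae_eq ((hR s).mul (hR t))
  have h4 : ∀ᵐ x ∂μ, ∀ s ∈ S, (R (star s) x : H x →L[ℂ] H x) = star (R s x : H x →L[ℂ] H x) :=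
    (ae_ball_iff hSc).2 fun s _ => (hR _).ae_eq (hR s).star
  have h5 : ∀ᵐ x ∂μ, ∀ k : ℕ, ∀ s ∈ S, (R (TopologicalSpace.denseSeq ℂ k • s) x :
      H x →L[ℂ] H x) = TopologicalSpace.denseSeq ℂ k • (R s x : H x →L[ℂ] H x) :=
    ae_all_iff.2 fun k => (ae_ball_iff hSc).2 fun s _ => (hR _).ae_eq ((hR s).smul _)
  have h6 : ∀ᵐ x ∂μ, ∀ n, a n x = R (A n) x := ae_all_iff.2 fun n => (hA n).ae_eq (hR _)
  filter_upwards [h1, h2, h3, h4, h5, h6, hM] with x h1 h2 h3 h4 h5 h6 hM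
  refine ⟨Subtype.ext h1, fun s hs t ht => Subtype.ext (h2 s hs t ht),
    fun s hs t ht => Subtype.ext (h3 s hs t ht), fun s hs => Subtype.ext (h4 s hs),
    fun k s hs => Subtype.ext (h5 k s hs), fun b hb => ?_⟩
  rw [hM] at hb
  refine generatedVonNeumannAlgebra_mono ?_ hb
  rintro _ ⟨n, rfl⟩
  exact subset_generatedVonNeumannAlgebra _ ⟨A n, hAS n, (h6 n).symm⟩

namespace IsFunctionalIntegral

variable {φ : (F.DirectIntegral →L[ℂ] F.DirectIntegral) →ₗ[ℂ] ℂ}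
  {ψ : ∀ x, (H x →L[ℂ] H x) →ₗ[ℂ] ℂ}

omit [SigmaFinite μ] in
theorem diagonalOperators_commute {D A : F.DirectIntegral →L[ℂ] F.DirectIntegral}
    (hD : D ∈ F.diagonalOperators) (hA : A ∈ F.integralAlgebra M) : A * D = D * A := by
  obtain ⟨f, hf, hD⟩ := hD
  obtain ⟨T, hT, -⟩ := hA
  exact hT.commutesWithDiagonal f D hf hD

/-- Diagonal operators are central, so `φ (D * a * b) = φ (b * D * a) = φ (D * b * a)`, and the
identity localizes. -/
theorem ae_trace (hψ : F.IsFunctionalIntegral φ ψ) {hM : F.IsMeasurableAlgebraField M}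
    (hφ : IsNormalTrace (F.integralVonNeumannAlgebra hM) φ)
    (hR : ∀ s : F.integralAlgebra M, F.IsDirectIntegral s (fun x => (R s x : H x →L[ℂ] H x)))
    (a b : F.integralAlgebra M) :
    ∀ᵐ x ∂μ, ψ x (R (a * b) x) = ψ x (R (b * a) x) := by
  refine hψ.ae_eq (hR _) (hR _) fun D hD => ?_
  have hDM := diagonalOperators_subset_integralAlgebra hD M
  have h1 := hφ.trace (D * (a : F.DirectIntegral →L[ℂ] F.DirectIntegral)) (mul_mem hDM a.2) b b.2
  rw [mul_assoc, ← mul_assoc (b : F.DirectIntegral →L[ℂ] F.DirectIntegral),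
    diagonalOperators_commute hD b.2, mul_assoc] at h1
  exact h1

/-- For a central projection `D`, `D * star a * a` is `star (a * D) * (a * D)`. -/
theorem ae_nonneg_star_mul_self (hψ : F.IsFunctionalIntegral φ ψ)
    {hM : F.IsMeasurableAlgebraField M} (hφ : IsNormalTrace (F.integralVonNeumannAlgebra hM) φ)
    (hR : ∀ s : F.integralAlgebra M, F.IsDirectIntegral s (fun x => (R s x : H x →L[ℂ] H x)))
    (a : F.integralAlgebra M) : ∀ᵐ x ∂μ, 0 ≤ ψ x (R (star a * a) x) := by
  refine hψ.ae_nonneg (hR _) fun D hD hDs hDD => ?_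
  have hDM := diagonalOperators_subset_integralAlgebra hD M
  have h1 := hφ.nonneg ((a : F.DirectIntegral →L[ℂ] F.DirectIntegral) * D) (mul_mem a.2 hDM)
  rw [star_mul, hDs, diagonalOperators_commute hD a.2, mul_assoc,
    ← mul_assoc _ D, diagonalOperators_commute hD (star_mem a.2), mul_assoc,
    ← mul_assoc D, hDD] at h1
  exact h1

omit [SigmaFinite μ] in
-- Since `θ` fixes `D`, `θ (D * a) = D * θ a`, and the global invariance of the trace localizes.
-- This is where triviality on the diagonal algebra enters.
theorem ae_map_eq (hψ : F.IsFunctionalIntegral φ ψ)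
    (hR : ∀ s : F.integralAlgebra M, F.IsDirectIntegral s (fun x => (R s x : H x →L[ℂ] H x)))
    {θ : F.integralAlgebra M ≃⋆ₐ[ℂ] F.integralAlgebra M} (hθ : F.FixesDiagonal M θ)
    (hφθ : ∀ a, φ (θ a : F.DirectIntegral →L[ℂ] F.DirectIntegral) = φ a)
    (a : F.integralAlgebra M) : ∀ᵐ x ∂μ, ψ x (R (θ a) x) = ψ x (R a x) := by
  refine hψ.ae_eq (hR _) (hR _) fun D hD => ?_
  let D' : F.integralAlgebra M := ⟨D, diagonalOperators_subset_integralAlgebra hD M⟩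
  obtain ⟨f, hf, hD⟩ := hD
  have h1 : θ (D' * a) = D' * θ a := by rw [map_mul, hθ f hf D' hD]
  have h2 := hφθ (D' * a)
  rw [h1] at h2
  exact h2

/-- Almost every functional in the disintegration of a faithful normal trace is a faithful normal
trace. -/
theorem ae_isNormalTrace (hψ : F.IsFunctionalIntegral φ ψ) {hM : F.IsMeasurableAlgebraField M}
    (hφ : IsNormalTrace (F.integralVonNeumannAlgebra hM) φ)
    (hR : ∀ s : F.integralAlgebra M, F.IsDirectIntegral s (fun x => (R s x : H x →L[ℂ] H x)))
    {S : Set (F.integralAlgebra M)} (hS : IsStableSet S) (hSc : S.Countable)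
    (hr : ∀ᵐ x ∂μ, IsFiberMap (M x) S (fun s => R s x)) :
    ∀ᵐ x ∂μ, IsNormalTrace (M x) (ψ x) := by
  obtain ⟨ζ, hζ⟩ := F.exists_isTotal
  obtain ⟨s, hs⟩ := hSc.exists_eq_range ⟨1, hS.one_mem⟩
  have h1 : ∀ᵐ x ∂μ, ∀ a ∈ S, ∀ b ∈ S, ψ x (R (a * b) x) = ψ x (R (b * a) x) :=
    (ae_ball_iff hSc).2 fun a _ => (ae_ball_iff hSc).2 fun b _ => hψ.ae_trace hφ hR a b
  have h2 : ∀ᵐ x ∂μ, ∀ a ∈ S, 0 ≤ ψ x (R (star a * a) x) :=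
    (ae_ball_iff hSc).2 fun a _ => hψ.ae_nonneg_star_mul_self hφ hR a
  -- Failure of faithfulness is witnessed by one of countably many triples of natural numbers; each
  -- is excluded almost everywhere.
  have h3 : ∀ᵐ x ∂μ, ∀ n C m : ℕ, ¬ ∀ k : ℕ, ∃ i, ‖(R (s i) x : H x →L[ℂ] H x)‖ ≤ C ∧
      (ψ x (star (R (s i) x : H x →L[ℂ] H x) * R (s i) x)).re ≤ (1 / 2 : ℝ) ^ k ∧
      1 / ((m : ℝ) + 1) ≤ ‖(R (s i) x : H x →L[ℂ] H x) (ζ n x)‖ :=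
    ae_all_iff.2 fun n => ae_all_iff.2 fun C => ae_all_iff.2 fun m =>
      hψ.ae_not_forall_exists hM hφ (fun i => hR (s i))
        (Eventually.of_forall fun x i => (R (s i) x).2) (ζ n) (Nat.cast_nonneg C)
        Nat.one_div_pos_of_nat
  filter_upwards [h1, h2, h3, hζ, hr] with x h1 h2 h3 hζ hr
  refine (hr.isNormalTrace_or_exists hS (hψ.normal x) h1 h2 hζ).resolve_right ?_
  rintro ⟨n, C, m, h⟩
  refine h3 n C m fun k => ?_
  obtain ⟨a, ha, h4, h5, h6⟩ := h k
  rw [hr.map_mul _ (hS.star_mem a ha) a ha, hr.map_star a ha] at h5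
  rw [hs] at ha
  obtain ⟨i, rfl⟩ := ha
  exact ⟨i, h4, h5, h6⟩

end IsFunctionalIntegral

end HilbertField

/-- A cocycle action on a stable set which preserves a faithful trace on the fiber extends to a
cocycle action on the fiber. -/
theorem IsFiberMap.exists_isCocycleAction {K : Type u} [NormedAddCommGroup K]
    [InnerProductSpace ℂ K] [CompleteSpace K] {M : VonNeumannAlgebra K} {E : Type*} [Ring E]
    [StarRing E] [Algebra ℂ E] {S : Set E} {r : E → M.toStarSubalgebra} (hr : IsFiberMap M S r)
    (hS : IsStableSet S) {φ : (K →L[ℂ] K) →ₗ[ℂ] ℂ} (hφ : IsNormalTrace M φ)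
    (h1 : (1 : K →L[ℂ] K) ≠ 0) {B : Type w} [Group B]
    {α : B → (E ≃⋆ₐ[ℂ] E)} {c : B → B → unitary E}
    (hα : ∀ g, ∀ a ∈ S, α g a ∈ S) (hα' : ∀ g, ∀ a ∈ S, (α g).symm a ∈ S)
    (hc : ∀ g h, (c g h : E) ∈ S) (hφα : ∀ g, ∀ a ∈ S, φ (r (α g a)) = φ (r a))
    (hmap : ∀ g h a, α g (α h a) = (c g h : E) * α (g * h) a * star (c g h : E))
    (hcoc : ∀ g h k, (c g h : E) * (c (g * h) k : E) = α g (c h k : E) * (c g (h * k) : E))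
    (hc1 : ∀ g, c g 1 = 1) (h1c : ∀ g, c 1 g = 1) :
    ∃ p : (B → (M.toStarSubalgebra ≃⋆ₐ[ℂ] M.toStarSubalgebra)) ×
        (B → B → unitary M.toStarSubalgebra),
      (∃ τ : M.toStarSubalgebra →ₗ[ℂ] ℂ, IsTracialState τ ∧ IsCocycleAction τ p.1 p.2) ∧
      (∀ g h, (p.2 g h : M.toStarSubalgebra) = r (c g h)) ∧
      ∀ g, ∀ b b' : M.toStarSubalgebra, (∀ a ∈ S,
        φ ((b * r a : M.toStarSubalgebra) : K →L[ℂ] K) =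
        φ ((b' * r (α g a) : M.toStarSubalgebra) : K →L[ℂ] K)) → p.1 g b = b' := by
  obtain ⟨α', c', h2, h3, h4, h5, h6, h7, h8⟩ :=
    hr.exists_cocycleAction hS hφ hα hα' hc hφα hmap hcoc hc1 h1c
  obtain ⟨τ, hτ, s, hs⟩ := hφ.exists_isTracialState h1
  exact ⟨(α', c'), ⟨τ, hτ, ⟨fun g a => by rw [hs, hs, h2], h3, h4, h5, h6⟩⟩, h7, h8⟩

theorem IsTracialState.one_ne_zero {K : Type u} [NormedAddCommGroup K]
    [InnerProductSpace ℂ K] [CompleteSpace K] {M : StarSubalgebra ℂ (K →L[ℂ] K)}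
    {τ : M →ₗ[ℂ] ℂ} (h : IsTracialState τ) : (1 : K →L[ℂ] K) ≠ 0 := by
  intro h0
  have h1 : (1 : M) = 0 := Subtype.ext h0
  have h2 := h.map_one
  rw [h1, map_zero] at h2
  exact zero_ne_one h2

/-- A countable set in a `*`-algebra with a cocycle action of a countable group is contained in a
countable stable set which is invariant under the action. -/
theorem exists_invariant_isStableSet {E : Type*} [Ring E] [StarRing E] [Algebra ℂ E] {B : Type w}
    [Countable B] (α : B → (E ≃⋆ₐ[ℂ] E)) {S₀ : Set E} (hS₀ : S₀.Countable) :
    ∃ S : Set E, S.Countable ∧ S₀ ⊆ S ∧ IsStableSet S ∧ (∀ g, ∀ a ∈ S, α g a ∈ S) ∧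
      ∀ g, ∀ a ∈ S, (α g).symm a ∈ S := by
  obtain ⟨S, hSc, hS0, h1, h2⟩ := exists_countable_stable (E := E) (ι := Option ℕ ⊕ B ⊕ B)
    (κ := Bool)
    (Sum.elim (fun o => o.elim star fun k a => TopologicalSpace.denseSeq ℂ k • a)
      (Sum.elim (fun g => α g) fun g => (α g).symm))
    (fun k a b => if k then a * b else a + b) (hS₀.insert 1)
  refine ⟨S, hSc, (Set.subset_insert _ _).trans hS0, ⟨hS0 (Set.mem_insert _ _),
    fun a ha b hb => by simpa using h2 false a ha b hb,
    fun a ha b hb => by simpa using h2 true a ha b hb, h1 (Sum.inl none),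
    fun k => h1 (Sum.inl (some k))⟩, fun g => h1 (Sum.inr (Sum.inl g)),
    fun g => h1 (Sum.inr (Sum.inr g))⟩

/-- The choice need not be measurable. In the application measurability follows from the identities
satisfied by the chosen objects. -/
theorem exists_forall_of_ae_exists {X : Type u} [MeasurableSpace X] {μ : Measure X} {β : X → Type w}
    [∀ x, Nonempty (β x)] {P : ∀ x, β x → Prop} (h : ∀ᵐ x ∂μ, ∃ b, P x b) :
    ∃ b : ∀ x, β x, ∀ᵐ x ∂μ, P x (b x) :=
  ⟨fun x => Classical.epsilon (P x), h.mono fun _ hx => Classical.epsilon_spec hx⟩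

/-! ### Assembling the decomposition of the cocycle action. -/

namespace HilbertField

variable {X : Type u} [MeasurableSpace X] {μ : Measure X} {H : X → Type v}
  [∀ x, NormedAddCommGroup (H x)] [∀ x, InnerProductSpace ℂ (H x)] [∀ x, CompleteSpace (H x)]
  [SigmaFinite μ] {F : HilbertField μ H} {M : ∀ x, VonNeumannAlgebra (H x)}

/-- A cocycle action on a direct integral of tracial von Neumann algebras which acts trivially on
the diagonal algebra is decomposable. -/
theorem exists_isCocycleDecomposition (hM : F.IsMeasurableAlgebraField M)
    (hMτ : ∀ᵐ x ∂μ, ∃ σ : (M x).toStarSubalgebra →ₗ[ℂ] ℂ, IsTracialState σ)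
    {τ : F.integralAlgebra M →ₗ[ℂ] ℂ} (hτ : IsTracialState τ)
    {B : Type w} [Group B] [Countable B]
    {α : B → (F.integralAlgebra M ≃⋆ₐ[ℂ] F.integralAlgebra M)}
    {c : B → B → unitary (F.integralAlgebra M)}
    (hαc : IsCocycleAction τ α c) (hα : ∀ g, F.FixesDiagonal M (α g)) :
    ∃ (α' : ∀ x, B → ((M x).toStarSubalgebra ≃⋆ₐ[ℂ] (M x).toStarSubalgebra))
      (c' : ∀ x, B → B → unitary (M x).toStarSubalgebra),
      F.IsCocycleDecomposition M α c α' c' := by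
  classical
  obtain ⟨φ, hφ, hτφ⟩ :=
    IsTracialState.exists_isNormalTrace (M := F.integralVonNeumannAlgebra hM) hτ
  obtain ⟨ψ, hψ⟩ := exists_isFunctionalIntegral hφ.normal
  have hex := hM.exists_generators
  choose A a hA hgen using hex
  obtain ⟨S, hSc, hS0, hS, hSα, hSα'⟩ := exists_invariant_isStableSet α
    (S₀ := Set.range A ∪ Set.range fun y : B × B => (c y.1 y.2 : F.integralAlgebra M))
    ((Set.countable_range _).union (Set.countable_range _))
  choose R hR using fun s : F.integralAlgebra M => exists_fiber_field s.2
  have hSr (g h : B) : (c g h : F.integralAlgebra M) ∈ S := hS0 (Or.inr ⟨(g, h), rfl⟩)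
  have hr := ae_isFiberMap hSc hR hA (fun n => hS0 (Or.inl ⟨n, rfl⟩)) hgen
  have htr := hψ.ae_isNormalTrace hφ hR hS hSc hr
  have hφα (g) (a : F.integralAlgebra M) :
      φ (α g a : F.DirectIntegral →L[ℂ] F.DirectIntegral) = φ a := by
    have h1 := hαc.trace_preserving g a
    exact (hτφ _).symm.trans (h1.trans (hτφ _))
  have hψα : ∀ᵐ x ∂μ, ∀ g, ∀ a ∈ S, ψ x (R (α g a) x) = ψ x (R a x) :=
    ae_all_iff.2 fun g => (ae_ball_iff hSc).2 fun a _ => hψ.ae_map_eq hR (hα g) (hφα g) a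
  have hex : ∀ᵐ x ∂μ, ∃ p : (B → ((M x).toStarSubalgebra ≃⋆ₐ[ℂ] (M x).toStarSubalgebra)) ×
        (B → B → unitary (M x).toStarSubalgebra),
      (∃ τ : (M x).toStarSubalgebra →ₗ[ℂ] ℂ, IsTracialState τ ∧ IsCocycleAction τ p.1 p.2) ∧
      (∀ g h, (p.2 g h : (M x).toStarSubalgebra) = R (c g h) x) ∧
      ∀ g, ∀ b b' : (M x).toStarSubalgebra, (∀ a ∈ S,
        ψ x ((b * R a x : (M x).toStarSubalgebra) : H x →L[ℂ] H x) =
        ψ x ((b' * R (α g a) x : (M x).toStarSubalgebra) : H x →L[ℂ] H x)) → p.1 g b = b' := by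
    filter_upwards [hr, htr, hψα, hMτ] with x hr htr hψα hσ
    -- The given trace on the fiber serves only to exclude the zero fiber; the invariant trace comes
    -- from `ψ x`.
    obtain ⟨σ, hσ⟩ := hσ
    exact hr.exists_isCocycleAction hS htr hσ.one_ne_zero hSα hSα' hSr hψα hαc.map_map
      hαc.cocycle hαc.right_one hαc.left_one
  have hne (x) : Nonempty ((B → ((M x).toStarSubalgebra ≃⋆ₐ[ℂ] (M x).toStarSubalgebra)) ×
      (B → B → unitary (M x).toStarSubalgebra)) := ⟨(fun _ => StarAlgEquiv.refl ℂ _, fun _ _ => 1)⟩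
  have hsel := exists_forall_of_ae_exists hex
  clear hex
  obtain ⟨p, hp⟩ := hsel
  have hcoc (g h) : F.IsDirectIntegral ((c g h : F.integralAlgebra M) : _ →L[ℂ] _)
      (fun x => (((p x).2 g h : (M x).toStarSubalgebra) : H x →L[ℂ] H x)) := by
    refine (hR (c g h)).congr ?_
    filter_upwards [hp] with x hx
    rw [hx.2.1]
  -- At almost every `x` the pairing of `T x` with `R s x` is that of `R (α g b) x` with `R (α g s)
  -- x`, because `ψ x` takes equal values on the fibers of `b * s` and `α g (b * s)`. This
  -- characterizes the image of `T x`, so the identity holds for every `b`, not only for `b` in `S`.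
  have haut (g) (b : F.integralAlgebra M) (T : ∀ x, (M x).toStarSubalgebra)
      (hT : F.IsDirectIntegral b (fun x => (T x : H x →L[ℂ] H x))) :
      F.IsDirectIntegral (α g b) (fun x => ((p x).1 g (T x) : H x →L[ℂ] H x)) := by
    refine (hR (α g b)).congr ?_
    have h1 : ∀ᵐ x ∂μ, ∀ s ∈ S, ψ x (R (b * s) x) = ψ x (R (α g (b * s)) x) :=
      (ae_ball_iff hSc).2 fun s _ =>
        (hψ.ae_map_eq hR (hα g) (hφα g) (b * s)).mono fun x hx => hx.symm
    have h2 : ∀ᵐ x ∂μ, ∀ s ∈ S, (R (b * s) x : H x →L[ℂ] H x) = T x * R s x :=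
      (ae_ball_iff hSc).2 fun s _ => (hR _).ae_eq (hT.mul (hR s))
    have h3 : ∀ᵐ x ∂μ, ∀ s ∈ S, (R (α g (b * s)) x : H x →L[ℂ] H x) =
        R (α g b) x * R (α g s) x :=
      (ae_ball_iff hSc).2 fun s _ => (hR _).ae_eq (by
        rw [map_mul]
        exact (hR _).mul (hR _))
    filter_upwards [hp, h1, h2, h3] with x hx h1 h2 h3
    rw [hx.2.2 g (T x) (R (α g b) x)]
    intro s hs
    have h4 := h1 s hs
    rw [h2 s hs, h3 s hs] at h4
    exact h4
  refine ⟨fun x => (p x).1, fun x => (p x).2, ⟨hp.mono fun x hx => hx.1, fun g T hT => ?_,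
    fun g h => (hcoc g h).1.aemeasurable⟩, haut, hcoc⟩
  -- A measurable field with values in the fibers integrates to some `b`, and the image field
  -- decomposes `α g b`, hence is measurable.
  obtain ⟨b, hb⟩ := hT.exists_isDirectIntegral
  exact (haut g ⟨b, _, hb, Eventually.of_forall fun x => (T x).2⟩ T hb).1

end HilbertField

end

theorem mainTheorem12 {X : Type u} [TopologicalSpace X] [T2Space X] [LocallyCompactSpace X]
    [SigmaCompactSpace X] [MeasurableSpace X] [BorelSpace X] (μ : Measure X) [μ.Regular]
    {H : X → Type v} [∀ x, NormedAddCommGroup (H x)] [∀ x, InnerProductSpace ℂ (H x)]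
    [∀ x, CompleteSpace (H x)] (F : HilbertField μ H)
    (M : ∀ x, VonNeumannAlgebra (H x)) (hM : F.IsMeasurableAlgebraField M)
    (hMτ : ∀ᵐ x ∂μ, ∃ σ : (M x).toStarSubalgebra →ₗ[ℂ] ℂ, IsTracialState σ)
    (τ : F.integralAlgebra M →ₗ[ℂ] ℂ) (hτ : IsTracialState τ)
    {B : Type w} [Group B] [Countable B]
    (α : B → (F.integralAlgebra M ≃⋆ₐ[ℂ] F.integralAlgebra M))
    (c : B → B → unitary (F.integralAlgebra M))
    (hαc : IsCocycleAction τ α c) (hα : ∀ g, F.FixesDiagonal M (α g)) :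
    (∃ (α' : ∀ x, B → ((M x).toStarSubalgebra ≃⋆ₐ[ℂ] (M x).toStarSubalgebra))
        (c' : ∀ x, B → B → unitary (M x).toStarSubalgebra),
        F.IsCocycleDecomposition M α c α' c') ∧
    ∀ (α' : ∀ x, B → ((M x).toStarSubalgebra ≃⋆ₐ[ℂ] (M x).toStarSubalgebra))
      (c' : ∀ x, B → B → unitary (M x).toStarSubalgebra),
      F.IsCocycleDecomposition M α c α' c' →
      (F.ellTwo B).IsMeasurableAlgebraField (fun x => cocycleCrossedProduct (α' x) (c' x)) ∧
      ∃ Φ : (cocycleCrossedProduct α c).toStarSubalgebra ≃⋆ₐ[ℂ]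
          (F.ellTwo B).integralAlgebra (fun x => cocycleCrossedProduct (α' x) (c' x)),
        (∀ (a : F.integralAlgebra M) (a' : ∀ x, (M x).toStarSubalgebra),
          F.IsDirectIntegral a (fun x => (a' x : H x →L[ℂ] H x)) →
          ∃ (T : (cocycleCrossedProduct α c).toStarSubalgebra)
            (T' : ∀ x, lp (fun _ : B => H x) 2 →L[ℂ] lp (fun _ : B => H x) 2),
            IsCopy α a T ∧ (∀ᵐ x ∂μ, IsCopy (α' x) (a' x) (T' x)) ∧
              (F.ellTwo B).IsDirectIntegral (Φ T) T') ∧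
        ∀ g : B, ∃ (U : (cocycleCrossedProduct α c).toStarSubalgebra)
            (U' : ∀ x, lp (fun _ : B => H x) 2 →L[ℂ] lp (fun _ : B => H x) 2),
            IsCanonicalUnitary α c g U ∧ (∀ᵐ x ∂μ, IsCanonicalUnitary (α' x) (c' x) g (U' x)) ∧
              (F.ellTwo B).IsDirectIntegral (Φ U) U' := by
  -- A regular measure is finite on compact sets, and `X` is a countable union of these.
  have : SigmaFinite μ := inferInstance
  exact ⟨HilbertField.exists_isCocycleDecomposition hM hMτ hτ hαc hα,
    fun α' c' h => h.exists_crossedProduct_equiv hM⟩
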